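/- Let $d\ge 1$, let $H\subset \mathrm{GL}(d,\mathbb R)$ be a closed abelian subgroup, and let $dh$ be a left Haar measure and $\Delta_H$ the modular function of $H$. Let $|\cdot|$ be the euclidean norm on $\mathbb R^d$ and $\|h\|$ the associated operator norm. Assume that $H$ is irreducibly admissible, that is, the quasi-regular representation $$[\pi(x,h)f](y)=|\det h|^{-1/2}f(h^{-1}(y-x))$$ of $G=\mathbb R^d\rtimes H$ on $L^2(\mathbb R^d)$ is irreducible (no closed invariant subspaces except $0$ and $L^2(\mathbb R^d)$) and square-integrable (for some $\psi\neq 0$ the function $(x,h)\mapsto\langle\psi,\pi(x,h)\psi\rangle$ is square-integrable with respect to the left Haar measure $|\det h|^{-1}\,dx\,dh$ of $G$). A commutative real algebra $\mathcal A\ne 0$ with unity is called irreducible if $\mathcal A=\mathbb K\cdot 1_{\mathcal A}+\mathcal N$, where $\mathcal N$ is the set of nilpotent elements and either $\mathbb K=\mathbb R$, or $\mathbb K=\mathbb C$ for some complex algebra structure on $\mathcal A$ extending the real one. Its nilpotency class is the least $n$ with $\mathcal N^n=\{0\}$. A block decomposition of $H$ consists of $g\in\mathrm{GL}(d,\mathbb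 R)$, sizes $d_1,\dots,d_k$ with $d_1+\dots+d_k=d$, and irreducible algebras $\mathcal A_i\subset\mathbb R^{d_i\times d_i}$ such that, up to a numbering of the coordinates by blocks, $g^{-1}Hg$ is the group of all block diagonal matrices with $i$-th block in $\mathcal A_i^\times$ ($i=1,\dots,k$). Then $H$ has a block decomposition, and there is exactly one open orbit $\mathcal O=\{h^T\xi_0:h\in H\}\subset\mathbb R^d$ of the dual action. Put $$A(\xi)=\min\left(\frac{\operatorname{dist}(\xi,\mathcal O^c)}{1+\sqrt{|\xi|^2-\operatorname{dist}(\xi,\mathcal O^c)^2}},\ \frac1{1+|\xi|}\right),\qquad \Phi_\ell(h)=\int_{\mathbb R^d}A(\xi)^\ell A(h^T\xi)^\ell\,d\xi\in[0,\infty].$$ (1) For every block decomposition of $H$, with $n$ the maximum of the nilpotency classes of its blocks $\mathcal A_1,\dots,\mathcal A_k$, and for every $\xi_0\in\mathcal O$, there is a constant $C$ such that for all $h\in H$ $$\|h^{\pm1}\|\,A(h^T\xi_0)^{e_2}\le C,\qquad |\det(h^{\pm1})|\,A(h^T\xi_0)^{e_3}\le C,\qquad \Delta_H(h^{\pm1})\,A(h^T\xi_0)^{e_4}\le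 C,$$ with $e_2=2n-1$, $e_3=d$, $e_4=0$. (2) Let $w_0:H\to(0,\infty)$ be a polynomially bounded weight, that is, $w_0$ is continuous, $w_0(hh')\le w_0(h)w_0(h')$, and $w_0(h)\le C(1+\|h\|)^k(1+\|h^{-1}\|)^k$ for some $k\in\mathbb N$ and $C>0$; and let $s\ge 0$. Then: (a) for every $q\in[1,\infty)$, $\mathcal O$ is $(s,q,w_0)$-temperately embedded with some index $\ell\in\mathbb N$: for all $\xi_0\in\mathcal O$, the function $h\mapsto|\det h|^{1/2-1/q}(1+\|h\|)^{s+d+1}w_0(h)A(h^T\xi_0)^\ell$ is in $L^q(H)$ and the function $h\mapsto|\det h|^{-1/2-1/q}(1+\|h\|)^{s+d+1}w_0(h)A(h^{-T}\xi_0)^\ell$ is in $L^1(H)$; (b) $\mathcal O$ is strongly $(s,w_0)$-temperately embedded with some index $\ell\in\mathbb N$: $\Phi_\ell$ belongs to the Wiener amalgam space $W(C^0,L^1_m)$ for $m(h)=w_0(h)|\det h|^{-1/2}(1+\|h\|)^{2(s+d+1)}$, that is, $\Phi_\ell$ is finite and continuous on $H$, and for every compact neighbourhood $U\subset H$ of the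 identity $$\int_H\sup_{u\in U}\Phi_\ell(hu)\,m(h)\,dh<\infty .$$ -/

import Mathlib

open MeasureTheory Topology
open scoped ENNReal MatrixGroups

noncomputable section

namespace AbelianDilation

/-- Euclidean space of dimension `d`. -/
abbrev Euc (d : ℕ) : Type := EuclideanSpace ℝ (Fin d)

/-- The linear action of a matrix on Euclidean space. -/
abbrev act {d : ℕ} (A : Matrix (Fin d) (Fin d) ℝ) : Euc d →L[ℝ] Euc d :=
  Matrix.toEuclideanCLM (n := Fin d) (𝕜 := ℝ) A

/-- The operator norm `‖h‖` of a matrix with respect to the Euclidean norm. -/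
def opNorm {d : ℕ} (h : GL (Fin d) ℝ) : ℝ := ‖act h.val‖

/-- `|det h|`. -/
def absDet {d : ℕ} (h : GL (Fin d) ℝ) : ℝ := |h.val.det|

/-- The dual action `ξ ↦ hᵀ ξ`. -/
def dualAct {d : ℕ} (h : GL (Fin d) ℝ) (ξ : Euc d) : Euc d := act h.val.transpose ξ

/-! ### The quasi-regular representation and irreducible admissibility -/

theorem memLp_comp_affine {d : ℕ} (x : Euc d) (h : GL (Fin d) ℝ) {f : Euc d → ℂ}
    (hf : MemLp f 2 volume) :
    MemLp (fun y => ((absDet h ^ (-(1 / 2) : ℝ) : ℝ) : ℂ) * f (act (h⁻¹).val (y - x))) 2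
      volume := by
  have hdet : LinearMap.det ((act (h⁻¹).val : Euc d →L[ℝ] Euc d) : Euc d →ₗ[ℝ] Euc d) ≠ 0 := by
    intro h0
    have hinv : ((act (h⁻¹).val : Euc d →L[ℝ] Euc d) : Euc d →ₗ[ℝ] Euc d) ∘ₗ
        ((act h.val : Euc d →L[ℝ] Euc d) : Euc d →ₗ[ℝ] Euc d) = LinearMap.id := by
      have hmul : act (h⁻¹).val * act h.val = 1 := by
        rw [act, act, ← map_mul, ← Units.val_mul, inv_mul_cancel, Units.val_one, map_one]
      ext1 v
      exact DFunLike.congr_fun hmul v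
    have := congrArg LinearMap.det hinv
    rw [LinearMap.det_comp, h0, zero_mul, LinearMap.det_id] at this
    exact zero_ne_one this
  have h1 : MemLp f 2 (Measure.map (act (h⁻¹).val) volume) := by
    have := Measure.map_linearMap_addHaar_eq_smul_addHaar (volume : Measure (Euc d)) hdet
    rw [show (Measure.map (act (h⁻¹).val) (volume : Measure (Euc d))) = _ from this]
    exact hf.smul_measure ENNReal.ofReal_ne_top
  have h2 : MemLp (f ∘ act (h⁻¹).val) 2 volume :=
    (memLp_map_measure_iff h1.1 (act (h⁻¹).val).continuous.aemeasurable).1 h1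
  exact (h2.comp_measurePreserving (measurePreserving_sub_right volume x)).const_mul _

/-- The quasi-regular representation on `L²(ℝᵈ)`:
`(π(x,h) f)(y) = |det h|^{-1/2} f(h⁻¹ (y - x))`. -/
def quasiRegular {d : ℕ} (x : Euc d) (h : GL (Fin d) ℝ)
    (f : Lp ℂ 2 (volume : Measure (Euc d))) : Lp ℂ 2 (volume : Measure (Euc d)) :=
  (memLp_comp_affine x h (Lp.memLp f)).toLp _

/-- The quasi-regular representation of `ℝᵈ ⋊ H` is irreducible: the only closed invariant
subspaces of `L²(ℝᵈ)` are `0` and the whole space. -/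
def QuasiRegularIrreducible {d : ℕ} (H : Subgroup (GL (Fin d) ℝ)) : Prop :=
  ∀ V : Submodule ℂ (Lp ℂ 2 (volume : Measure (Euc d))),
    IsClosed (V : Set (Lp ℂ 2 (volume : Measure (Euc d)))) →
    (∀ (x : Euc d) (h : H), ∀ f ∈ V, quasiRegular x h.1 f ∈ V) → V = ⊥ ∨ V = ⊤

/-- The left Haar measure `|det h|⁻¹ dx dh` of the affine group `ℝᵈ ⋊ H`, where `μ` is a left Haar
measure `dh` of `H`. -/
def affineHaar {d : ℕ} (H : Subgroup (GL (Fin d) ℝ)) [MeasurableSpace H] (μ : Measure H) :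
    Measure (Euc d × H) :=
  (volume : Measure (Euc d)).prod (μ.withDensity fun h => ENNReal.ofReal (absDet h.1)⁻¹)

/-- `H` is irreducibly admissible: the quasi-regular representation of `ℝᵈ ⋊ H` is irreducible and
square-integrable, i.e. some nonzero `ψ` has a square-integrable matrix coefficient
`(x,h) ↦ ⟨ψ, π(x,h) ψ⟩`. -/
def IrreduciblyAdmissible {d : ℕ} (H : Subgroup (GL (Fin d) ℝ)) [MeasurableSpace H]
    (μ : Measure H) : Prop :=
  QuasiRegularIrreducible H ∧
  ∃ ψ : Lp ℂ 2 (volume : Measure (Euc d)), ψ ≠ 0 ∧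
    MemLp (fun p : Euc d × H => inner ℂ (quasiRegular p.1 p.2.1 ψ) ψ) 2 (affineHaar H μ)

/-! ### The open dual orbit and the auxiliary functions -/

/-- The orbit `{hᵀ ξ : h ∈ H}` of the dual action. -/
def dualOrbit {d : ℕ} (H : Subgroup (GL (Fin d) ℝ)) (ξ : Euc d) : Set (Euc d) :=
  Set.range fun h : H => dualAct h.1 ξ

/-- `O` is an open orbit of the dual action. -/
def IsOpenDualOrbit {d : ℕ} (H : Subgroup (GL (Fin d) ℝ)) (O : Set (Euc d)) : Prop :=
  IsOpen O ∧ ∃ ξ, O = dualOrbit H ξ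

/-- The envelope function
`A(ξ) = min (dist(ξ,Oᶜ) / (1 + √(|ξ|² - dist(ξ,Oᶜ)²))) (1 / (1 + |ξ|))`;
the formula gives the value `0` on the closed set `Oᶜ`. -/
def envelope {d : ℕ} (O : Set (Euc d)) (ξ : Euc d) : ℝ :=
  min (Metric.infDist ξ Oᶜ / (1 + Real.sqrt (‖ξ‖ ^ 2 - Metric.infDist ξ Oᶜ ^ 2)))
    (1 / (1 + ‖ξ‖))

/-- `Φ_ℓ(h) = ∫ A(ξ)^ℓ A(hᵀ ξ)^ℓ dξ`, with values in `[0,∞]`. -/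
def auxPhi {d : ℕ} (O : Set (Euc d)) (l : ℕ) (h : GL (Fin d) ℝ) : ℝ≥0∞ :=
  ∫⁻ ξ, ENNReal.ofReal (envelope O ξ ^ l * envelope O (dualAct h ξ) ^ l)

/-! ### The decay estimates -/

/-- The modular function of `H`, normalised by `μ(E h) = Δ(h) μ(E)` for the left Haar measure
`μ`. -/
def modularFn {d : ℕ} (H : Subgroup (GL (Fin d) ℝ)) [MeasurableSpace H] [BorelSpace H]
    (μ : Measure H) [μ.IsHaarMeasure] (h : H) : ℝ :=
  (Measure.haarScalarFactor (Measure.map (· * h⁻¹) μ) μ : ℝ)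

/-- `‖h^{±1}‖ A(hᵀ ξ₀)^e ≤ C` on `H`. -/
def NormDecay {d : ℕ} (H : Subgroup (GL (Fin d) ℝ)) (O : Set (Euc d)) (ξ₀ : Euc d)
    (e : ℝ) : Prop :=
  ∃ C : ℝ, ∀ h : H, opNorm h.1 * envelope O (dualAct h.1 ξ₀) ^ e ≤ C ∧
    opNorm (h.1)⁻¹ * envelope O (dualAct h.1 ξ₀) ^ e ≤ C

/-- `|det h^{±1}| A(hᵀ ξ₀)^e ≤ C` on `H`. -/
def DetDecay {d : ℕ} (H : Subgroup (GL (Fin d) ℝ)) (O : Set (Euc d)) (ξ₀ : Euc d)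
    (e : ℝ) : Prop :=
  ∃ C : ℝ, ∀ h : H, absDet h.1 * envelope O (dualAct h.1 ξ₀) ^ e ≤ C ∧
    absDet (h.1)⁻¹ * envelope O (dualAct h.1 ξ₀) ^ e ≤ C

/-- `Δ_H(h^{±1}) A(hᵀ ξ₀)^e ≤ C` on `H`. -/
def ModularDecay {d : ℕ} (H : Subgroup (GL (Fin d) ℝ)) [MeasurableSpace H] [BorelSpace H]
    (μ : Measure H) [μ.IsHaarMeasure] (O : Set (Euc d)) (ξ₀ : Euc d) (e : ℝ) : Prop :=
  ∃ C : ℝ, ∀ h : H, modularFn H μ h * envelope O (dualAct h.1 ξ₀) ^ e ≤ C ∧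
    modularFn H μ h⁻¹ * envelope O (dualAct h.1 ξ₀) ^ e ≤ C

/-! ### Weights and (strong) temperate embeddedness -/

/-- A weight on a group: continuous, strictly positive and submultiplicative. -/
structure IsWeight {K : Type*} [Group K] [TopologicalSpace K] (w : K → ℝ) : Prop where
  continuous : Continuous w
  pos : ∀ x, 0 < w x
  submul : ∀ x y, w (x * y) ≤ w x * w y

/-- `w(h) ≤ C (1 + ‖h‖)^k (1 + ‖h⁻¹‖)^k` on `H`, for some `k` and `C`. -/
def PolynomiallyBounded {d : ℕ} (H : Subgroup (GL (Fin d) ℝ)) (w : H → ℝ) : Prop :=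
  ∃ (k : ℕ) (C : ℝ), ∀ h : H, w h ≤ C * ((1 + opNorm h.1) ^ k * (1 + opNorm (h.1)⁻¹) ^ k)

/-- `O` is `(s,q,w)`-temperately embedded with index `l`. The condition does not depend on the
choice of the base point `ξ₀` in the orbit; here it is required for all of them. -/
def TemperatelyEmbedded {d : ℕ} (H : Subgroup (GL (Fin d) ℝ)) [MeasurableSpace H]
    (μ : Measure H) (O : Set (Euc d)) (s q : ℝ) (w : H → ℝ) (l : ℕ) : Prop :=
  ∀ ξ₀ ∈ O,
    MemLp (fun h : H => absDet h.1 ^ (1 / 2 - 1 / q) * (1 + opNorm h.1) ^ (s + d + 1) * w h *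
      envelope O (dualAct h.1 ξ₀) ^ l) (ENNReal.ofReal q) μ ∧
    MemLp (fun h : H => absDet h.1 ^ (-(1 / 2) - 1 / q) * (1 + opNorm h.1) ^ (s + d + 1) * w h *
      envelope O (dualAct (h.1)⁻¹ ξ₀) ^ l) 1 μ

/-- The (left-sided) Wiener amalgam space `W(C⁰, L¹_m)`, for functions with values in `[0,∞]`:
`F` is finite and continuous, and its local maximum function `h ↦ sup_{u ∈ U} F(h u)` lies in
`L¹_m`. This does not depend on the compact neighbourhood `U` of the identity; here it is required
for all of them. -/
def MemWienerAmalgam {K : Type*} [Group K] [TopologicalSpace K] [MeasurableSpace K]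
    (μ : Measure K) (m : K → ℝ) (F : K → ℝ≥0∞) : Prop :=
  (∀ h, F h ≠ ∞) ∧ Continuous F ∧
  ∀ U : Set K, IsCompact U → U ∈ 𝓝 (1 : K) →
    ∫⁻ h, (⨆ u ∈ U, F (h * u)) * ENNReal.ofReal (m h) ∂μ < ∞

/-- `O` is strongly `(s,w)`-temperately embedded with index `l`. -/
def StronglyTemperatelyEmbedded {d : ℕ} (H : Subgroup (GL (Fin d) ℝ)) [MeasurableSpace H]
    (μ : Measure H) (O : Set (Euc d)) (s : ℝ) (w : H → ℝ) (l : ℕ) : Prop :=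
  MemWienerAmalgam μ
    (fun h : H => w h * absDet h.1 ^ (-(1 / 2) : ℝ) * (1 + opNorm h.1) ^ (2 * (s + d + 1)))
    (fun h : H => auxPhi O l h.1)

/-! ### Block decomposition into irreducible algebras -/

/-- A nonzero commutative real algebra is irreducible if it is the sum `𝕂 · 1 + N` of scalars and
nilpotent elements, either for `𝕂 = ℝ` or for `𝕂 = ℂ` with respect to some structure of a complex
algebra. -/
def IsIrreducibleAlgebra (A : Type*) [Ring A] [Algebra ℝ A] : Prop :=
  Nontrivial A ∧ (∀ a b : A, a * b = b * a) ∧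
  ((∀ a : A, ∃ r : ℝ, IsNilpotent (a - algebraMap ℝ A r)) ∨
    ∃ φ : ℂ →ₐ[ℝ] A, ∀ a : A, ∃ z : ℂ, IsNilpotent (a - φ z))

/-- The nilpotency class of the set `N` of nilpotent elements: the least `n` with `N ^ n = {0}`,
i.e. such that all products of `n` nilpotent elements vanish. -/
def algNilpotencyClass (A : Type*) [Ring A] : ℕ :=
  sInf {n : ℕ | ∀ l : List A, l.length = n → (∀ a ∈ l, IsNilpotent a) → l.prod = 0}

/-- A decomposition of `H`, after the change of coordinates `g`, into the group of all block
diagonal matrices with `i`-th block in the unit group of an irreducible algebra of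
`dim i × dim i`-matrices. -/
structure BlockDecomposition {d : ℕ} (H : Subgroup (GL (Fin d) ℝ)) where
  /-- the number of blocks -/
  k : ℕ
  /-- the sizes of the blocks -/
  dim : Fin k → ℕ
  /-- the irreducible algebras -/
  alg : ∀ i, Subalgebra ℝ (Matrix (Fin (dim i)) (Fin (dim i)) ℝ)
  irreducible : ∀ i, IsIrreducibleAlgebra (alg i)
  /-- the numbering of the coordinates by blocks -/
  e : (Σ i, Fin (dim i)) ≃ Fin d
  /-- the change of coordinates -/
  g : GL (Fin d) ℝ
  mem_iff : ∀ h : GL (Fin d) ℝ, h ∈ H ↔ ∃ b : ∀ i, (alg i)ˣ,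
    (g⁻¹ * h * g).val = Matrix.reindex e e
      (Matrix.blockDiagonal' fun i => ((b i : alg i) : Matrix (Fin (dim i)) (Fin (dim i)) ℝ))

/-- The maximal nilpotency class of the blocks. -/
def BlockDecomposition.maxNilpotencyClass {d : ℕ} {H : Subgroup (GL (Fin d) ℝ)}
    (B : BlockDecomposition H) : ℕ :=
  Finset.univ.sup fun i => algNilpotencyClass (B.alg i)

end AbelianDilation

end

/-!
On the Fourier side the quasi-regular representation acts by modulations and by the dual action
(`fourier_quasiRegular`), so a subset of `ℝᵈ` invariant under the dual action gives an invariant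
subspace, and irreducibility means that the dual action is ergodic
(`QuasiRegularIrreducible.null_or_conull`). Square-integrability of the coefficient of `ψ` says
that `∫ φ(ξ) ∫ φ(hᵀ ξ) dh dξ < ∞` for `φ = |ψ̂|²` (`lintegral_fourier_sq_lt_top`). Hence the
push-forward of `φ(hᵀ ξ) dh` to the orbit of `ξ` is, for almost every `ξ`, a finite nonzero
measure. As a function of `ξ` it is invariant, hence almost everywhere constant by ergodicity;
since it lives on the orbit of `ξ`, almost all points lie on one orbit
(`IrreduciblyAdmissible.exists_conull_dualOrbit`).

Let `S` be the algebra generated by `H` and `ξ₀` a point of the conull orbit. As `S` is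
commutative and the orbit lies in no proper subspace, `a ↦ aᵀ ξ₀` is a linear bijection `S → ℝᵈ`.
For a unit `h` of `S` the map `hᵀ` sends some point of the orbit into the orbit, so injectivity
gives `h ∈ H` (`exists_subalgebra_of_conull`): `H` is the unit group of `S`. The orbit is then the
image of the open set `Sˣ`, and it is the only open orbit. The primitive idempotents of the
Artinian ring `S` give the block decomposition (`nonempty_blockDecomposition`).

In an irreducible block an invertible element is a scalar of modulus `t` times a unipotent
element; its determinant is of size `t` to the power of the block size, and its inverse is a
Neumann series with `n` terms in `‖b‖ / t` (`IsIrreducibleAlgebra.exists_scalarPart`). Removing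
the scalar part of one block of `h` moves `hᵀ ξ₀` out of the orbit, so
`A(hᵀ ξ₀) ≤ dist(hᵀ ξ₀, 𝒪ᶜ) ≲ t` (`BlockDecomposition.infDist_le_of_isNilpotent`), while `‖h‖ ≲ |hᵀ ξ₀| ≤ 1 / A(hᵀ ξ₀)`.
Combining these bounds gives the decay estimates (`BlockDecomposition.normDecay`,
`BlockDecomposition.detDecay`).

For the embeddedness statements everything is measured by `growth h = (1 + ‖h‖) (1 + ‖h⁻¹‖)`. In
the coordinates `ξ = hᵀ ξ₀` the Haar measure of `H` is a multiple of `|det h|⁻¹ dξ`, so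
`growth ^ (-(2 d + 1))` is integrable (`lintegral_inv_growth_pow_lt_top`). All weights are bounded by powers
of `growth`, and by the norm estimate powers of `A(hᵀ ξ₀)` compensate powers of `growth h`. Since
`growth` is submultiplicative, `A(ξ) A(hᵀ ξ)` compensates `growth h` uniformly in `ξ`
(`growth_mul_envelope_le`), which bounds `Φ_ℓ(h)` by any given negative power of `growth h` for
large `ℓ` (`exists_auxPhi_le`).
-/

namespace AbelianDilation

/-! ### The dual action and the topology of `H` -/

section Basic

variable {d : ℕ}

theorem act_mul (a b : Matrix (Fin d) (Fin d) ℝ) (v : Euc d) : act (a * b) v = act a (act b v) := by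
  rw [act, map_mul]; rfl

theorem act_one (v : Euc d) : act (1 : Matrix (Fin d) (Fin d) ℝ) v = v := by
  rw [act, map_one]; rfl

theorem dualAct_mul (k h : GL (Fin d) ℝ) (v : Euc d) :
    dualAct (k * h) v = dualAct h (dualAct k v) := by
  rw [dualAct, Units.val_mul, Matrix.transpose_mul, act_mul]; rfl

theorem dualAct_one (v : Euc d) : dualAct (1 : GL (Fin d) ℝ) v = v := by
  rw [dualAct, Units.val_one, Matrix.transpose_one, act_one]

theorem dualAct_inv_dualAct (h : GL (Fin d) ℝ) (v : Euc d) : dualAct h⁻¹ (dualAct h v) = v := by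
  rw [← dualAct_mul, mul_inv_cancel, dualAct_one]

theorem dualAct_dualAct_inv (h : GL (Fin d) ℝ) (v : Euc d) : dualAct h (dualAct h⁻¹ v) = v := by
  rw [← dualAct_mul, inv_mul_cancel, dualAct_one]

theorem norm_act_mul_le (a b : Matrix (Fin d) (Fin d) ℝ) : ‖act (a * b)‖ ≤ ‖act a‖ * ‖act b‖ := by
  rw [act, map_mul]
  exact norm_mul_le _ _

theorem norm_act_transpose (a : Matrix (Fin d) (Fin d) ℝ) : ‖act a.transpose‖ = ‖act a‖ := by
  have h := Matrix.l2_opNorm_conjTranspose a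
  rw [Matrix.conjTranspose_eq_transpose_of_trivial] at h
  exact h

theorem opNorm_mul_le (h k : GL (Fin d) ℝ) : opNorm (h * k) ≤ opNorm h * opNorm k :=
  norm_act_mul_le _ _

theorem opNorm_nonneg (h : GL (Fin d) ℝ) : 0 ≤ opNorm h := norm_nonneg _

theorem norm_dualAct_le (h : GL (Fin d) ℝ) (v : Euc d) : ‖dualAct h v‖ ≤ opNorm h * ‖v‖ := by
  rw [opNorm, ← norm_act_transpose]
  exact (act h.val.transpose).le_opNorm v

theorem continuous_matrix_act : Continuous fun a : Matrix (Fin d) (Fin d) ℝ => act a :=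
  LinearMap.continuous_of_finiteDimensional
    ((Matrix.toEuclideanCLM (n := Fin d) (𝕜 := ℝ)).toAlgEquiv.toLinearMap)

theorem continuous_dualAct : Continuous fun p : GL (Fin d) ℝ × Euc d => dualAct p.1 p.2 := by
  have h1 : Continuous fun h : GL (Fin d) ℝ => h.val.transpose :=
    Units.continuous_val.matrix_transpose
  exact ((continuous_matrix_act.comp h1).comp continuous_fst).clm_apply continuous_snd

theorem continuous_dualAct_comp {X : Type*} [TopologicalSpace X] {f : X → GL (Fin d) ℝ}
    {g : X → Euc d} (hf : Continuous f) (hg : Continuous g) :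
    Continuous fun x => dualAct (f x) (g x) := by
  have h1 := continuous_dualAct.comp (hf.prodMk hg)
  simp only [Function.comp_def] at h1
  exact h1

theorem continuous_absDet : Continuous fun h : GL (Fin d) ℝ => absDet h :=
  (Continuous.matrix_det Units.continuous_val).abs

theorem continuous_opNorm : Continuous fun h : GL (Fin d) ℝ => opNorm h :=
  (continuous_matrix_act.comp Units.continuous_val).norm

theorem absDet_pos (h : GL (Fin d) ℝ) : 0 < absDet h :=
  abs_pos.2 ((Matrix.isUnit_iff_isUnit_det _).1 h.isUnit).ne_zero

theorem absDet_mul (k h : GL (Fin d) ℝ) : absDet (k * h) = absDet k * absDet h := by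
  simp [absDet, abs_mul]

theorem absDet_inv (h : GL (Fin d) ℝ) : absDet h⁻¹ = (absDet h)⁻¹ := by
  have := absDet_mul h⁻¹ h
  rw [inv_mul_cancel] at this
  have h1 : absDet (1 : GL (Fin d) ℝ) = 1 := by simp [absDet]
  exact eq_inv_of_mul_eq_one_left (by rw [← this, h1])

theorem locallyCompactSpace_closedSubgroup {H : Subgroup (GL (Fin d) ℝ)}
    (hclosed : IsClosed (H : Set (GL (Fin d) ℝ))) : LocallyCompactSpace H := by
  have : LocallyCompactSpace (Matrix (Fin d) (Fin d) ℝ) :=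
    inferInstanceAs (LocallyCompactSpace (Fin d → Fin d → ℝ))
  have : LocallyCompactSpace (Matrix (Fin d) (Fin d) ℝ)ᵐᵒᵖ :=
    MulOpposite.opHomeomorph.symm.isClosedEmbedding.locallyCompactSpace
  have : LocallyCompactSpace (GL (Fin d) ℝ) :=
    Units.isClosedEmbedding_embedProduct.locallyCompactSpace
  exact hclosed.isClosedEmbedding_subtypeVal.locallyCompactSpace

theorem secondCountableTopology_subgroup (H : Subgroup (GL (Fin d) ℝ)) :
    SecondCountableTopology H := by
  have : SecondCountableTopology (Matrix (Fin d) (Fin d) ℝ) :=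
    inferInstanceAs (SecondCountableTopology (Fin d → Fin d → ℝ))
  have : SecondCountableTopology (Matrix (Fin d) (Fin d) ℝ)ᵐᵒᵖ :=
    MulOpposite.opHomeomorph.symm.isInducing.secondCountableTopology
  have : SecondCountableTopology (GL (Fin d) ℝ) :=
    Units.isEmbedding_embedProduct.isInducing.secondCountableTopology
  exact inferInstanceAs (SecondCountableTopology (H : Set (GL (Fin d) ℝ)))

/-- The dual action of an invertible matrix as a linear homeomorphism. -/
noncomputable def dualEquiv (h : GL (Fin d) ℝ) : Euc d ≃L[ℝ] Euc d :=
  ContinuousLinearEquiv.equivOfInverse (act h.val.transpose) (act (h⁻¹).val.transpose)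
    (dualAct_inv_dualAct h) (dualAct_dualAct_inv h)

theorem dualEquiv_apply (h : GL (Fin d) ℝ) (v : Euc d) : dualEquiv h v = dualAct h v := rfl

theorem det_act (a : Matrix (Fin d) (Fin d) ℝ) :
    LinearMap.det ((act a : Euc d →L[ℝ] Euc d) : Euc d →ₗ[ℝ] Euc d) = a.det := by
  rw [show ((act a : Euc d →L[ℝ] Euc d) : Euc d →ₗ[ℝ] Euc d) = Matrix.toEuclideanLin a from
    Matrix.coe_toEuclideanCLM_eq_toEuclideanLin a, Matrix.toEuclideanLin_eq_toLin_orthonormal]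
  exact LinearMap.det_toLin _ a

theorem map_act_volume {a : Matrix (Fin d) (Fin d) ℝ} (ha : a.det ≠ 0) :
    Measure.map (act a) (volume : Measure (Euc d)) =
      ENNReal.ofReal |a.det|⁻¹ • (volume : Measure (Euc d)) := by
  have h0 : LinearMap.det ((act a : Euc d →L[ℝ] Euc d) : Euc d →ₗ[ℝ] Euc d) ≠ 0 := by
    rwa [det_act]
  have := Measure.map_linearMap_addHaar_eq_smul_addHaar (volume : Measure (Euc d)) h0
  rw [det_act, abs_inv] at this
  exact this

theorem map_dualAct_volume (h : GL (Fin d) ℝ) :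
    Measure.map (dualAct h) (volume : Measure (Euc d)) =
      ENNReal.ofReal (absDet h)⁻¹ • (volume : Measure (Euc d)) := by
  have h1 := map_act_volume (a := h.val.transpose) (by
    rw [Matrix.det_transpose]
    exact abs_pos.1 (absDet_pos h))
  rw [Matrix.det_transpose] at h1
  exact h1

theorem quasiMeasurePreserving_dualAct (h : GL (Fin d) ℝ) :
    Measure.QuasiMeasurePreserving (dualAct h) (volume : Measure (Euc d)) volume := by
  refine ⟨(dualEquiv h).continuous.measurable, ?_⟩
  rw [map_dualAct_volume]
  exact Measure.smul_absolutelyContinuous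

theorem lintegral_comp_dualAct (h : GL (Fin d) ℝ) (f : Euc d → ℝ≥0∞) :
    ∫⁻ ξ, f (dualAct h ξ) = ENNReal.ofReal (absDet h)⁻¹ * ∫⁻ ξ, f ξ := by
  have h1 := (dualEquiv h).toHomeomorph.measurableEmbedding.lintegral_map (μ := volume) f
  have h2 : Measure.map (dualEquiv h).toHomeomorph (volume : Measure (Euc d)) =
    ENNReal.ofReal (absDet h)⁻¹ • (volume : Measure (Euc d)) := map_dualAct_volume h
  rw [h2, lintegral_smul_measure] at h1
  exact h1.symm

theorem continuous_dualAct_left (H : Subgroup (GL (Fin d) ℝ)) (ξ : Euc d) :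
    Continuous fun h : H => dualAct h.1 ξ :=
  continuous_dualAct_comp continuous_subtype_val continuous_const

theorem measurable_dualAct_left (H : Subgroup (GL (Fin d) ℝ))
    [MeasurableSpace H] [BorelSpace H] (ξ : Euc d) : Measurable fun h : H => dualAct h.1 ξ :=
  (continuous_dualAct_left H ξ).measurable

theorem measurable_ofReal_inv_absDet (H : Subgroup (GL (Fin d) ℝ))
    [MeasurableSpace H] [BorelSpace H] : Measurable fun h : H => ENNReal.ofReal (absDet h.1)⁻¹ :=
  ENNReal.measurable_ofReal.comp (continuous_absDet.comp continuous_subtype_val).measurable.inv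

end Basic

/-! ### The quasi-regular representation on the Fourier side -/

section Fourier

open FourierTransform Real
open scoped SchwartzMap ComplexConjugate

variable {d : ℕ}

/-- An integrable function whose Fourier transform is square-integrable is itself
square-integrable, with the same norm; stated as an inequality in `[0,∞]`. -/
theorem lintegral_sq_le_lintegral_fourier_sq {G : Euc d → ℂ} (hG : Integrable G) :
    ∫⁻ ξ, ‖G ξ‖ₑ ^ 2 ≤ ∫⁻ x, ‖𝓕 G x‖ₑ ^ 2 := by
  have hcont : Continuous (𝓕 G) :=
    VectorFourier.fourierIntegral_continuous continuous_fourierChar continuous_inner hG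
  have hnorm : ∀ f : Euc d → ℂ, ∫⁻ x, ‖f x‖ₑ ^ 2 = eLpNorm f 2 volume ^ 2 := by
    intro f
    have := eLpNorm_nnreal_pow_eq_lintegral (μ := (volume : Measure (Euc d))) (f := f)
      (p := 2) two_ne_zero
    simpa using this.symm
  by_cases hfin : ∫⁻ x, ‖𝓕 G x‖ₑ ^ 2 = ∞
  · rw [hfin]; exact le_top
  have hmem : MemLp (𝓕 G) 2 volume := by
    refine ⟨hcont.aestronglyMeasurable, ?_⟩
    rw [hnorm] at hfin
    exact lt_top_iff_ne_top.2 fun h => hfin (by rw [h]; simp)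
  -- `u` is the inverse Fourier transform of `𝓕 G` in `L²`; it agrees with `G` as a distribution
  set u : Lp ℂ 2 (volume : Measure (Euc d)) := 𝓕⁻ (hmem.toLp _) with hu
  have hFu : 𝓕 u = hmem.toLp _ := by rw [hu]; exact FourierTransform.fourier_fourierInv_eq _
  have huloc : LocallyIntegrable u volume :=
    (Lp.memLp u).locallyIntegrable (by norm_num)
  have key : ∀ᵐ x : Euc d, G x = u x := by
    refine ae_eq_of_integral_contDiff_smul_eq hG.locallyIntegrable huloc fun g hg hgc => ?_
    have hgc' : HasCompactSupport (fun x => (g x : ℂ)) :=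
      hgc.comp_left (g := fun r : ℝ => (r : ℂ)) (by simp)
    have hgs : ContDiff ℝ (⊤ : ℕ∞) (fun x => (g x : ℂ)) := Complex.ofRealCLM.contDiff.comp hg
    set φ : 𝓢(Euc d, ℂ) := hgc'.toSchwartzMap hgs with hφ
    set χ : 𝓢(Euc d, ℂ) := 𝓕⁻ φ with hχ
    have hφχ : φ = 𝓕 χ := (FourierTransform.fourier_fourierInv_eq φ).symm
    have hφg : ∀ x, φ x = (g x : ℂ) := fun x => rfl
    have e1 : ∀ f : Euc d → ℂ, ∫ x, g x • f x = ∫ x, φ x • f x := by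
      intro f
      refine integral_congr_ae (Filter.Eventually.of_forall fun x => ?_)
      simp [hφg]
    rw [e1, e1]
    have h1 : ∫ x, 𝓕 G x • χ x = ∫ x, G x • (𝓕 χ) x :=
      VectorFourier.integral_fourierIntegral_smul_eq_flip (L := innerₗ (Euc d))
        continuous_fourierChar continuous_inner hG χ.integrable |>.trans (by
          rw [SchwartzMap.fourier_coe, flip_innerₗ]; rfl)
    have h2 := DFunLike.congr_fun (Lp.fourier_toTemperedDistribution_eq u) χ
    rw [TemperedDistribution.fourier_apply, Lp.toTemperedDistribution_apply,
      Lp.toTemperedDistribution_apply, ← hφχ, hFu] at h2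
    rw [h2]
    calc ∫ x, φ x • G x = ∫ x, G x • (𝓕 χ) x := by
          simp_rw [← hφχ, smul_eq_mul, mul_comm]
      _ = ∫ x, 𝓕 G x • χ x := h1.symm
      _ = ∫ x, χ x • (hmem.toLp _) x := by
          refine integral_congr_ae ?_
          filter_upwards [hmem.coeFn_toLp] with x hx
          rw [hx, smul_eq_mul, smul_eq_mul, mul_comm]
  have hnu : eLpNorm u 2 volume = eLpNorm (𝓕 G) 2 volume := by
    have := Lp.norm_fourier_eq u
    rw [hFu, Lp.norm_def, Lp.norm_def,
      ENNReal.toReal_eq_toReal_iff' (Lp.memLp _).2.ne (Lp.memLp _).2.ne,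
      eLpNorm_congr_ae hmem.coeFn_toLp] at this
    exact this.symm
  rw [hnorm, hnorm, eLpNorm_congr_ae key, hnu]

/-- A weighted composition operator which is well defined and bounded on `L²` is continuous. -/
theorem continuous_weightedComp {c : Euc d → ℂ} {φ : Euc d → Euc d} (K : NNReal)
    (hmem : ∀ f : Euc d → ℂ, MemLp f 2 volume → MemLp (fun y => c y * f (φ y)) 2 volume)
    (hbd : ∀ f : Euc d → ℂ, MemLp f 2 volume →
      eLpNorm (fun y => c y * f (φ y)) 2 volume ≤ K * eLpNorm f 2 volume) :
    Continuous fun f : Lp ℂ 2 (volume : Measure (Euc d)) => (hmem f (Lp.memLp f)).toLp _ := by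
  refine LipschitzWith.continuous (K := K) fun f g => ?_
  rw [Lp.edist_def, Lp.edist_def]
  have h1 : eLpNorm (⇑((hmem f (Lp.memLp f)).toLp _) - ⇑((hmem g (Lp.memLp g)).toLp _)) 2 volume =
      eLpNorm (fun y => c y * (⇑f - ⇑g) (φ y)) 2 volume := by
    refine eLpNorm_congr_ae ?_
    filter_upwards [(hmem f (Lp.memLp f)).coeFn_toLp, (hmem g (Lp.memLp g)).coeFn_toLp]
      with y h1 h2
    rw [Pi.sub_apply, h1, h2, Pi.sub_apply, mul_sub]
  rw [h1]
  exact hbd _ ((Lp.memLp f).sub (Lp.memLp g))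

theorem eLpNorm_weightedComp {c : Euc d → ℂ} {φ : Euc d → Euc d} {r : ℝ} {a : ℝ≥0∞}
    (hc : ∀ y, ‖c y‖ = r) (hφ : Measurable φ)
    (hmap : Measure.map φ (volume : Measure (Euc d)) = a • volume) {f : Euc d → ℂ}
    (hf : MemLp f 2 volume) :
    eLpNorm (fun y => c y * f (φ y)) 2 volume =
      ENNReal.ofReal r * a ^ (1 / 2 : ℝ) * eLpNorm f 2 volume := by
  have hr : 0 ≤ r := hc 0 ▸ norm_nonneg _
  have h1 : eLpNorm (fun y => c y * f (φ y)) 2 volume =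
      eLpNorm ((r : ℂ) • (f ∘ φ)) 2 volume := by
    refine eLpNorm_congr_norm_ae (Filter.Eventually.of_forall fun y => ?_)
    simp [hc, abs_of_nonneg hr]
  have hf' : AEStronglyMeasurable f (Measure.map φ volume) := by
    rw [hmap]; exact hf.1.mono_ac Measure.smul_absolutelyContinuous
  rw [h1, eLpNorm_const_smul, ← eLpNorm_map_measure hf' hφ.aemeasurable, hmap,
    eLpNorm_smul_measure_of_ne_top (by norm_num), smul_eq_mul, mul_assoc]
  congr 1
  · rw [enorm_eq_nnnorm, ENNReal.ofReal, ENNReal.coe_inj]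
    ext
    simp [Real.coe_toNNReal _ hr, abs_of_nonneg hr]
  · simp

theorem memLp_comp_map {φ : Euc d → Euc d} {a : ℝ≥0∞} (ha : a ≠ ∞) (hφ : Measurable φ)
    (hmap : Measure.map φ (volume : Measure (Euc d)) = a • volume) {f : Euc d → ℂ}
    (hf : MemLp f 2 volume) : MemLp (fun y => f (φ y)) 2 volume := by
  have h1 : MemLp f 2 (Measure.map φ volume) := by
    rw [hmap]; exact hf.smul_measure ha
  exact h1.comp_of_map hφ.aemeasurable

/-- The quasi-regular representation on the Fourier side:
`g ↦ |det h|^{1/2} e^{-2πi⟨x,·⟩} g(hᵀ ·)`. -/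
noncomputable def fourierRep (x : Euc d) (h : GL (Fin d) ℝ) (g : Euc d → ℂ) : Euc d → ℂ :=
  fun ξ => (((absDet h ^ (1 / 2 : ℝ) : ℝ) : ℂ) * ((𝐞 (-(inner ℝ x ξ)) : Circle) : ℂ)) *
    g (dualAct h ξ)

theorem memLp_fourierRep (x : Euc d) (h : GL (Fin d) ℝ) {g : Euc d → ℂ} (hg : MemLp g 2 volume) :
    MemLp (fourierRep x h g) 2 volume := by
  have h1 : MemLp (fun ξ => g (dualAct h ξ)) 2 volume :=
    memLp_comp_map ENNReal.ofReal_ne_top (dualEquiv h).continuous.measurable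
      (map_dualAct_volume h) hg
  refine h1.of_le_mul (c := absDet h ^ (1 / 2 : ℝ)) ?_ (Filter.Eventually.of_forall fun ξ => ?_)
  · refine Continuous.aestronglyMeasurable ?_ |>.mul h1.1
    refine continuous_const.mul ?_
    exact continuous_subtype_val.comp
      (continuous_fourierChar.comp (continuous_const.inner continuous_id).neg)
  · refine le_of_eq ?_
    rw [fourierRep, norm_mul, norm_mul, Circle.norm_coe, mul_one, Complex.norm_real,
      Real.norm_of_nonneg (Real.rpow_nonneg (absDet_pos h).le _)]

theorem eLpNorm_fourierRep_le (x : Euc d) (h : GL (Fin d) ℝ) : ∃ K : NNReal, ∀ g : Euc d → ℂ,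
    MemLp g 2 volume → eLpNorm (fourierRep x h g) 2 volume ≤ K * eLpNorm g 2 volume := by
  have hK : ENNReal.ofReal (absDet h ^ (1 / 2 : ℝ)) *
      ENNReal.ofReal (absDet h)⁻¹ ^ (1 / 2 : ℝ) ≠ ∞ :=
    ENNReal.mul_ne_top ENNReal.ofReal_ne_top
      (ENNReal.rpow_ne_top_of_nonneg (by norm_num) ENNReal.ofReal_ne_top)
  refine ⟨(ENNReal.ofReal (absDet h ^ (1 / 2 : ℝ)) *
      ENNReal.ofReal (absDet h)⁻¹ ^ (1 / 2 : ℝ)).toNNReal, fun g hg => ?_⟩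
  rw [ENNReal.coe_toNNReal hK]
  refine (eLpNorm_weightedComp (fun y => ?_) (dualEquiv h).continuous.measurable
    (map_dualAct_volume h) hg).le
  rw [norm_mul, Circle.norm_coe, mul_one, Complex.norm_real,
    Real.norm_of_nonneg (Real.rpow_nonneg (absDet_pos h).le _)]

theorem map_affine_volume (x : Euc d) (h : GL (Fin d) ℝ) :
    Measure.map (fun y => act (h⁻¹).val (y - x)) (volume : Measure (Euc d)) =
      ENNReal.ofReal (absDet h) • (volume : Measure (Euc d)) := by
  have h1 : _ = ENNReal.ofReal (absDet h⁻¹)⁻¹ • _ :=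
    map_act_volume (abs_pos.1 (absDet_pos h⁻¹))
  rw [absDet_inv, inv_inv] at h1
  rw [← h1]
  conv_rhs => rw [← (measurePreserving_sub_right volume x).map_eq]
  rw [Measure.map_map (act (h⁻¹).val).continuous.measurable (measurable_sub_const x)]
  rfl

theorem continuous_quasiRegular (x : Euc d) (h : GL (Fin d) ℝ) :
    Continuous (quasiRegular x h) := by
  have hK : ENNReal.ofReal (absDet h ^ (-(1 / 2) : ℝ)) *
      ENNReal.ofReal (absDet h) ^ (1 / 2 : ℝ) ≠ ∞ :=
    ENNReal.mul_ne_top ENNReal.ofReal_ne_top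
      (ENNReal.rpow_ne_top_of_nonneg (by norm_num) ENNReal.ofReal_ne_top)
  have hmeas : Measurable fun y => act (h⁻¹).val (y - x) :=
    (act (h⁻¹).val).continuous.measurable.comp (measurable_id.sub_const x)
  refine continuous_weightedComp (φ := fun y => act (h⁻¹).val (y - x))
    (ENNReal.ofReal (absDet h ^ (-(1 / 2) : ℝ)) *
      ENNReal.ofReal (absDet h) ^ (1 / 2 : ℝ)).toNNReal
    (fun f hf => memLp_comp_affine x h hf) (fun f hf => ?_)
  rw [ENNReal.coe_toNNReal hK]
  refine (eLpNorm_weightedComp (fun y => ?_) hmeas (map_affine_volume x h) hf).le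
  simp [abs_of_nonneg (Real.rpow_nonneg (absDet_pos h).le _)]

theorem inner_act (h : GL (Fin d) ℝ) (u ξ : Euc d) :
    inner ℝ (act h.val u) ξ = inner ℝ u (dualAct h ξ) := by
  rw [dualAct, Matrix.inner_toEuclideanCLM, real_inner_comm, Matrix.inner_toEuclideanCLM,
    Matrix.dotProduct_mulVec, ← Matrix.mulVec_transpose, dotProduct_comm]

theorem integral_comp_affine (x : Euc d) (h : GL (Fin d) ℝ) (F : Euc d → ℂ) :
    ∫ y, F (act (h⁻¹).val (y - x)) = (absDet h : ℂ) * ∫ y, F y := by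
  let e : Euc d ≃ₜ Euc d := (Homeomorph.subRight x).trans
    (ContinuousLinearEquiv.equivOfInverse (act (h⁻¹).val) (act h.val)
      (fun v => by rw [← act_mul, ← Units.val_mul, mul_inv_cancel, Units.val_one, act_one])
      (fun v => by
        rw [← act_mul, ← Units.val_mul, inv_mul_cancel, Units.val_one, act_one])).toHomeomorph
  have h1 := e.measurableEmbedding.integral_map (μ := (volume : Measure (Euc d))) F
  have h2 : Measure.map e (volume : Measure (Euc d)) = _ := map_affine_volume x h
  rw [h2, integral_smul_measure, ENNReal.toReal_ofReal (absDet_pos h).le] at h1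
  rw [← Complex.real_smul, h1]
  rfl

/-- The Fourier transform intertwines the quasi-regular representation with its Fourier side. -/
theorem fourier_quasiRegular (x : Euc d) (h : GL (Fin d) ℝ)
    (f : Lp ℂ 2 (volume : Measure (Euc d))) :
    𝓕 (quasiRegular x h f) = (memLp_fourierRep x h (Lp.memLp (𝓕 f))).toLp _ := by
  obtain ⟨K, hK⟩ := eLpNorm_fourierRep_le x h
  have hcont : Continuous fun g : Lp ℂ 2 (volume : Measure (Euc d)) =>
      (memLp_fourierRep x h (Lp.memLp g)).toLp _ :=
    continuous_weightedComp K (fun g hg => memLp_fourierRep x h hg) hK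
  have hF : Continuous (fun g : Lp ℂ 2 (volume : Measure (Euc d)) => 𝓕 g) :=
    (Lp.fourierTransformₗᵢ (Euc d) ℂ).continuous
  refine DenseRange.induction_on
    (p := fun f => 𝓕 (quasiRegular x h f) = (memLp_fourierRep x h (Lp.memLp (𝓕 f))).toLp _)
    (SchwartzMap.denseRange_toLpCLM (E := Euc d) (F := ℂ) (p := 2) (μ := volume)
      ENNReal.ofNat_ne_top) f ?_ ?_
  · exact isClosed_eq (hF.comp (continuous_quasiRegular x h)) (hcont.comp hF)
  intro f
  rw [SchwartzMap.toLpCLM_apply]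
  let e : Euc d ≃L[ℝ] Euc d := ContinuousLinearEquiv.equivOfInverse (act (h⁻¹).val) (act h.val)
      (fun v => by rw [← act_mul, ← Units.val_mul, mul_inv_cancel, Units.val_one, act_one])
      (fun v => by rw [← act_mul, ← Units.val_mul, inv_mul_cancel, Units.val_one, act_one])
  let S : 𝓢(Euc d, ℂ) := ((absDet h ^ (-(1 / 2) : ℝ) : ℝ) : ℂ) •
    (SchwartzMap.compSubConstCLM ℂ x (SchwartzMap.compCLMOfContinuousLinearEquiv ℂ e f))
  have hS : ∀ y, S y = ((absDet h ^ (-(1 / 2) : ℝ) : ℝ) : ℂ) * f (act (h⁻¹).val (y - x)) :=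
    fun y => rfl
  have hqS : quasiRegular x h (f.toLp 2) = S.toLp 2 := by
    refine Lp.ext ?_
    have hqmp : Measure.QuasiMeasurePreserving (fun y => act (h⁻¹).val (y - x))
        (volume : Measure (Euc d)) volume := by
      refine ⟨(act (h⁻¹).val).continuous.measurable.comp (measurable_id.sub_const x), ?_⟩
      rw [map_affine_volume]
      exact Measure.smul_absolutelyContinuous
    filter_upwards [(memLp_comp_affine x h (Lp.memLp (f.toLp 2))).coeFn_toLp,
      S.coeFn_toLp 2 volume, hqmp.ae (f.coeFn_toLp 2 volume)] with y h1 h2 h3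
    rw [quasiRegular, h1, h2, h3, hS]
  rw [hqS, SchwartzMap.toLp_fourier_eq, SchwartzMap.toLp_fourier_eq]
  refine Lp.ext ?_
  filter_upwards [(memLp_fourierRep x h (Lp.memLp ((𝓕 f).toLp 2))).coeFn_toLp,
      (𝓕 S).coeFn_toLp 2 volume,
      (quasiMeasurePreserving_dualAct h).ae ((𝓕 f).coeFn_toLp 2 volume)] with ξ h1 h2 h3
  rw [h1, h2, fourierRep, h3, SchwartzMap.fourier_coe, SchwartzMap.fourier_coe, Real.fourier_eq,
    Real.fourier_eq]
  -- substitute `y = h u + x` in the integral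
  let F : Euc d → ℂ := fun u =>
    (((absDet h ^ (-(1 / 2) : ℝ) : ℝ) : ℂ) * ((𝐞 (-(inner ℝ x ξ)) : Circle) : ℂ)) *
      (𝐞 (-(inner ℝ u (dualAct h ξ))) • f u)
  have hsub : ∀ y : Euc d, 𝐞 (-(inner ℝ y ξ)) • S y = F (act (h⁻¹).val (y - x)) := by
    intro y
    simp only [F]
    have h4 : inner ℝ y ξ = inner ℝ x ξ + inner ℝ (act (h⁻¹).val (y - x)) (dualAct h ξ) := by
      rw [← inner_act, ← act_mul, ← Units.val_mul, mul_inv_cancel, Units.val_one, act_one,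
        ← inner_add_left, add_sub_cancel]
    simp only [hS, h4, Circle.smul_def, smul_eq_mul, neg_add, AddChar.map_add_eq_mul,
      Circle.coe_mul]
    ring
  refine ((integral_congr_ae (Filter.Eventually.of_forall hsub)).trans
    (integral_comp_affine x h F)).trans ?_
  rw [show ∫ u, F u = _ from integral_const_mul _ _]
  have h5 : (absDet h : ℂ) * ((absDet h ^ (-(1 / 2) : ℝ) : ℝ) : ℂ) =
      ((absDet h ^ (1 / 2 : ℝ) : ℝ) : ℂ) := by
    rw [← Complex.ofReal_mul]
    congr 1
    nth_rewrite 1 [← Real.rpow_one (absDet h)]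
    rw [← Real.rpow_add (absDet_pos h)]
    norm_num
  rw [← mul_assoc, ← mul_assoc, h5]

end Fourier

/-! ### Consequences of irreducibility and square-integrability -/

section Ergodic

open FourierTransform Real
open scoped ComplexConjugate

variable {d : ℕ}

/-- If every `g ∈ L²` vanishing on `E` is zero, then the complement of `E` is a null set. -/
theorem measure_compl_eq_zero_of_forall_Lp {E : Set (Euc d)} (hE : MeasurableSet E)
    (h : ∀ g : Lp ℂ 2 (volume : Measure (Euc d)), (∀ᵐ ξ, ξ ∈ E → g ξ = 0) → g = 0) :
    volume Eᶜ = 0 := by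
  have hn : ∀ n : ℕ, volume (Eᶜ ∩ Metric.ball 0 n) = 0 := by
    intro n
    have hfin : volume (Eᶜ ∩ Metric.ball (0 : Euc d) n) ≠ ∞ :=
      ((measure_mono Set.inter_subset_right).trans_lt measure_ball_lt_top).ne
    have hms : MeasurableSet (Eᶜ ∩ Metric.ball (0 : Euc d) n) := hE.compl.inter measurableSet_ball
    have h0 := h (indicatorConstLp 2 hms hfin (1 : ℂ)) (by
      filter_upwards [indicatorConstLp_coeFn (p := 2) (hs := hms) (hμs := hfin) (c := (1 : ℂ))]
        with ξ h1 h2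
      rw [h1, Set.indicator_of_notMem (fun h3 => h3.1 h2)])
    have h1 : (indicatorConstLp 2 hms hfin (1 : ℂ) : Euc d → ℂ) =ᵐ[volume] 0 := by
      rw [h0]; exact Lp.coeFn_zero _ _ _
    have h2 := (indicatorConstLp_coeFn (p := 2) (hs := hms) (hμs := hfin) (c := (1 : ℂ))).symm.trans
      h1
    rw [Filter.EventuallyEq, ae_iff] at h2
    refine measure_mono_null (fun ξ hξ => ?_) h2
    rw [Set.mem_ofPred_eq, Set.indicator_of_mem hξ]
    exact one_ne_zero
  have : Eᶜ = ⋃ n : ℕ, Eᶜ ∩ Metric.ball (0 : Euc d) n := by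
    rw [← Set.inter_iUnion, Metric.iUnion_ball_nat, Set.inter_univ]
  rw [this]
  exact measure_iUnion_null hn

/-- Irreducibility makes the dual action ergodic: the functions whose Fourier transform vanishes on
an invariant measurable set form a closed invariant subspace. -/
theorem QuasiRegularIrreducible.null_or_conull {H : Subgroup (GL (Fin d) ℝ)}
    (hirr : QuasiRegularIrreducible H) {E : Set (Euc d)} (hE : MeasurableSet E)
    (hinv : ∀ h ∈ H, ∀ ξ ∈ E, dualAct h ξ ∈ E) : volume E = 0 ∨ volume Eᶜ = 0 := by
  let T : Lp ℂ 2 (volume : Measure (Euc d)) →L[ℂ] Lp ℂ 2 ((volume : Measure (Euc d)).restrict E) :=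
    (LpToLpRestrictCLM (Euc d) ℂ ℂ volume 2 E).comp
      (Lp.fourierTransformₗᵢ (Euc d) ℂ).toContinuousLinearEquiv.toContinuousLinearMap
  have hker : ∀ f, f ∈ LinearMap.ker T.toLinearMap ↔ ∀ᵐ ξ, ξ ∈ E → (𝓕 f) ξ = 0 := by
    intro f
    have h1 : T f =ᵐ[volume.restrict E] ((𝓕 f : Lp ℂ 2 (volume : Measure (Euc d))) : Euc d → ℂ) :=
      LpToLpRestrictCLM_coeFn ℂ E (𝓕 f)
    rw [LinearMap.mem_ker, ← ae_restrict_iff' hE]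
    constructor
    · intro h0
      have h0' : T f = 0 := h0
      rw [h0'] at h1
      filter_upwards [h1, Lp.coeFn_zero ℂ 2 ((volume : Measure (Euc d)).restrict E)] with ξ h2 h3
      rw [← h2, h3, Pi.zero_apply]
    · intro h0
      refine Lp.ext ?_
      filter_upwards [h1, h0, Lp.coeFn_zero ℂ 2 ((volume : Measure (Euc d)).restrict E)]
        with ξ h2 h3 h4
      rw [h4]
      exact h2.trans h3
  have hsurj : ∀ g : Lp ℂ 2 (volume : Measure (Euc d)), 𝓕 (𝓕⁻ g) = g :=
    fun g => FourierTransform.fourier_fourierInv_eq g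
  have hVinv : ∀ (x : Euc d) (h : H), ∀ f ∈ LinearMap.ker T.toLinearMap,
      quasiRegular x h.1 f ∈ LinearMap.ker T.toLinearMap := by
    intro x h f hf
    rw [hker] at hf ⊢
    rw [fourier_quasiRegular]
    filter_upwards [(memLp_fourierRep x h.1 (Lp.memLp (𝓕 f))).coeFn_toLp,
      (quasiMeasurePreserving_dualAct h.1).ae hf] with ξ h1 h2 h3
    rw [h1, fourierRep, h2 (hinv h.1 h.2 ξ h3), mul_zero]
  rcases hirr (LinearMap.ker T.toLinearMap) T.isClosed_ker hVinv with hV | hV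
  · refine Or.inr (measure_compl_eq_zero_of_forall_Lp hE fun g hg => ?_)
    have h1 : 𝓕⁻ g ∈ LinearMap.ker T.toLinearMap := by rwa [hker, hsurj]
    rw [hV, Submodule.mem_bot] at h1
    rw [← hsurj g, h1]
    exact (Lp.fourierTransformₗᵢ (Euc d) ℂ).map_zero
  · refine Or.inl ?_
    rw [← compl_compl E]
    refine measure_compl_eq_zero_of_forall_Lp hE.compl fun g hg => ?_
    have h1 : 𝓕⁻ g ∈ LinearMap.ker T.toLinearMap := hV ▸ Submodule.mem_top
    rw [hker, hsurj] at h1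
    refine Lp.ext ?_
    filter_upwards [h1, hg, Lp.coeFn_zero ℂ 2 (volume : Measure (Euc d))] with ξ h2 h3 h4
    rw [h4]
    by_cases hξ : ξ ∈ E
    · exact h2 hξ
    · exact h3 hξ

/-- The matrix coefficients of the quasi-regular representation are Fourier transforms of
integrable functions. -/
theorem inner_quasiRegular (x : Euc d) (h : GL (Fin d) ℝ)
    (ψ : Lp ℂ 2 (volume : Measure (Euc d))) :
    inner ℂ (quasiRegular x h ψ) ψ = ((absDet h ^ (1 / 2 : ℝ) : ℝ) : ℂ) *
      𝓕 (fun ξ : Euc d => (conj ((𝓕 ψ) (dualAct h ξ)) * (𝓕 ψ) ξ : ℂ)) (-x) := by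
  rw [← Lp.inner_fourier_eq, L2.inner_def, Real.fourier_eq, ← integral_const_mul,
    fourier_quasiRegular]
  refine integral_congr_ae ?_
  filter_upwards [(memLp_fourierRep x h (Lp.memLp (𝓕 ψ))).coeFn_toLp] with ξ h1
  rw [h1, RCLike.inner_apply, fourierRep, inner_neg_right, neg_neg, Circle.smul_def, smul_eq_mul,
    map_mul, map_mul, Complex.conj_ofReal, ← Circle.coe_inv_eq_conj, ← AddChar.map_neg_eq_inv,
    neg_neg, real_inner_comm]
  ring

/-- Square-integrability of a matrix coefficient, expressed on the Fourier side. -/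
theorem lintegral_fourier_sq_lt_top {H : Subgroup (GL (Fin d) ℝ)} [MeasurableSpace H]
    [BorelSpace H] (μ : Measure H) [SFinite μ] {ψ : Lp ℂ 2 (volume : Measure (Euc d))}
    (hψ : MemLp (fun p : Euc d × H => inner ℂ (quasiRegular p.1 p.2.1 ψ) ψ) 2 (affineHaar H μ)) :
    ∫⁻ h : H, (∫⁻ ξ, ‖(𝓕 ψ) (dualAct h.1 ξ)‖ₑ ^ 2 * ‖(𝓕 ψ) ξ‖ₑ ^ 2) ∂μ < ∞ := by
  have hmeas := measurable_ofReal_inv_absDet H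
  have h1 : ∫⁻ p, ‖inner ℂ (quasiRegular p.1 p.2.1 ψ) ψ‖ₑ ^ 2 ∂(affineHaar H μ) < ∞ := by
    have h2 := eLpNorm_nnreal_pow_eq_lintegral (μ := affineHaar H μ)
      (f := fun p : Euc d × H => inner ℂ (quasiRegular p.1 p.2.1 ψ) ψ) (p := 2) two_ne_zero
    have h3 : ∫⁻ p, ‖inner ℂ (quasiRegular p.1 p.2.1 ψ) ψ‖ₑ ^ 2 ∂(affineHaar H μ) =
      eLpNorm (fun p : Euc d × H => inner ℂ (quasiRegular p.1 p.2.1 ψ) ψ) 2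
        (affineHaar H μ) ^ 2 := by simpa using h2.symm
    rw [h3]
    exact ENNReal.pow_lt_top hψ.2
  rw [affineHaar, lintegral_prod_symm _ (hψ.1.enorm.pow_const 2),
    lintegral_withDensity_eq_lintegral_mul_non_measurable _ hmeas
      (Filter.Eventually.of_forall fun _ => ENNReal.ofReal_lt_top)] at h1
  refine lt_of_le_of_lt (lintegral_mono fun h => ?_) h1
  set G : Euc d → ℂ := fun ξ => conj ((𝓕 ψ) (dualAct h.1 ξ)) * (𝓕 ψ) ξ with hGdef
  have hG : Integrable G := by
    have h2 : MemLp (fun ξ => (𝓕 ψ) (dualAct h.1 ξ)) 2 (volume : Measure (Euc d)) :=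
      memLp_comp_map ENNReal.ofReal_ne_top (dualEquiv h.1).continuous.measurable
        (map_dualAct_volume h.1) (Lp.memLp _)
    exact MemLp.integrable_mul (MemLp.star h2) (Lp.memLp (𝓕 ψ))
  have hdet : ENNReal.ofReal (absDet h.1)⁻¹ * ENNReal.ofReal (absDet h.1) = 1 := by
    rw [← ENNReal.ofReal_mul (inv_nonneg.2 (absDet_pos _).le),
      inv_mul_cancel₀ (absDet_pos _).ne', ENNReal.ofReal_one]
  have hsq : ‖((absDet h.1 ^ (1 / 2 : ℝ) : ℝ) : ℂ)‖ₑ ^ 2 = ENNReal.ofReal (absDet h.1) := by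
    rw [← ofReal_norm, Complex.norm_real, ← ENNReal.ofReal_pow (norm_nonneg _),
      Real.norm_of_nonneg (Real.rpow_nonneg (absDet_pos _).le _), ← Real.rpow_natCast,
      ← Real.rpow_mul (absDet_pos _).le]
    norm_num
  simp only [Pi.mul_apply]
  calc ∫⁻ ξ, ‖(𝓕 ψ) (dualAct h.1 ξ)‖ₑ ^ 2 * ‖(𝓕 ψ) ξ‖ₑ ^ 2 = ∫⁻ ξ, ‖G ξ‖ₑ ^ 2 := by
        refine lintegral_congr fun ξ => ?_
        rw [hGdef, enorm_mul, mul_pow, ← ofReal_norm (conj _), RCLike.norm_conj,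
          ofReal_norm]
    _ ≤ ∫⁻ x, ‖𝓕 G x‖ₑ ^ 2 := lintegral_sq_le_lintegral_fourier_sq hG
    _ = ∫⁻ x, ‖𝓕 G (-x)‖ₑ ^ 2 :=
        (lintegral_neg_eq_self (μ := (volume : Measure (Euc d)))
          (f := fun x => ‖𝓕 G x‖ₑ ^ 2)).symm
    _ = ENNReal.ofReal (absDet h.1)⁻¹ *
          (ENNReal.ofReal (absDet h.1) * ∫⁻ x, ‖𝓕 G (-x)‖ₑ ^ 2) := by
        rw [← mul_assoc, hdet, one_mul]
    _ = _ := by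
        congr 1
        rw [← lintegral_const_mul' _ _ ENNReal.ofReal_ne_top]
        refine lintegral_congr fun x => ?_
        rw [inner_quasiRegular, enorm_mul, mul_pow, hsq]

theorem exists_countable_piSystem_borel (X : Type*) [TopologicalSpace X]
    [SecondCountableTopology X] [MeasurableSpace X] [BorelSpace X] :
    ∃ C : Set (Set X), C.Countable ∧ IsPiSystem C ∧
      ‹MeasurableSpace X› = MeasurableSpace.generateFrom C ∧ ∀ s ∈ C, IsOpen s := by
  have hb := TopologicalSpace.isBasis_countableBasis X
  have hopen : ∀ s ∈ (fun f : Set (Set X) => ⋂₀ f) ''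
      {f | f.Finite ∧ f ⊆ TopologicalSpace.countableBasis X}, IsOpen s := by
    rintro _ ⟨f, ⟨hf, hfb⟩, rfl⟩
    exact hf.isOpen_sInter fun s hs => hb.isOpen (hfb hs)
  refine ⟨(fun f : Set (Set X) => ⋂₀ f) ''
    {f | f.Finite ∧ f ⊆ TopologicalSpace.countableBasis X},
    (Set.countable_ofPred_finite_subset (TopologicalSpace.countable_countableBasis X)).image _,
    ?_, ?_, hopen⟩
  · rintro _ ⟨f, ⟨hf, hfb⟩, rfl⟩ _ ⟨g, ⟨hg, hgb⟩, rfl⟩ -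
    exact ⟨f ∪ g, ⟨hf.union hg, Set.union_subset hfb hgb⟩, Set.sInter_union f g⟩
  · refine le_antisymm ?_ (MeasurableSpace.generateFrom_le fun s hs => (hopen s hs).measurableSet)
    rw [BorelSpace.measurable_eq (α := X), hb.borel_eq_generateFrom]
    refine MeasurableSpace.generateFrom_mono fun s hs => ⟨{s}, ⟨Set.finite_singleton s, ?_⟩, ?_⟩
    · simpa using hs
    · simp

end Ergodic

/-! ### A dual orbit of full measure -/

section OrbitalIntegral

variable {d : ℕ}

/-- The integral of `f` along the dual orbit of `ξ`. -/
noncomputable def orbitalIntegral {H : Subgroup (GL (Fin d) ℝ)} [MeasurableSpace H]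
    (μ : Measure H) (f : Euc d → ℝ≥0∞) (ξ : Euc d) : ℝ≥0∞ :=
  ∫⁻ h : H, f (dualAct h.1 ξ) ∂μ

theorem measurable_dualAct (H : Subgroup (GL (Fin d) ℝ)) [SecondCountableTopology H]
    [MeasurableSpace H] [BorelSpace H] : Measurable fun p : Euc d × H => dualAct p.2.1 p.1 :=
  (continuous_dualAct_comp (continuous_subtype_val.comp continuous_snd)
    continuous_fst).measurable

theorem measurable_orbitalIntegral {H : Subgroup (GL (Fin d) ℝ)} [SecondCountableTopology H]
    [MeasurableSpace H] [BorelSpace H] (μ : Measure H) [SFinite μ] {f : Euc d → ℝ≥0∞}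
    (hf : Measurable f) : Measurable (orbitalIntegral μ f) :=
  Measurable.lintegral_prod_right' (hf.comp (measurable_dualAct H))

theorem orbitalIntegral_dualAct {H : Subgroup (GL (Fin d) ℝ)} [MeasurableSpace H] [BorelSpace H]
    (μ : Measure H) [μ.IsMulLeftInvariant] (f : Euc d → ℝ≥0∞) (k : H) (ξ : Euc d) :
    orbitalIntegral μ f (dualAct k.1 ξ) = orbitalIntegral μ f ξ := by
  rw [orbitalIntegral, orbitalIntegral,
    ← lintegral_mul_left_eq_self (fun h : H => f (dualAct h.1 ξ)) k]
  refine lintegral_congr fun h => ?_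
  rw [Subgroup.coe_mul, dualAct_mul]

/-- Ergodicity of the dual action: invariant measurable sets are null or conull. -/
def DualErgodic (H : Subgroup (GL (Fin d) ℝ)) : Prop :=
  ∀ E : Set (Euc d), MeasurableSet E → (∀ h ∈ H, ∀ ξ ∈ E, dualAct h ξ ∈ E) →
    volume E = 0 ∨ volume Eᶜ = 0

theorem DualErgodic.ae_mem_or_ae_notMem {H : Subgroup (GL (Fin d) ℝ)} (herg : DualErgodic H)
    [SecondCountableTopology H] [MeasurableSpace H] [BorelSpace H] (μ : Measure H) [SFinite μ]
    [μ.IsMulLeftInvariant] {f : Euc d → ℝ≥0∞} (hf : Measurable f) {U : Set ℝ≥0∞}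
    (hU : MeasurableSet U) :
    (∀ᵐ ξ, orbitalIntegral μ f ξ ∈ U) ∨ ∀ᵐ ξ, orbitalIntegral μ f ξ ∉ U := by
  rcases herg (orbitalIntegral μ f ⁻¹' U) (measurable_orbitalIntegral μ hf hU)
    (fun h hh ξ hξ => by
      rw [Set.mem_preimage, orbitalIntegral_dualAct μ f ⟨h, hh⟩ ξ]
      exact hξ) with h0 | h0
  · exact Or.inr (measure_eq_zero_iff_ae_notMem.1 h0)
  · exact Or.inl (mem_ae_iff.2 h0)

theorem DualErgodic.orbitalIntegral_ae_const {H : Subgroup (GL (Fin d) ℝ)} (herg : DualErgodic H)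
    [SecondCountableTopology H] [MeasurableSpace H] [BorelSpace H] (μ : Measure H) [SFinite μ]
    [μ.IsMulLeftInvariant] {f : Euc d → ℝ≥0∞} (hf : Measurable f) :
    ∃ a : ℝ≥0∞, ∀ᵐ ξ, orbitalIntegral μ f ξ = a :=
  Filter.exists_eventuallyEq_const_of_forall_separating MeasurableSet
    fun _ hU => herg.ae_mem_or_ae_notMem μ hf hU

theorem lintegral_orbitalIntegral {H : Subgroup (GL (Fin d) ℝ)}
    [SecondCountableTopology H] [MeasurableSpace H] [BorelSpace H] (μ : Measure H) [SFinite μ]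
    {f : Euc d → ℝ≥0∞} (hf : Measurable f) :
    ∫⁻ ξ, orbitalIntegral μ f ξ =
      (∫⁻ h : H, ENNReal.ofReal (absDet h.1)⁻¹ ∂μ) * ∫⁻ ξ, f ξ := by
  simp only [orbitalIntegral]
  rw [lintegral_lintegral_swap (f := fun (ξ : Euc d) (h : H) => f (dualAct h.1 ξ))
    (hf.comp (measurable_dualAct H)).aemeasurable]
  simp only [lintegral_comp_dualAct]
  rw [lintegral_mul_const _ (measurable_ofReal_inv_absDet H)]

theorem DualErgodic.orbitalIntegral_ne_zero {H : Subgroup (GL (Fin d) ℝ)} (herg : DualErgodic H)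
    [SecondCountableTopology H] [MeasurableSpace H] [BorelSpace H] (μ : Measure H) [SFinite μ]
    [μ.IsMulLeftInvariant] [NeZero μ] {φ : Euc d → ℝ≥0∞} (hφ : Measurable φ)
    (hφ0 : ¬ φ =ᵐ[volume] 0) : ∀ᵐ ξ, orbitalIntegral μ φ ξ ≠ 0 := by
  refine (herg.ae_mem_or_ae_notMem μ hφ (measurableSet_singleton 0)).resolve_left fun h0 => ?_
  have h1 : ∫⁻ ξ, orbitalIntegral μ φ ξ = 0 :=
    (lintegral_eq_zero_iff (measurable_orbitalIntegral μ hφ)).2 h0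
  rw [lintegral_orbitalIntegral μ hφ] at h1
  rcases mul_eq_zero.1 h1 with h2 | h2
  · rw [lintegral_eq_zero_iff (measurable_ofReal_inv_absDet H)] at h2
    obtain ⟨h, hh⟩ := h2.exists
    rw [Pi.zero_apply, ENNReal.ofReal_eq_zero] at hh
    exact absurd (inv_pos.2 (absDet_pos h.1)) (not_lt.2 hh)
  · exact hφ0 ((lintegral_eq_zero_iff hφ).1 h2)

/-- The square-integrability of a matrix coefficient says that `∫ φ(ξ) ∫ φ(hᵀ ξ) dh dξ` is finite,
so the orbital integral cannot be infinite almost everywhere; by ergodicity it is finite almost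
everywhere. -/
theorem DualErgodic.orbitalIntegral_ne_top {H : Subgroup (GL (Fin d) ℝ)} (herg : DualErgodic H)
    [SecondCountableTopology H] [MeasurableSpace H] [BorelSpace H] (μ : Measure H) [SFinite μ]
    [μ.IsMulLeftInvariant] {φ : Euc d → ℝ≥0∞} (hφ : Measurable φ)
    (hφ0 : ¬ φ =ᵐ[volume] 0)
    (hfin : ∫⁻ h : H, (∫⁻ ξ, φ (dualAct h.1 ξ) * φ ξ) ∂μ < ∞) :
    ∀ᵐ ξ, orbitalIntegral μ φ ξ ≠ ∞ := by
  refine (herg.ae_mem_or_ae_notMem μ hφ (measurableSet_singleton ∞)).resolve_left fun h0 => ?_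
  have hm : Measurable fun p : Euc d × H => φ (dualAct p.2.1 p.1) * φ p.1 :=
    (hφ.comp (measurable_dualAct H)).mul (hφ.comp measurable_fst)
  rw [lintegral_lintegral_swap (f := fun (h : H) (ξ : Euc d) => φ (dualAct h.1 ξ) * φ ξ)
    (hm.comp measurable_swap).aemeasurable] at hfin
  have h1 : ∀ᵐ ξ, ∫⁻ h : H, φ (dualAct h.1 ξ) * φ ξ ∂μ < ∞ :=
    ae_lt_top (Measurable.lintegral_prod_right' hm) hfin.ne
  refine hφ0 ?_
  filter_upwards [h0, h1] with ξ h2 h3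
  have hφξ : Measurable fun h : H => φ (dualAct h.1 ξ) := hφ.comp (measurable_dualAct_left H ξ)
  rw [lintegral_mul_const _ hφξ, show (∫⁻ h : H, φ (dualAct h.1 ξ) ∂μ) = ∞ from h2] at h3
  by_contra hne
  rw [ENNReal.top_mul hne] at h3
  exact lt_irrefl _ h3

/-- The push-forward of the measure `φ(hᵀ ξ) dh` to the dual orbit of `ξ`. -/
noncomputable def orbitalMeasure {H : Subgroup (GL (Fin d) ℝ)} [MeasurableSpace H]
    (μ : Measure H) (φ : Euc d → ℝ≥0∞) (ξ : Euc d) : Measure (Euc d) :=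
  Measure.map (fun h : H => dualAct h.1 ξ) (μ.withDensity fun h => φ (dualAct h.1 ξ))

theorem orbitalMeasure_apply {H : Subgroup (GL (Fin d) ℝ)} [MeasurableSpace H] [BorelSpace H]
    (μ : Measure H) (φ : Euc d → ℝ≥0∞) (ξ : Euc d) {s : Set (Euc d)} (hs : MeasurableSet s) :
    orbitalMeasure μ φ ξ s = orbitalIntegral μ (s.indicator φ) ξ := by
  have hact := measurable_dualAct_left H ξ
  rw [orbitalMeasure, Measure.map_apply hact hs, withDensity_apply _ (hact hs),
    ← lintegral_indicator (hact hs)]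
  rfl

theorem orbitalMeasure_eq_zero {H : Subgroup (GL (Fin d) ℝ)} [MeasurableSpace H] [BorelSpace H]
    (μ : Measure H) (φ : Euc d → ℝ≥0∞) (ξ : Euc d) {s : Set (Euc d)} (hs : MeasurableSet s)
    (hd : Disjoint s (dualOrbit H ξ)) : orbitalMeasure μ φ ξ s = 0 := by
  rw [orbitalMeasure_apply μ φ ξ hs]
  refine (lintegral_congr fun h => ?_).trans lintegral_zero
  exact Set.indicator_of_notMem (fun h5 => Set.disjoint_left.1 hd h5 ⟨h, rfl⟩) _

theorem mem_dualOrbit_self (H : Subgroup (GL (Fin d) ℝ)) (ξ : Euc d) : ξ ∈ dualOrbit H ξ :=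
  ⟨1, dualAct_one ξ⟩

theorem disjoint_dualOrbit {H : Subgroup (GL (Fin d) ℝ)} {ξ η : Euc d} (h : ξ ∉ dualOrbit H η) :
    Disjoint (dualOrbit H η) (dualOrbit H ξ) := by
  rw [Set.disjoint_left]
  rintro _ ⟨a, rfl⟩ ⟨k, hk⟩
  refine h ⟨a * k⁻¹, ?_⟩
  have hk' : dualAct k.1 ξ = dualAct a.1 η := hk
  simp only [Subgroup.coe_mul, Subgroup.coe_inv, dualAct_mul]
  rw [← hk', dualAct_inv_dualAct]

theorem measurableSet_dualOrbit (H : Subgroup (GL (Fin d) ℝ)) [SigmaCompactSpace H] (ξ : Euc d) :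
    MeasurableSet (dualOrbit H ξ) := by
  obtain ⟨K, hK, hKU⟩ := isSigmaCompact_range (continuous_dualAct_left H ξ)
  rw [dualOrbit, ← hKU]
  exact MeasurableSet.iUnion fun n => (hK n).measurableSet

/-- An ergodic dual action which is integrable along orbits has a conull orbit: the measure
`orbitalMeasure μ φ ξ` is an invariant function of `ξ`, hence almost everywhere the same, and
measures living on different orbits are different. -/
theorem DualErgodic.exists_conull_dualOrbit {H : Subgroup (GL (Fin d) ℝ)} (herg : DualErgodic H)
    [SigmaCompactSpace H] [SecondCountableTopology H] [MeasurableSpace H]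
    [BorelSpace H] (μ : Measure H) [SFinite μ] [μ.IsMulLeftInvariant] [NeZero μ]
    {φ : Euc d → ℝ≥0∞} (hφ : Measurable φ) (hφ0 : ¬ φ =ᵐ[volume] 0)
    (hfin : ∫⁻ h : H, (∫⁻ ξ, φ (dualAct h.1 ξ) * φ ξ) ∂μ < ∞) :
    ∃ ξ₀, volume (dualOrbit H ξ₀)ᶜ = 0 := by
  obtain ⟨C, hCc, hCpi, hCgen, hCo⟩ := exists_countable_piSystem_borel (Euc d)
  have : Countable C := hCc
  have h1 : ∀ s : C, ∃ a : ℝ≥0∞, ∀ᵐ ξ, orbitalMeasure μ φ ξ s.1 = a := fun s => by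
    have hs := (hCo s.1 s.2).measurableSet
    simp only [orbitalMeasure_apply μ φ _ hs]
    exact herg.orbitalIntegral_ae_const μ (hφ.indicator hs)
  choose a ha using h1
  have hu : ∀ ξ, orbitalMeasure μ φ ξ Set.univ = orbitalIntegral μ φ ξ := fun ξ => by
    rw [orbitalMeasure_apply μ φ ξ MeasurableSet.univ, Set.indicator_univ]
  obtain ⟨b, hb⟩ := herg.orbitalIntegral_ae_const μ hφ
  have hgood := ((ae_all_iff.2 ha).and hb).and
    ((herg.orbitalIntegral_ne_zero μ hφ hφ0).and (herg.orbitalIntegral_ne_top μ hφ hφ0 hfin))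
  obtain ⟨ξ₀, ⟨h1, h2⟩, h3, h4⟩ := hgood.exists
  refine ⟨ξ₀, ?_⟩
  have horb : MeasurableSet (dualOrbit H ξ₀) := measurableSet_dualOrbit H ξ₀
  rw [← mem_ae_iff]
  filter_upwards [hgood] with ξ ⟨⟨g1, g2⟩, g3, g4⟩
  by_contra hξ
  have : IsFiniteMeasure (orbitalMeasure μ φ ξ) := ⟨by rw [hu]; exact lt_top_iff_ne_top.2 g4⟩
  have heq : orbitalMeasure μ φ ξ = orbitalMeasure μ φ ξ₀ :=
    ext_of_generate_finite C hCgen hCpi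
      (fun s hs => (g1 ⟨s, hs⟩).trans (h1 ⟨s, hs⟩).symm) (by rw [hu, hu, g2, h2])
  have e1 := orbitalMeasure_eq_zero μ φ ξ horb (disjoint_dualOrbit hξ)
  have e2 := orbitalMeasure_eq_zero μ φ ξ₀ horb.compl disjoint_compl_left
  rw [heq] at e1
  refine h3 ?_
  rw [← hu, ← Set.union_compl_self (dualOrbit H ξ₀)]
  exact measure_union_null e1 e2

open FourierTransform in
/-- An irreducibly admissible group has a conull dual orbit. -/
theorem IrreduciblyAdmissible.exists_conull_dualOrbit {H : Subgroup (GL (Fin d) ℝ)}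
    (hclosed : IsClosed (H : Set (GL (Fin d) ℝ))) [MeasurableSpace H]
    [BorelSpace H] (μ : Measure H) [μ.IsHaarMeasure] (hadm : IrreduciblyAdmissible H μ) :
    ∃ ξ₀, volume (dualOrbit H ξ₀)ᶜ = 0 := by
  have := locallyCompactSpace_closedSubgroup hclosed
  have := secondCountableTopology_subgroup H
  obtain ⟨hirr, ψ, hψ0, hψ⟩ := hadm
  have herg : DualErgodic H := fun E hE hinv => hirr.null_or_conull hE hinv
  refine herg.exists_conull_dualOrbit μ (φ := fun ξ => ‖(𝓕 ψ) ξ‖ₑ ^ 2)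
    ((Lp.stronglyMeasurable _).measurable.enorm.pow_const 2) (fun h0 => hψ0 ?_)
    (lintegral_fourier_sq_lt_top μ hψ)
  have h1 : 𝓕 ψ = 0 := by
    refine Lp.ext ?_
    filter_upwards [h0, Lp.coeFn_zero ℂ 2 (volume : Measure (Euc d))] with ξ h2 h3
    rw [h3]
    simpa using h2
  exact (Lp.fourierTransformₗᵢ (Euc d) ℂ).map_eq_zero_iff.1 h1

end OrbitalIntegral

/-! ### The algebra spanned by `H` -/

section Span

variable {d : ℕ}

theorem act_transpose_act_transpose_comm {a b : Matrix (Fin d) (Fin d) ℝ} (h : a * b = b * a)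
    (v : Euc d) : act a.transpose (act b.transpose v) = act b.transpose (act a.transpose v) := by
  rw [← act_mul, ← act_mul, ← Matrix.transpose_mul, ← Matrix.transpose_mul, h]

theorem act_injective : Function.Injective (act : Matrix (Fin d) (Fin d) ℝ → Euc d →L[ℝ] Euc d) :=
  (Matrix.toEuclideanCLM (n := Fin d) (𝕜 := ℝ)).injective

theorem act_eq_zero_iff {a : Matrix (Fin d) (Fin d) ℝ} : act a = 0 ↔ a = 0 :=
  map_eq_zero_iff _ act_injective

/-- The linear map `a ↦ aᵀ ξ`. -/
noncomputable def evalMap (ξ : Euc d) : Matrix (Fin d) (Fin d) ℝ →ₗ[ℝ] Euc d where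
  toFun a := act a.transpose ξ
  map_add' a b := by rw [Matrix.transpose_add, act, map_add]; rfl
  map_smul' r a := by rw [Matrix.transpose_smul, act, map_smul]; rfl

theorem evalMap_apply (ξ : Euc d) (a : Matrix (Fin d) (Fin d) ℝ) :
    evalMap ξ a = act a.transpose ξ := rfl

theorem dualAct_eq_evalMap (h : GL (Fin d) ℝ) (ξ : Euc d) : dualAct h ξ = evalMap ξ h.val := rfl

/-- If `a` commutes with `H`, then `aᵀ` vanishes on the whole dual orbit of `ξ₀` as soon as it
vanishes at `ξ₀`, and a proper subspace is a null set. -/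
theorem eq_zero_of_evalMap_eq_zero {H : Subgroup (GL (Fin d) ℝ)} {ξ₀ : Euc d}
    (hpos : volume (dualOrbit H ξ₀) ≠ 0) {a : Matrix (Fin d) (Fin d) ℝ}
    (hcomm : ∀ h ∈ H, a * h.val = h.val * a) (ha : evalMap ξ₀ a = 0) : a = 0 := by
  have h1 : dualOrbit H ξ₀ ⊆
      (LinearMap.ker (act a.transpose : Euc d →ₗ[ℝ] Euc d) : Set (Euc d)) := by
    rintro _ ⟨h, rfl⟩
    have h2 := act_transpose_act_transpose_comm (hcomm h.1 h.2) ξ₀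
    rw [← evalMap_apply ξ₀ a, ha, map_zero] at h2
    exact h2
  have h3 : LinearMap.ker (act a.transpose : Euc d →ₗ[ℝ] Euc d) = ⊤ := by
    by_contra hne
    exact hpos (measure_mono_null h1 (Measure.addHaar_submodule volume _ hne))
  have h4 : act a.transpose = 0 := by
    ext1 v
    have : v ∈ LinearMap.ker (act a.transpose : Euc d →ₗ[ℝ] Euc d) := h3 ▸ Submodule.mem_top
    exact this
  rw [act_eq_zero_iff, Matrix.transpose_eq_zero] at h4
  exact h4

theorem volume_univ_ne_zero : (volume : Measure (Euc d)) Set.univ ≠ 0 :=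
  (isOpen_univ.measure_pos volume Set.univ_nonempty).ne'

theorem volume_ne_zero_of_compl {s : Set (Euc d)} (hs : volume sᶜ = 0) : volume s ≠ 0 := by
  intro h
  refine volume_univ_ne_zero (d := d) ?_
  rw [← Set.union_compl_self s]
  exact measure_union_null h hs

/-- An abelian group with a conull dual orbit is the unit group of a commutative algebra of matrices
which is mapped bijectively onto `ℝᵈ` by `a ↦ aᵀ ξ₀`. -/
theorem exists_subalgebra_of_conull {H : Subgroup (GL (Fin d) ℝ)}
    (hcomm : ∀ a ∈ H, ∀ b ∈ H, a * b = b * a) {ξ₀ : Euc d}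
    (hconull : volume (dualOrbit H ξ₀)ᶜ = 0) :
    ∃ S : Subalgebra ℝ (Matrix (Fin d) (Fin d) ℝ), (∀ a ∈ S, ∀ b ∈ S, a * b = b * a) ∧
      (∀ h : GL (Fin d) ℝ, h ∈ H ↔ h.val ∈ S) ∧
      Function.Bijective (fun a : S => evalMap ξ₀ a.1) := by
  let s : Set (Matrix (Fin d) (Fin d) ℝ) := Units.val '' (H : Set (GL (Fin d) ℝ))
  have hs : ∀ a ∈ s, ∀ b ∈ s, a * b = b * a := by
    rintro _ ⟨a, ha, rfl⟩ _ ⟨b, hb, rfl⟩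
    rw [← Units.val_mul, hcomm a ha b hb, Units.val_mul]
  have hS : ∀ a ∈ Algebra.adjoin ℝ s, ∀ b ∈ Algebra.adjoin ℝ s, a * b = b * a := by
    intro a ha b hb
    have := Algebra.isMulCommutative_adjoin ℝ hs
    exact congrArg Subtype.val (mul_comm' (⟨a, ha⟩ : Algebra.adjoin ℝ s) ⟨b, hb⟩)
  have hHS : ∀ h ∈ H, h.val ∈ Algebra.adjoin ℝ s := fun h hh =>
    Algebra.subset_adjoin ⟨h, hh, rfl⟩
  have hpos := volume_ne_zero_of_compl hconull
  have hinj : ∀ a ∈ Algebra.adjoin ℝ s, evalMap ξ₀ a = 0 → a = 0 := fun a ha h0 =>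
    eq_zero_of_evalMap_eq_zero hpos (fun h hh => hS a ha _ (hHS h hh)) h0
  refine ⟨Algebra.adjoin ℝ s, hS, fun h => ⟨hHS h, fun hh => ?_⟩, fun a b hab => ?_, fun v => ?_⟩
  · -- the orbit and its image under `hᵀ` are both conull, hence meet
    have h1 : volume (dualAct h⁻¹ ⁻¹' (dualOrbit H ξ₀)ᶜ) = 0 :=
      (quasiMeasurePreserving_dualAct h⁻¹).preimage_null hconull
    have h2 : (volume : Measure (Euc d))
        (dualOrbit H ξ₀ ∩ dualAct h⁻¹ ⁻¹' (dualOrbit H ξ₀)) ≠ 0 := by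
      refine volume_ne_zero_of_compl ?_
      rw [Set.compl_inter]
      exact measure_union_null hconull h1
    obtain ⟨_, ⟨k, rfl⟩, ⟨l, hl⟩⟩ := nonempty_of_measure_ne_zero h2
    have h3 : dualAct h (dualAct l.1 ξ₀) = dualAct k.1 ξ₀ := by
      have hl' : dualAct l.1 ξ₀ = dualAct h⁻¹ (dualAct k.1 ξ₀) := hl
      rw [hl', dualAct_dualAct_inv]
    rw [← dualAct_mul, dualAct_eq_evalMap, dualAct_eq_evalMap, ← sub_eq_zero, ← map_sub] at h3
    have h4 := hinj _ (sub_mem (by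
      rw [Units.val_mul]; exact mul_mem (hHS _ l.2) hh) (hHS _ k.2)) h3
    rw [sub_eq_zero, Units.val_inj] at h4
    rw [show h = l.1⁻¹ * k.1 by rw [← h4, inv_mul_cancel_left]]
    exact H.mul_mem (H.inv_mem l.2) k.2
  · have h1 : evalMap ξ₀ (a.1 - b.1) = 0 := by rw [map_sub, sub_eq_zero]; exact hab
    exact Subtype.ext (sub_eq_zero.1 (hinj _ (sub_mem a.2 b.2) h1))
  · have h1 : Submodule.map (evalMap ξ₀) (Subalgebra.toSubmodule (Algebra.adjoin ℝ s)) = ⊤ := by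
      by_contra hne
      refine hpos (measure_mono_null ?_ (Measure.addHaar_submodule volume _ hne))
      rintro _ ⟨h, rfl⟩
      exact ⟨h.1.val, hHS _ h.2, rfl⟩
    obtain ⟨a, ha, hv⟩ : v ∈ Submodule.map (evalMap ξ₀)
      (Subalgebra.toSubmodule (Algebra.adjoin ℝ s)) := h1 ▸ Submodule.mem_top
    exact ⟨⟨a, ha⟩, hv⟩

/-- The orbit of `ξ₀` is the linear image of the set of invertible elements, which is open. -/
theorem isOpen_dualOrbit {H : Subgroup (GL (Fin d) ℝ)}
    {S : Subalgebra ℝ (Matrix (Fin d) (Fin d) ℝ)} {ξ₀ : Euc d}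
    (hS : ∀ h : GL (Fin d) ℝ, h ∈ H ↔ h.val ∈ S)
    (hbij : Function.Bijective (fun a : S => evalMap ξ₀ a.1)) : IsOpen (dualOrbit H ξ₀) := by
  let e : S ≃ₗ[ℝ] Euc d :=
    LinearEquiv.ofBijective ((evalMap ξ₀).comp (Subalgebra.toSubmodule S).subtype) hbij
  let f : Euc d →ₗ[ℝ] Matrix (Fin d) (Fin d) ℝ :=
    (Subalgebra.toSubmodule S).subtype.comp e.symm.toLinearMap
  have hf : Continuous f := f.continuous_of_finiteDimensional
  have h1 : dualOrbit H ξ₀ = {v | (f v).det ≠ 0} := by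
    ext v
    constructor
    · rintro ⟨h, rfl⟩
      have h2 : f (dualAct h.1 ξ₀) = h.1.val :=
        congrArg Subtype.val (e.symm_apply_apply ⟨h.1.val, (hS _).1 h.2⟩)
      rw [Set.mem_ofPred_eq, h2]
      exact abs_pos.1 (absDet_pos h.1)
    · intro hv
      have hu : IsUnit (f v) := (Matrix.isUnit_iff_isUnit_det _).2 (isUnit_iff_ne_zero.2 hv)
      refine ⟨⟨hu.unit, (hS _).2 ?_⟩, ?_⟩
      · exact (e.symm v).2
      · exact e.apply_symm_apply v
  rw [h1]
  exact isOpen_ne_fun hf.matrix_det continuous_const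

theorem dualOrbit_eq_of_mem {H : Subgroup (GL (Fin d) ℝ)} {ξ η : Euc d} (h : η ∈ dualOrbit H ξ) :
    dualOrbit H η = dualOrbit H ξ := by
  obtain ⟨k, rfl⟩ := h
  ext v
  constructor
  · rintro ⟨l, rfl⟩
    exact ⟨k * l, dualAct_mul _ _ _⟩
  · rintro ⟨l, rfl⟩
    refine ⟨k⁻¹ * l, ?_⟩
    simp only [Subgroup.coe_mul, Subgroup.coe_inv, dualAct_mul]
    rw [dualAct_inv_dualAct]

theorem IsOpenDualOrbit.eq_of_conull {H : Subgroup (GL (Fin d) ℝ)} {ξ₀ : Euc d}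
    (hconull : volume (dualOrbit H ξ₀)ᶜ = 0) {O : Set (Euc d)} (hO : IsOpenDualOrbit H O) :
    O = dualOrbit H ξ₀ := by
  obtain ⟨hopen, ξ, rfl⟩ := hO
  have hpos := hopen.measure_pos volume ⟨ξ, mem_dualOrbit_self H ξ⟩
  obtain ⟨η, h1, h2⟩ : (dualOrbit H ξ ∩ dualOrbit H ξ₀).Nonempty := by
    by_contra hne
    rw [Set.not_nonempty_iff_eq_empty, ← Set.disjoint_iff_inter_eq_empty] at hne
    exact hpos.ne' (measure_mono_null (Set.subset_compl_iff_disjoint_right.2 hne) hconull)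
  rw [← dualOrbit_eq_of_mem h1, dualOrbit_eq_of_mem h2]

theorem IsOpenDualOrbit.eq_dualOrbit {H : Subgroup (GL (Fin d) ℝ)} {O : Set (Euc d)}
    (hO : IsOpenDualOrbit H O) {ξ : Euc d} (hξ : ξ ∈ O) : O = dualOrbit H ξ := by
  obtain ⟨_, η, rfl⟩ := hO
  exact (dualOrbit_eq_of_mem hξ).symm

end Span

/-! ### Commutative algebras of matrices decompose into irreducible blocks -/

section Decomposition

/-- The primitive idempotents of a commutative Artinian ring: on each block an element is either
invertible or nilpotent. -/
theorem exists_primitive_idempotents (R : Type*) [CommRing R] [IsArtinianRing R] :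
    ∃ (k : ℕ) (e : Fin k → R), CompleteOrthogonalIdempotents e ∧ (∀ i, e i ≠ 0) ∧
      ∀ a i, (∃ b, a * b * e i = e i) ∨ ∃ n : ℕ, a ^ n * e i = 0 := by
  classical
  let E := MaximalSpectrum.toPiLocalizationEquiv R
  have : Finite (MaximalSpectrum R) := inferInstance
  let := Fintype.ofFinite (MaximalSpectrum R)
  let e₀ : MaximalSpectrum R → R := fun I => E.symm (Pi.single I 1)
  have he₀ : CompleteOrthogonalIdempotents e₀ :=
    (CompleteOrthogonalIdempotents.single
      (fun I : MaximalSpectrum R => Localization.AtPrime I.asIdeal)).map E.symm.toRingHom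
  let σ := (Fintype.equivFin (MaximalSpectrum R)).symm
  refine ⟨Fintype.card (MaximalSpectrum R), e₀ ∘ σ, (CompleteOrthogonalIdempotents.equiv σ).2 he₀,
    fun i h0 => ?_, fun a i => ?_⟩
  · have h1 : (Pi.single (σ i) 1 : MaximalSpectrum.PiLocalization R) = 0 :=
      (map_eq_zero_iff E.symm E.symm.injective).1 h0
    have h2 := congrFun h1 (σ i)
    rw [Pi.single_eq_same, Pi.zero_apply] at h2
    exact one_ne_zero h2
  · set I := σ i
    have key : ∀ x : R, E x I * 1 = 1 → x * e₀ I = e₀ I := by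
      intro x hx
      apply E.injective
      rw [map_mul, show E (e₀ I) = Pi.single I 1 from E.apply_symm_apply _]
      funext J
      by_cases hJ : J = I
      · subst hJ; simpa using hx
      · simp [Pi.single_eq_of_ne hJ]
    have key0 : ∀ x : R, E x I = 0 → x * e₀ I = 0 := by
      intro x hx
      apply E.injective
      rw [map_mul, show E (e₀ I) = Pi.single I 1 from E.apply_symm_apply _, map_zero]
      funext J
      by_cases hJ : J = I
      · subst hJ; simp [hx]
      · simp [Pi.single_eq_of_ne hJ]
    by_cases hu : IsUnit (E a I)
    · left
      obtain ⟨u, hu⟩ := hu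
      refine ⟨E.symm (Pi.single I (↑u⁻¹ : Localization.AtPrime I.asIdeal)), key _ ?_⟩
      rw [map_mul, E.apply_symm_apply, mul_one, Pi.mul_apply, Pi.single_eq_same, ← hu]
      exact u.mul_inv
    · right
      have : IsArtinianRing (Localization.AtPrime I.asIdeal) := inferInstance
      obtain ⟨n, hn⟩ : IsNilpotent (E a I) := by
        have h1 : E a I ∈ IsLocalRing.maximalIdeal (Localization.AtPrime I.asIdeal) := hu
        have h2 := IsArtinianRing.isNilpotent_jacobson_bot (R := Localization.AtPrime I.asIdeal)
        rw [IsLocalRing.jacobson_eq_maximalIdeal _ bot_ne_top] at h2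
        obtain ⟨n, hn⟩ := h2
        exact ⟨n, by simpa [hn] using Ideal.pow_mem_pow h1 n⟩
      exact ⟨n, key0 _ (by rw [map_pow, Pi.pow_apply, hn])⟩

/-- A finite-dimensional commutative real algebra whose elements are invertible or nilpotent is
irreducible. If its residue field is `ℂ`, then the complex structure lifts along the nilpotent
maximal ideal because `ℂ` is formally smooth over `ℝ`. -/
theorem isIrreducibleAlgebra_of_isUnit_or_isNilpotent (A : Type*) [Ring A] [Algebra ℝ A]
    [Module.Finite ℝ A] [Nontrivial A] (hcomm : ∀ a b : A, a * b = b * a)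
    (hloc : ∀ a : A, IsUnit a ∨ IsNilpotent a) : IsIrreducibleAlgebra A := by
  refine ⟨inferInstance, hcomm, ?_⟩
  let : CommRing A := { ‹Ring A› with mul_comm := hcomm }
  have : IsLocalRing A := IsLocalRing.of_isUnit_or_isUnit_one_sub_self fun a =>
    (hloc a).imp_right IsNilpotent.isUnit_one_sub
  have hnil : ∀ a : A, IsLocalRing.residue A a = 0 → IsNilpotent a := fun a ha =>
    (hloc a).resolve_left ((IsLocalRing.mem_maximalIdeal a).1
      ((IsLocalRing.residue_eq_zero_iff a).1 ha))
  have : IsArtinianRing A := IsArtinianRing.of_finite ℝ A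
  have hI : IsNilpotent (IsLocalRing.maximalIdeal A) := by
    rw [← IsLocalRing.jacobson_eq_maximalIdeal _ bot_ne_top]
    exact IsArtinianRing.isNilpotent_jacobson_bot
  have : Module.Finite ℝ (IsLocalRing.ResidueField A) :=
    Module.Finite.of_surjective
      (IsScalarTower.toAlgHom ℝ A (IsLocalRing.ResidueField A)).toLinearMap
      IsLocalRing.residue_surjective
  rcases Real.nonempty_algEquiv_or (IsLocalRing.ResidueField A) with ⟨⟨σ⟩⟩ | ⟨⟨σ⟩⟩
  · left
    intro a
    refine ⟨σ (IsLocalRing.residue A a), hnil _ (σ.injective ?_)⟩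
    rw [map_sub, map_sub, map_zero, sub_eq_zero]
    exact (σ.commutes (σ (IsLocalRing.residue A a))).symm
  · right
    obtain ⟨f, hf⟩ := Algebra.FormallySmooth.exists_lift (R := ℝ) (A := ℂ)
      (IsLocalRing.maximalIdeal A) hI σ.symm.toAlgHom
    refine ⟨f, fun a => ⟨σ (IsLocalRing.residue A a), hnil _ ?_⟩⟩
    have h1 : IsLocalRing.residue A (f (σ (IsLocalRing.residue A a))) =
        σ.symm (σ (IsLocalRing.residue A a)) := DFunLike.congr_fun hf _
    rw [map_sub, h1, σ.symm_apply_apply, sub_self]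

end Decomposition

section Blocks

variable {d : ℕ}

/-- The representation of a commutative algebra of matrices on an invariant subspace, in terms of a
basis. -/
noncomputable def blockRep (S : Subalgebra ℝ (Matrix (Fin d) (Fin d) ℝ))
    (N : Submodule ℝ (Fin d → ℝ)) (hN : ∀ a ∈ S, Set.MapsTo (Matrix.toLin' a) N N) {m : ℕ}
    (b : Module.Basis (Fin m) ℝ N) : S →ₐ[ℝ] Matrix (Fin m) (Fin m) ℝ :=
  (LinearMap.toMatrixAlgEquiv b).toAlgHom.comp
    { toFun := fun a => (Matrix.toLin' a.1).restrict (hN a.1 a.2)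
      map_one' := by ext x; simp
      map_zero' := by ext x; simp
      map_add' := fun a c => LinearMap.ext fun x => Subtype.ext <| by
        change Matrix.toLin' (a.1 + c.1) x.1 = Matrix.toLin' a.1 x.1 + Matrix.toLin' c.1 x.1
        rw [map_add, LinearMap.add_apply]
      map_mul' := fun a c => LinearMap.ext fun x => Subtype.ext <| by
        change Matrix.toLin' (a.1 * c.1) x.1 = Matrix.toLin' a.1 (Matrix.toLin' c.1 x.1)
        rw [Matrix.toLin'_mul, LinearMap.comp_apply]
      commutes' := fun r => by
        ext x
        simp [Algebra.algebraMap_eq_smul_one] }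

theorem blockRep_apply (S : Subalgebra ℝ (Matrix (Fin d) (Fin d) ℝ))
    (N : Submodule ℝ (Fin d → ℝ)) (hN : ∀ a ∈ S, Set.MapsTo (Matrix.toLin' a) N N) {m : ℕ}
    (b : Module.Basis (Fin m) ℝ N) (a : S) :
    blockRep S N hN b a = LinearMap.toMatrix b b ((Matrix.toLin' a.1).restrict (hN a.1 a.2)) := rfl

theorem blockRep_eq_zero (S : Subalgebra ℝ (Matrix (Fin d) (Fin d) ℝ))
    (N : Submodule ℝ (Fin d → ℝ)) (hN : ∀ a ∈ S, Set.MapsTo (Matrix.toLin' a) N N) {m : ℕ}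
    (b : Module.Basis (Fin m) ℝ N) (a : S) (ha : ∀ v ∈ N, Matrix.toLin' a.1 v = 0) :
    blockRep S N hN b a = 0 := by
  rw [blockRep_apply, LinearEquiv.map_eq_zero_iff]
  ext v
  exact congrFun (ha v.1 v.2) _

theorem blockRep_eq_one (S : Subalgebra ℝ (Matrix (Fin d) (Fin d) ℝ))
    (N : Submodule ℝ (Fin d → ℝ)) (hN : ∀ a ∈ S, Set.MapsTo (Matrix.toLin' a) N N) {m : ℕ}
    (b : Module.Basis (Fin m) ℝ N) (a : S) (ha : ∀ v ∈ N, Matrix.toLin' a.1 v = v) :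
    blockRep S N hN b a = 1 := by
  rw [blockRep_apply, ← LinearMap.toMatrix_id b]
  congr 1
  ext v
  exact congrFun (ha v.1 v.2) _

/-- The unit group of a commutative algebra of matrices has a block decomposition; the blocks are
the ranges of the primitive idempotents. -/
theorem nonempty_blockDecomposition {H : Subgroup (GL (Fin d) ℝ)}
    {S : Subalgebra ℝ (Matrix (Fin d) (Fin d) ℝ)} (hcomm : ∀ a ∈ S, ∀ b ∈ S, a * b = b * a)
    (hS : ∀ h : GL (Fin d) ℝ, h ∈ H ↔ h.val ∈ S) : Nonempty (BlockDecomposition H) := by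
  classical
  let : CommRing S :=
    { (inferInstance : Ring S) with
      mul_comm := fun a b => Subtype.ext (hcomm a.1 a.2 b.1 b.2) }
  have : IsArtinianRing S := IsArtinianRing.of_finite ℝ S
  obtain ⟨k, e, he, he0, hloc⟩ := exists_primitive_idempotents S
  let N : Fin k → Submodule ℝ (Fin d → ℝ) := fun i => LinearMap.range (Matrix.toLin' (e i).1)
  have hmul : ∀ (a c : S) (v : Fin d → ℝ),
      Matrix.toLin' (a * c).1 v = Matrix.toLin' a.1 (Matrix.toLin' c.1 v) := fun a c v => by
    rw [show (a * c).1 = a.1 * c.1 from rfl, Matrix.toLin'_mul]; rfl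
  have hinv : ∀ i, ∀ a ∈ S, Set.MapsTo (Matrix.toLin' a) (N i) (N i) := by
    rintro i a ha _ ⟨v, rfl⟩
    refine ⟨Matrix.toLin' a v, ?_⟩
    rw [← hmul (e i) ⟨a, ha⟩, mul_comm (e i), hmul]
  have hfix : ∀ i, ∀ v ∈ N i, Matrix.toLin' (e i).1 v = v := by
    rintro i _ ⟨v, rfl⟩
    rw [← hmul, (he.idem i).eq]
  have hkill : ∀ i j, i ≠ j → ∀ v ∈ N j, Matrix.toLin' (e i).1 v = 0 := by
    rintro i j hij _ ⟨v, rfl⟩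
    rw [← hmul, he.ortho hij]
    simp
  have hint : DirectSum.IsInternal N := by
    rw [DirectSum.isInternal_submodule_iff_iSupIndep_and_iSup_eq_top]
    constructor
    · intro i
      rw [Submodule.disjoint_def]
      intro v hv hv'
      have h1 : ⨆ j, ⨆ (_ : j ≠ i), N j ≤ LinearMap.ker (Matrix.toLin' (e i).1) :=
        iSup₂_le fun j hj v hv => hkill i j hj.symm v hv
      rw [← hfix i v hv]
      exact h1 hv'
    · rw [eq_top_iff]
      intro v _
      have h1 : v = ∑ i, Matrix.toLin' (e i).1 v := by
        have h2 : (∑ i, (e i).1) = 1 := by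
          have := congrArg Subtype.val he.complete
          rwa [AddSubmonoidClass.coe_finsetSum] at this
        rw [← LinearMap.sum_apply, ← map_sum, h2, Matrix.toLin'_one, LinearMap.id_apply]
      rw [h1]
      exact sum_mem fun i _ => Submodule.mem_iSup_of_mem i ⟨v, rfl⟩
  let b : ∀ i, Module.Basis (Fin (Module.finrank ℝ (N i))) ℝ (N i) := fun i =>
    Module.finBasis ℝ (N i)
  let c := hint.collectedBasis b
  let σ : (Σ i, Fin (Module.finrank ℝ (N i))) ≃ Fin d := c.indexEquiv (Pi.basisFun ℝ (Fin d))
  let c' := c.reindex σ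
  let ρ : ∀ i, S →ₐ[ℝ] Matrix (Fin (Module.finrank ℝ (N i))) (Fin (Module.finrank ℝ (N i))) ℝ :=
    fun i => blockRep S (N i) (hinv i) (b i)
  let g : GL (Fin d) ℝ :=
    ⟨(Pi.basisFun ℝ (Fin d)).toMatrix c', c'.toMatrix (Pi.basisFun ℝ (Fin d)),
      Module.Basis.toMatrix_mul_toMatrix_flip _ _, Module.Basis.toMatrix_mul_toMatrix_flip _ _⟩
  have hconj : ∀ a : S, (g⁻¹).val * a.1 * g.val =
      Matrix.reindex σ σ (Matrix.blockDiagonal' fun i => ρ i a) := by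
    intro a
    have h1 : (g⁻¹).val * a.1 * g.val = LinearMap.toMatrix c' c' (Matrix.toLin' a.1) := by
      have h2 := basis_toMatrix_mul_linearMap_toMatrix_mul_basis_toMatrix c'
        (Pi.basisFun ℝ (Fin d)) c' (Pi.basisFun ℝ (Fin d)) (Matrix.toLin' a.1)
      rw [← h2, ← LinearMap.toMatrix'_toLin' a.1, ← LinearMap.toMatrix_eq_toMatrix']
      simp only [LinearMap.toMatrix'_toLin', LinearMap.toMatrix_eq_toMatrix']
      rfl
    have h3 := LinearMap.toMatrix_directSum_collectedBasis_eq_blockDiagonal' hint hint b b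
      (f := Matrix.toLin' a.1) (fun i => hinv i a.1 a.2)
    rw [h1]
    have h4 : LinearMap.toMatrix c' c' (Matrix.toLin' a.1) =
        Matrix.reindex σ σ (LinearMap.toMatrix c c (Matrix.toLin' a.1)) := by
      ext i j
      simp [c', LinearMap.toMatrix_apply]
    rw [h4, h3]
    rfl
  have hρe : ∀ i, ρ i (e i) = 1 := fun i => blockRep_eq_one _ _ _ _ _ (hfix i)
  have hρe0 : ∀ i j, j ≠ i → ρ i (e j) = 0 := fun i j hj =>
    blockRep_eq_zero _ _ _ _ _ (hkill j i hj)
  have hN0 : ∀ i, Nontrivial (N i) := fun i => by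
    refine Submodule.nontrivial_iff_ne_bot.2 fun h0 => he0 i ?_
    have h1 := LinearMap.range_eq_bot.1 h0
    rw [LinearEquiv.map_eq_zero_iff] at h1
    exact Subtype.ext h1
  refine ⟨{ k := k
            dim := fun i => Module.finrank ℝ (N i)
            alg := fun i => (ρ i).range
            irreducible := fun i => ?_
            e := σ
            g := g
            mem_iff := fun h => ⟨fun hh => ?_, ?_⟩ }⟩
  · have := hN0 i
    have hpos : 0 < Module.finrank ℝ (N i) := Module.finrank_pos
    have : Nonempty (Fin (Module.finrank ℝ (N i))) := ⟨⟨0, hpos⟩⟩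
    refine isIrreducibleAlgebra_of_isUnit_or_isNilpotent _ ?_ ?_
    · rintro ⟨_, a, rfl⟩ ⟨_, a', rfl⟩
      refine Subtype.ext ?_
      change (ρ i) a * (ρ i) a' = (ρ i) a' * (ρ i) a
      rw [← map_mul, mul_comm, map_mul]
    · rintro ⟨_, a, rfl⟩
      rcases hloc a i with ⟨a', ha'⟩ | ⟨n, hn⟩
      · left
        have h1 : (ρ i) a * (ρ i) a' = 1 := by
          rw [← map_mul, ← mul_one (ρ i (a * a')), ← hρe i, ← map_mul, ha']
        have h2 : (ρ i) a' * (ρ i) a = 1 := by rw [← map_mul, mul_comm, map_mul, h1]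
        exact ⟨⟨⟨(ρ i) a, a, rfl⟩, ⟨(ρ i) a', a', rfl⟩, Subtype.ext h1, Subtype.ext h2⟩, rfl⟩
      · right
        refine ⟨n, Subtype.ext ?_⟩
        change (ρ i) a ^ n = 0
        rw [← map_pow, ← mul_one (ρ i (a ^ n)), ← hρe i, ← map_mul, hn, map_zero]
  · let u : Sˣ := ⟨⟨h.val, (hS h).1 hh⟩, ⟨(h⁻¹).val, (hS _).1 (H.inv_mem hh)⟩,
      Subtype.ext (by simp), Subtype.ext (by simp)⟩
    refine ⟨fun i => Units.map (ρ i).rangeRestrict.toMonoidHom u, ?_⟩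
    rw [Units.val_mul, Units.val_mul, hconj ⟨h.val, (hS h).1 hh⟩]
    rfl
  · rintro ⟨β, hβ⟩
    have h1 : ∀ i, ∃ a : S, ρ i a = (β i).1.1 := fun i => (β i).1.2
    choose a ha using h1
    have h2 : ∀ i, ρ i (∑ j, a j * e j) = (β i).1.1 := by
      intro i
      rw [map_sum, Finset.sum_eq_single i]
      · rw [map_mul, hρe, mul_one, ha]
      · intro j _ hj
        rw [map_mul, hρe0 i j hj, mul_zero]
      · simp
    have h3 := hconj (∑ j, a j * e j)
    simp only [h2] at h3
    rw [← hβ, Units.val_mul, Units.val_mul, Units.mul_left_inj, Units.mul_right_inj] at h3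
    rw [hS, ← h3]
    exact (∑ j, a j * e j).2

end Blocks

/-! ### Scalar parts and inverses in an irreducible algebra -/

section ScalarPart

open scoped Matrix.Norms.L2Operator

theorem exists_norm_le_of_finiteDimensional {E F : Type*} [NormedAddCommGroup E] [NormedSpace ℝ E]
    [FiniteDimensional ℝ E] [NormedAddCommGroup F] [NormedSpace ℝ F] (L : E →ₗ[ℝ] F) :
    ∃ C : ℝ, 0 ≤ C ∧ ∀ x, ‖L x‖ ≤ C * ‖x‖ :=
  ⟨‖L.toContinuousLinearMap‖, norm_nonneg _, fun x => L.toContinuousLinearMap.le_opNorm x⟩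

theorem exists_norm_le_of_injective {E F : Type*} [NormedAddCommGroup E] [NormedSpace ℝ E]
    [FiniteDimensional ℝ E] [NormedAddCommGroup F] [NormedSpace ℝ F] (L : E →ₗ[ℝ] F)
    (hL : ∀ x, L x = 0 → x = 0) : ∃ C : ℝ, 0 ≤ C ∧ ∀ x, ‖x‖ ≤ C * ‖L x‖ := by
  obtain ⟨K, _, hK⟩ := L.exists_antilipschitzWith (LinearMap.ker_eq_bot'.2 hL)
  refine ⟨K, K.2, fun x => ?_⟩
  have := hK.le_mul_dist x 0
  rwa [map_zero, dist_zero_right, dist_zero_right] at this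

theorem abs_det_le {m : ℕ} (a : Matrix (Fin m) (Fin m) ℝ) :
    |a.det| ≤ (m.factorial : ℝ) * ‖a‖ ^ m := by
  have hentry : ∀ i j, AbsoluteValue.abs (a i j) ≤ ‖a‖ := by
    intro i j
    have h1 : a i j = (act a (EuclideanSpace.single j 1)) i := by
      simp [act]
    have h2 : ‖(act a (EuclideanSpace.single j 1)) i‖ ≤ ‖act a (EuclideanSpace.single j 1)‖ :=
      PiLp.norm_apply_le _ _
    have h3 := (act a).le_opNorm (EuclideanSpace.single j 1)
    rw [PiLp.norm_single, norm_one, mul_one] at h3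
    rw [AbsoluteValue.abs_apply, h1, ← Real.norm_eq_abs]
    exact h2.trans h3
  have := Matrix.det_le hentry
  rwa [Fintype.card_fin, nsmul_eq_mul] at this

theorem det_one_add_of_isNilpotent {m : ℕ} {a : Matrix (Fin m) (Fin m) ℝ} (ha : IsNilpotent a) :
    (1 + a).det = 1 := by
  have h1 := (Matrix.isNilpotent_charpoly_sub_pow_of_isNilpotent ha).eq_zero
  rw [sub_eq_zero, Fintype.card_fin] at h1
  have h2 := Matrix.eval_charpoly a (-1)
  rw [h1, Polynomial.eval_pow, Polynomial.eval_X] at h2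
  have h3 : Matrix.scalar (Fin m) (-1 : ℝ) - a = -(1 + a) := by
    rw [map_neg, map_one, neg_add, sub_eq_add_neg]
  rw [h3, Matrix.det_neg, Fintype.card_fin] at h2
  have h4 : ((-1 : ℝ) ^ m) ≠ 0 := pow_ne_zero _ (by norm_num)
  exact (mul_left_cancel₀ h4 (by rw [mul_one]; exact h2)).symm

/-- `|det φ(z)|` is comparable to `|z|^m`, by homogeneity and compactness of the unit sphere. -/
theorem exists_norm_pow_le_abs_det {𝕜 : Type*} [RCLike 𝕜] {m : ℕ}
    (φ : 𝕜 →ₐ[ℝ] Matrix (Fin m) (Fin m) ℝ) :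
    ∃ C : ℝ, 0 < C ∧ ∀ z, ‖z‖ ^ m ≤ C * |(φ z).det| := by
  have : FiniteDimensional ℝ 𝕜 := inferInstance
  have hφ : Continuous φ := φ.toLinearMap.continuous_of_finiteDimensional
  have hcont : Continuous fun z => |(φ z).det| := hφ.matrix_det.abs
  obtain ⟨u, hu, hmin⟩ := (isCompact_sphere (0 : 𝕜) 1).exists_isMinOn ⟨1, by simp⟩
    hcont.continuousOn
  have hunit : ∀ z : 𝕜, z ≠ 0 → 0 < |(φ z).det| := fun z hz =>
    abs_pos.2 (((Matrix.isUnit_iff_isUnit_det _).1 ((isUnit_iff_ne_zero.2 hz).map φ)).ne_zero)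
  have hu0 : 0 < |(φ u).det| := hunit u (by
    rintro rfl
    simp at hu)
  refine ⟨|(φ u).det|⁻¹, inv_pos.2 hu0, fun z => ?_⟩
  obtain ⟨v, hv, hz⟩ : ∃ v : 𝕜, ‖v‖ = 1 ∧ z = ‖z‖ • v := by
    by_cases hz : z = 0
    · exact ⟨1, norm_one, by simp [hz]⟩
    · refine ⟨‖z‖⁻¹ • z, by simp [norm_smul, hz], ?_⟩
      rw [smul_smul, mul_inv_cancel₀ (norm_ne_zero_iff.2 hz), one_smul]
  have h1 : |(φ z).det| = ‖z‖ ^ m * |(φ v).det| := by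
    conv_lhs => rw [hz]
    rw [map_smul, Matrix.det_smul, Fintype.card_fin, abs_mul, abs_of_nonneg (by positivity)]
  have h2 : |(φ u).det| ≤ |(φ v).det| := hmin (by simp [hv])
  rw [h1, inv_mul_eq_div, le_div_iff₀ hu0]
  exact mul_le_mul_of_nonneg_left h2 (by positivity)

/-- Determinant and inverse of an invertible element `b` of an irreducible algebra are controlled by
the size `t` of its scalar part `c`: the determinant of `b` is that of `c`, and the inverse is given
by the terminating Neumann series for scalar plus nilpotent. -/
theorem exists_scalarPart_of_algHom {𝕜 : Type*} [RCLike 𝕜] {m : ℕ}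
    {S : Subalgebra ℝ (Matrix (Fin m) (Fin m) ℝ)} (hm : 0 < m)
    (hcomm : ∀ a b : S, a * b = b * a) (φ : 𝕜 →ₐ[ℝ] S)
    (hφ : ∀ a : S, ∃ z : 𝕜, IsNilpotent (a - φ z)) {n : ℕ}
    (hn : ∀ a : S, IsNilpotent a → a ^ n = 0) :
    ∃ C : ℝ, 1 ≤ C ∧ ∀ b : Sˣ, ∃ (c : S) (t : ℝ), 0 < t ∧ IsNilpotent (b.1 - c) ∧
      ‖c.1‖ ≤ C * t ∧ t ^ m ≤ C * |b.1.1.det| ∧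
      ‖(b⁻¹).1.1‖ ≤ C / t * ∑ j ∈ Finset.range n, (C * ‖b.1.1‖ / t) ^ j := by
  have : Nonempty (Fin m) := ⟨⟨0, hm⟩⟩
  obtain ⟨C₁, hC₁, h₁⟩ := exists_norm_le_of_finiteDimensional (S.val.comp φ).toLinearMap
  obtain ⟨C₂, hC₂, h₂⟩ := exists_norm_pow_le_abs_det (S.val.comp φ)
  have h₁' : ∀ z, ‖(φ z).1‖ ≤ C₁ * ‖z‖ := h₁
  have h₂' : ∀ z, ‖z‖ ^ m ≤ C₂ * |(φ z).1.det| := h₂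
  set C₃ : ℝ := max 1 (C₂ * m.factorial) with hC₃
  have hC₃1 : 1 ≤ C₃ := le_max_left _ _
  set C : ℝ := max (max 1 C₂) (max C₁ (C₁ * (1 + C₁ * C₃))) with hC
  have hC1 : 1 ≤ C := (le_max_left _ _).trans (le_max_left _ _)
  have hCC₂ : C₂ ≤ C := (le_max_right _ _).trans (le_max_left _ _)
  have hCC₁ : C₁ ≤ C := (le_max_left _ _).trans (le_max_right _ _)
  have hCC₃ : C₁ * (1 + C₁ * C₃) ≤ C := (le_max_right _ _).trans (le_max_right _ _)
  refine ⟨C, hC1, fun b => ?_⟩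
  let : CommRing S := { (inferInstance : Ring S) with mul_comm := hcomm }
  obtain ⟨z, hz⟩ := hφ b.1
  have hz0 : z ≠ 0 := by
    rintro rfl
    rw [map_zero, sub_zero] at hz
    have : Nontrivial S := inferInstance
    exact (IsNilpotent.not_isUnit hz) b.isUnit
  have ht : 0 < ‖z‖ := norm_pos_iff.2 hz0
  set ν : S := b.1 - φ z with hν
  have hb : b.1 = φ z + ν := by rw [hν]; ring
  have hcc : φ z * φ z⁻¹ = 1 := by rw [← map_mul, mul_inv_cancel₀ hz0, map_one]
  have hdet : |b.1.1.det| = |(φ z).1.det| := by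
    have h3 : b.1.1 = (φ z).1 * (1 + (φ z⁻¹ * ν).1) := by
      have : b.1 = φ z * (1 + φ z⁻¹ * ν) := by
        rw [mul_add, ← mul_assoc, hcc, hb]; ring
      exact congrArg Subtype.val this
    have h4 : IsNilpotent (φ z⁻¹ * ν).1 := by
      obtain ⟨r, hr⟩ := (Commute.all (φ z⁻¹) ν).isNilpotent_mul_left hz
      exact ⟨r, congrArg Subtype.val hr⟩
    rw [h3, Matrix.det_mul, det_one_add_of_isNilpotent h4, mul_one]
  -- `t ≤ C₃ ‖b‖` because `t ^ m ≤ C₂ |det b| ≤ C₂ m! ‖b‖ ^ m`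
  have htb : ‖z‖ ≤ C₃ * ‖b.1.1‖ := by
    refine le_of_pow_le_pow_left₀ hm.ne' (by positivity) ?_
    calc ‖z‖ ^ m ≤ C₂ * |b.1.1.det| := by rw [hdet]; exact h₂' z
      _ ≤ C₂ * (m.factorial * ‖b.1.1‖ ^ m) := by gcongr; exact abs_det_le _
      _ = C₂ * m.factorial * ‖b.1.1‖ ^ m := by ring
      _ ≤ C₃ ^ m * ‖b.1.1‖ ^ m := by
          gcongr
          exact (le_max_right _ _).trans (le_self_pow₀ hC₃1 hm.ne')
      _ = (C₃ * ‖b.1.1‖) ^ m := by rw [mul_pow]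
  refine ⟨φ z, ‖z‖, ht, hz, (h₁' z).trans (by gcongr), ?_, ?_⟩
  · rw [hdet]
    exact (h₂' z).trans (by gcongr)
  · set x : S := -(φ z⁻¹ * ν) with hx
    have hxn : x ^ n = 0 := by
      rw [hx, neg_pow, mul_pow, hn ν hz, mul_zero, mul_zero]
    have hinv : (b⁻¹).1 = φ z⁻¹ * ∑ j ∈ Finset.range n, x ^ j := by
      rw [← mul_one (b⁻¹).1, Units.inv_mul_eq_iff_eq_mul]
      have h3 : b.1 = φ z * (1 - x) := by
        rw [hx, sub_neg_eq_add, mul_add, ← mul_assoc, hcc, hb]; ring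
      calc (1 : S) = φ z * φ z⁻¹ * ((1 - x) * ∑ j ∈ Finset.range n, x ^ j) := by
            rw [mul_neg_geom_sum, hxn, hcc, sub_zero, mul_one]
        _ = b.1 * (φ z⁻¹ * ∑ j ∈ Finset.range n, x ^ j) := by rw [h3]; ring
    have hc' : ‖(φ z⁻¹).1‖ ≤ C₁ / ‖z‖ := by
      have := h₁' z⁻¹
      rwa [norm_inv] at this
    have hxnorm : ‖x.1‖ ≤ C * ‖b.1.1‖ / ‖z‖ := by
      have h3 : ‖ν.1‖ ≤ ‖b.1.1‖ + C₁ * (C₃ * ‖b.1.1‖) :=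
        (norm_sub_le _ _).trans (add_le_add le_rfl ((h₁' z).trans (by gcongr)))
      calc ‖x.1‖ = ‖(φ z⁻¹).1 * ν.1‖ := norm_neg _
        _ ≤ ‖(φ z⁻¹).1‖ * ‖ν.1‖ := norm_mul_le _ _
        _ ≤ C₁ / ‖z‖ * (‖b.1.1‖ + C₁ * (C₃ * ‖b.1.1‖)) := by gcongr
        _ = C₁ * (1 + C₁ * C₃) * ‖b.1.1‖ / ‖z‖ := by ring
        _ ≤ C * ‖b.1.1‖ / ‖z‖ := by gcongr
    have hsum : ‖(∑ j ∈ Finset.range n, x ^ j : S).1‖ ≤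
        ∑ j ∈ Finset.range n, (C * ‖b.1.1‖ / ‖z‖) ^ j := by
      rw [AddSubmonoidClass.coe_finsetSum]
      refine (norm_sum_le _ _).trans (Finset.sum_le_sum fun j _ => ?_)
      rw [SubmonoidClass.coe_pow]
      exact (norm_pow_le _ _).trans (by gcongr)
    rw [hinv]
    calc ‖(φ z⁻¹).1 * (∑ j ∈ Finset.range n, x ^ j : S).1‖
        ≤ ‖(φ z⁻¹).1‖ * ‖(∑ j ∈ Finset.range n, x ^ j : S).1‖ := norm_mul_le _ _
      _ ≤ C / ‖z‖ * _ := by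
        refine mul_le_mul (hc'.trans (by gcongr)) hsum (norm_nonneg _) (by positivity)

/-- The two kinds of irreducible algebras, treated uniformly. -/
theorem IsIrreducibleAlgebra.exists_scalarPart {m : ℕ}
    {S : Subalgebra ℝ (Matrix (Fin m) (Fin m) ℝ)} (hS : IsIrreducibleAlgebra S) {n : ℕ}
    (hn : ∀ a : S, IsNilpotent a → a ^ n = 0) :
    ∃ C : ℝ, 1 ≤ C ∧ ∀ b : Sˣ, ∃ (c : S) (t : ℝ), 0 < t ∧ IsNilpotent (b.1 - c) ∧
      ‖c.1‖ ≤ C * t ∧ t ^ m ≤ C * |b.1.1.det| ∧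
      ‖(b⁻¹).1.1‖ ≤ C / t * ∑ j ∈ Finset.range n, (C * ‖b.1.1‖ / t) ^ j := by
  obtain ⟨hnt, hcomm, hK⟩ := hS
  have hm : 0 < m := by
    rcases Nat.eq_zero_or_pos m with rfl | hm
    · exact absurd (Subtype.ext (Subsingleton.elim _ _)) (one_ne_zero (α := S))
    · exact hm
  rcases hK with hK | ⟨φ, hK⟩
  · exact exists_scalarPart_of_algHom (𝕜 := ℝ) hm hcomm (Algebra.ofId ℝ S) hK hn
  · exact exists_scalarPart_of_algHom (𝕜 := ℂ) hm hcomm φ hK hn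

end ScalarPart

/-! ### The nilpotency class -/

section NilpotencyClass

/-- The infimum defining the nilpotency class is attained, because the nilradical of a commutative
Artinian ring is nilpotent. -/
theorem list_prod_eq_zero_of_algNilpotencyClass (A : Type*) [Ring A] [Algebra ℝ A]
    [Module.Finite ℝ A] (hcomm : ∀ a b : A, a * b = b * a) {l : List A}
    (hl : l.length = algNilpotencyClass A) (h : ∀ a ∈ l, IsNilpotent a) : l.prod = 0 := by
  let : CommRing A := { ‹Ring A› with mul_comm := hcomm }
  have : IsArtinianRing A := IsArtinianRing.of_finite ℝ A
  have hprod : ∀ l : List A, (∀ a ∈ l, IsNilpotent a) → l.prod ∈ nilradical A ^ l.length := by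
    intro l
    induction l with
    | nil => intro _; simp
    | cons a l ih =>
      intro hl
      rw [List.prod_cons, List.length_cons, pow_succ']
      exact Ideal.mul_mem_mul (mem_nilradical.2 (hl a (by simp)))
        (ih fun b hb => hl b (by simp [hb]))
  obtain ⟨N, hN⟩ := IsArtinianRing.isNilpotent_nilradical (R := A)
  have hne : {n : ℕ | ∀ l : List A, l.length = n → (∀ a ∈ l, IsNilpotent a) →
      l.prod = 0}.Nonempty :=
    ⟨N, fun l hlN hln => by
      have := hprod l hln
      rwa [hlN, hN] at this⟩
  exact Nat.sInf_mem hne l hl h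

theorem pow_eq_zero_of_algNilpotencyClass_le (A : Type*) [Ring A] [Algebra ℝ A]
    [Module.Finite ℝ A] (hcomm : ∀ a b : A, a * b = b * a) {n : ℕ}
    (hn : algNilpotencyClass A ≤ n) {a : A} (ha : IsNilpotent a) : a ^ n = 0 := by
  refine pow_eq_zero_of_le hn ?_
  rw [← List.prod_replicate]
  exact list_prod_eq_zero_of_algNilpotencyClass A hcomm (List.length_replicate ..)
    fun b hb => (List.eq_of_mem_replicate hb) ▸ ha

theorem algNilpotencyClass_pos (A : Type*) [Ring A] [Algebra ℝ A]
    [Module.Finite ℝ A] [Nontrivial A] (hcomm : ∀ a b : A, a * b = b * a) :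
    0 < algNilpotencyClass A := by
  rw [Nat.pos_iff_ne_zero]
  intro h0
  have := list_prod_eq_zero_of_algNilpotencyClass A hcomm (l := []) (by rw [h0]; rfl) (by simp)
  exact one_ne_zero this

end NilpotencyClass

/-! ### The envelope function -/

section Envelope

variable {d : ℕ}

theorem envelope_nonneg (O : Set (Euc d)) (ξ : Euc d) : 0 ≤ envelope O ξ :=
  le_min (div_nonneg Metric.infDist_nonneg (by positivity)) (by positivity)

theorem envelope_le_infDist (O : Set (Euc d)) (ξ : Euc d) :
    envelope O ξ ≤ Metric.infDist ξ Oᶜ := by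
  refine (min_le_left _ _).trans (div_le_self Metric.infDist_nonneg ?_)
  linarith [Real.sqrt_nonneg (‖ξ‖ ^ 2 - Metric.infDist ξ Oᶜ ^ 2)]

theorem envelope_le_inv (O : Set (Euc d)) (ξ : Euc d) : envelope O ξ ≤ 1 / (1 + ‖ξ‖) :=
  min_le_right _ _

theorem envelope_le_one (O : Set (Euc d)) (ξ : Euc d) : envelope O ξ ≤ 1 :=
  (envelope_le_inv O ξ).trans (div_le_one_of_le₀ (by linarith [norm_nonneg ξ]) (by positivity))

theorem envelope_mul_norm_le (O : Set (Euc d)) (ξ : Euc d) : envelope O ξ * ‖ξ‖ ≤ 1 := by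
  have h := envelope_le_inv O ξ
  rw [le_div_iff₀ (by positivity)] at h
  nlinarith [envelope_nonneg O ξ, norm_nonneg ξ]

theorem continuous_envelope (O : Set (Euc d)) : Continuous (envelope O) := by
  have h1 : Continuous fun ξ => Metric.infDist ξ Oᶜ := Metric.continuous_infDist_pt _
  refine Continuous.min (h1.div (continuous_const.add
    ((continuous_norm.pow 2).sub (h1.pow 2)).sqrt) fun ξ => ?_)
    (continuous_const.div (continuous_const.add continuous_norm) fun ξ => ?_)
  · positivity
  · positivity

theorem envelope_eq_zero {O : Set (Euc d)} {ξ : Euc d} (h : ξ ∉ O) : envelope O ξ = 0 :=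
  le_antisymm ((envelope_le_infDist O ξ).trans
    (Metric.infDist_zero_of_mem (s := Oᶜ) h).le) (envelope_nonneg O ξ)

end Envelope

/-! ### Decay of `h` in terms of the envelope function -/

theorem det_blockDiagonal' {k : ℕ} {m : Fin k → ℕ} (β : ∀ i, Matrix (Fin (m i)) (Fin (m i)) ℝ) :
    (Matrix.blockDiagonal' β).det = ∏ i, (β i).det := by
  rw [(Matrix.blockTriangular_blockDiagonal' β).det_fintype]
  refine Finset.prod_congr rfl fun i _ => ?_
  rw [← Matrix.det_submatrix_equiv_self (Equiv.sigmaSubtype i).symm]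
  congr 1
  ext x y
  exact Matrix.blockDiagonal'_apply_eq β i x y

namespace BlockDecomposition

open scoped Matrix.Norms.L2Operator

variable {d : ℕ} {H : Subgroup (GL (Fin d) ℝ)} (B : BlockDecomposition H)

/-- The matrix of a family of blocks in the original coordinates. -/
noncomputable def assemble :
    (∀ i, Matrix (Fin (B.dim i)) (Fin (B.dim i)) ℝ) →ₗ[ℝ] Matrix (Fin d) (Fin d) ℝ where
  toFun β := B.g.val * Matrix.reindex B.e B.e (Matrix.blockDiagonal' β) * (B.g⁻¹).val
  map_add' β γ := by
    rw [Matrix.blockDiagonal'_add, Matrix.reindex_apply, Matrix.submatrix_add, Matrix.reindex_apply,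
      Matrix.reindex_apply]
    simp [mul_add, add_mul]
  map_smul' r β := by
    rw [Matrix.blockDiagonal'_smul, Matrix.reindex_apply, Matrix.submatrix_smul,
      Matrix.reindex_apply]
    simp

theorem assemble_apply (β : ∀ i, Matrix (Fin (B.dim i)) (Fin (B.dim i)) ℝ) :
    B.assemble β = B.g.val * Matrix.reindex B.e B.e (Matrix.blockDiagonal' β) * (B.g⁻¹).val := rfl

theorem assemble_mul (β γ : ∀ i, Matrix (Fin (B.dim i)) (Fin (B.dim i)) ℝ) :
    B.assemble (β * γ) = B.assemble β * B.assemble γ := by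
  rw [assemble_apply, assemble_apply, assemble_apply, Pi.mul_def, Matrix.blockDiagonal'_mul]
  have h1 : (B.g⁻¹).val * B.g.val = 1 := B.g.inv_mul
  have h2 : Matrix.reindex B.e B.e (Matrix.blockDiagonal' β * Matrix.blockDiagonal' γ) =
      Matrix.reindex B.e B.e (Matrix.blockDiagonal' β) *
        Matrix.reindex B.e B.e (Matrix.blockDiagonal' γ) := by
    simp only [Matrix.reindex_apply, Matrix.submatrix_mul_equiv]
  rw [h2]
  calc _ = B.g.val * Matrix.reindex B.e B.e (Matrix.blockDiagonal' β) * 1 *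
        Matrix.reindex B.e B.e (Matrix.blockDiagonal' γ) * (B.g⁻¹).val := by
          simp only [mul_assoc, one_mul]
    _ = _ := by rw [← h1]; simp only [mul_assoc]

theorem assemble_one : B.assemble 1 = 1 := by
  rw [assemble_apply, Matrix.blockDiagonal'_one, Matrix.reindex_apply, Matrix.submatrix_one_equiv,
    mul_one]
  exact B.g.mul_inv

theorem assemble_eq_zero {β : ∀ i, Matrix (Fin (B.dim i)) (Fin (B.dim i)) ℝ}
    (h : B.assemble β = 0) : β = 0 := by
  rw [assemble_apply, Units.mul_left_eq_zero, Units.mul_right_eq_zero] at h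
  have h1 : Matrix.blockDiagonal' β = 0 := (Matrix.reindex B.e B.e).injective (by rw [h]; rfl)
  exact Matrix.blockDiagonal'_injective (h1.trans Matrix.blockDiagonal'_zero.symm)

theorem det_assemble (β : ∀ i, Matrix (Fin (B.dim i)) (Fin (B.dim i)) ℝ) :
    (B.assemble β).det = ∏ i, (β i).det := by
  have h1 : B.g.val.det * (B.g⁻¹).val.det = 1 := by
    rw [← Matrix.det_mul, ← Units.val_mul, mul_inv_cancel, Units.val_one, Matrix.det_one]
  rw [assemble_apply, Matrix.det_mul, Matrix.det_mul, Matrix.det_reindex_self,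
    det_blockDiagonal', mul_right_comm, h1, one_mul]

theorem exists_eq_assemble {h : GL (Fin d) ℝ} (hh : h ∈ H) : ∃ b : ∀ i, (B.alg i)ˣ,
    h.val = B.assemble (fun i => (b i).1.1) ∧ (h⁻¹).val = B.assemble (fun i => (b i)⁻¹.1.1) := by
  obtain ⟨b, hb⟩ := (B.mem_iff h).1 hh
  have h1 : h.val = B.assemble (fun i => (b i).1.1) := by
    rw [assemble_apply, ← hb, ← Units.val_mul, ← Units.val_mul]
    congr 1
    group
  refine ⟨b, h1, ?_⟩
  refine Units.inv_eq_of_mul_eq_one_right ?_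
  rw [h1, ← assemble_mul, ← B.assemble_one]
  congr 1
  funext i
  exact congrArg Subtype.val (b i).mul_inv

theorem sum_dim : ∑ i, B.dim i = d := by
  have := Fintype.card_congr B.e
  simpa using this

theorem nilpotent_pow_eq_zero (i : Fin B.k) {a : B.alg i} (ha : IsNilpotent a) :
    a ^ B.maxNilpotencyClass = 0 :=
  pow_eq_zero_of_algNilpotencyClass_le _ (B.irreducible i).2.1
    (Finset.le_sup (f := fun i => algNilpotencyClass (B.alg i)) (Finset.mem_univ i)) ha

theorem k_pos (hd : 0 < d) : 0 < B.k := by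
  have h := B.sum_dim
  rcases Nat.eq_zero_or_pos B.k with h0 | h0
  · have : IsEmpty (Fin B.k) := by rw [h0]; infer_instance
    rw [Finset.univ_eq_empty, Finset.sum_empty] at h
    omega
  · exact h0

theorem maxNilpotencyClass_pos (hd : 0 < d) : 0 < B.maxNilpotencyClass := by
  have i : Fin B.k := ⟨0, B.k_pos hd⟩
  have := (B.irreducible i).1
  exact (algNilpotencyClass_pos (B.alg i) (B.irreducible i).2.1).trans_le
    (Finset.le_sup (f := fun i => algNilpotencyClass (B.alg i)) (Finset.mem_univ i))

/-- The families of blocks taken from the irreducible algebras. -/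
noncomputable def blocks :
    Submodule ℝ (∀ i, Matrix (Fin (B.dim i)) (Fin (B.dim i)) ℝ) :=
  Submodule.pi Set.univ fun i => Subalgebra.toSubmodule (B.alg i)

theorem mem_blocks {β : ∀ i, Matrix (Fin (B.dim i)) (Fin (B.dim i)) ℝ} :
    β ∈ B.blocks ↔ ∀ i, β i ∈ B.alg i := by
  simp [blocks, Submodule.mem_pi]

/-- The map `β ↦ βᵀ ξ₀` on the algebra of block matrices is injective when the dual orbit of `ξ₀` is
open. -/
theorem eq_zero_of_evalMap_assemble {ξ₀ : Euc d} (hO : IsOpen (dualOrbit H ξ₀))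
    {β : ∀ i, Matrix (Fin (B.dim i)) (Fin (B.dim i)) ℝ} (hβ : β ∈ B.blocks)
    (h0 : evalMap ξ₀ (B.assemble β) = 0) : β = 0 := by
  refine B.assemble_eq_zero (eq_zero_of_evalMap_eq_zero
    (hO.measure_pos volume ⟨ξ₀, mem_dualOrbit_self H ξ₀⟩).ne' (fun h hh => ?_) h0)
  obtain ⟨b, hb, -⟩ := B.exists_eq_assemble hh
  rw [hb, ← assemble_mul, ← assemble_mul]
  congr 1
  funext i
  exact congrArg Subtype.val ((B.irreducible i).2.1 ⟨β i, B.mem_blocks.1 hβ i⟩ (b i).1)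

theorem exists_norm_le_evalMap {ξ₀ : Euc d} (hO : IsOpen (dualOrbit H ξ₀)) :
    ∃ C : ℝ, 0 ≤ C ∧ ∀ β ∈ B.blocks, ‖β‖ ≤ C * ‖evalMap ξ₀ (B.assemble β)‖ := by
  obtain ⟨C, hC, h⟩ := exists_norm_le_of_injective
    ((evalMap ξ₀).comp (B.assemble.comp B.blocks.subtype)) (fun β hβ =>
      Subtype.ext (B.eq_zero_of_evalMap_assemble hO β.2 hβ))
  exact ⟨C, hC, fun β hβ => h ⟨β, hβ⟩⟩

/-- Removing the scalar part of one block leads out of the open orbit; hence the distance to the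
complement of the orbit is bounded by the size of each scalar part. -/
theorem infDist_le_of_isNilpotent {ξ₀ : Euc d} (hO : IsOpen (dualOrbit H ξ₀))
    {b : ∀ i, (B.alg i)ˣ} {i : Fin B.k} {c : B.alg i} (hc : IsNilpotent ((b i).1 - c)) :
    Metric.infDist (evalMap ξ₀ (B.assemble fun j => (b j).1.1)) (dualOrbit H ξ₀)ᶜ ≤
      ‖evalMap ξ₀ (B.assemble (Pi.single i c.1))‖ := by
  have hmem : evalMap ξ₀ (B.assemble ((fun j => (b j).1.1) - Pi.single i c.1)) ∈
      (dualOrbit H ξ₀)ᶜ := by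
    rintro ⟨h, hh⟩
    obtain ⟨b', hb', -⟩ := B.exists_eq_assemble h.2
    have hh' : evalMap ξ₀ h.1.val = _ := hh
    rw [hb', ← sub_eq_zero, ← map_sub, ← map_sub] at hh'
    have h1 := B.eq_zero_of_evalMap_assemble hO (B.mem_blocks.2 fun j => ?_) hh'
    · have h2 := congrFun h1 i
      rw [Pi.sub_apply, Pi.sub_apply, Pi.single_eq_same, Pi.zero_apply, sub_eq_zero] at h2
      have h3 : (b' i).1 = (b i).1 - c := Subtype.ext h2
      have := (B.irreducible i).1
      exact hc.not_isUnit (h3 ▸ (b' i).isUnit)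
    · refine sub_mem (b' j).1.2 (sub_mem (b j).1.2 ?_)
      by_cases hj : j = i
      · subst hj
        rw [Pi.single_eq_same]
        exact c.2
      · rw [Pi.single_eq_of_ne hj]
        exact zero_mem _
  refine (Metric.infDist_le_dist_of_mem hmem).trans ?_
  rw [dist_eq_norm, ← map_sub, ← map_sub, sub_sub_cancel]

/-- The common quantitative input of the decay estimates: each block `b i` of `h` has a scalar part
of size `t i`, which is bounded below by the envelope function and controls determinant and inverse
of the block. -/
theorem exists_block_bounds {ξ₀ : Euc d} (hO : IsOpen (dualOrbit H ξ₀)) :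
    ∃ C : ℝ, 1 ≤ C ∧ ∀ h ∈ H, ∃ (b : ∀ i, (B.alg i)ˣ) (t : Fin B.k → ℝ),
      h.val = B.assemble (fun i => (b i).1.1) ∧ (h⁻¹).val = B.assemble (fun i => (b i)⁻¹.1.1) ∧
      ∀ i, 0 < t i ∧ envelope (dualOrbit H ξ₀) (dualAct h ξ₀) ≤ C * t i ∧
        ‖(b i).1.1‖ ≤ C * ‖dualAct h ξ₀‖ ∧ t i ^ B.dim i ≤ C * |(b i).1.1.det| ∧
        ‖((b i)⁻¹).1.1‖ ≤ C / t i *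
          ∑ j ∈ Finset.range B.maxNilpotencyClass, (C * ‖(b i).1.1‖ / t i) ^ j := by
  choose C₁ hC₁ h₁ using fun i => (B.irreducible i).exists_scalarPart
    (n := B.maxNilpotencyClass) fun a ha => B.nilpotent_pow_eq_zero i ha
  obtain ⟨C₂, hC₂, h₂⟩ := B.exists_norm_le_evalMap hO
  obtain ⟨C₃, hC₃, h₃⟩ : ∃ C : ℝ, 0 ≤ C ∧ ∀ β, ‖evalMap ξ₀ (B.assemble β)‖ ≤ C * ‖β‖ :=
    exists_norm_le_of_finiteDimensional ((evalMap ξ₀).comp B.assemble)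
  set D : ℝ := 1 + ∑ i, C₁ i with hD
  have hsum : ∀ i, C₁ i ≤ D := fun i => by
    have := Finset.single_le_sum (f := C₁) (fun j _ => zero_le_one.trans (hC₁ j))
      (Finset.mem_univ i)
    linarith
  have hD1 : 1 ≤ D := by
    have := Finset.sum_nonneg (s := Finset.univ) fun i _ => zero_le_one.trans (hC₁ i)
    linarith
  set C : ℝ := D * (1 + C₃) + C₂ with hC
  have hCD : D ≤ C := by nlinarith
  have hCC₂ : C₂ ≤ C := by nlinarith
  have hCC₃ : C₃ * D ≤ C := by nlinarith
  refine ⟨C, hD1.trans hCD, fun h hh => ?_⟩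
  obtain ⟨b, hb, hb'⟩ := B.exists_eq_assemble hh
  choose c t ht hnil hcn hdet hinv using fun i => h₁ i (b i)
  have hξ : dualAct h ξ₀ = evalMap ξ₀ (B.assemble fun i => (b i).1.1) := by
    rw [dualAct_eq_evalMap, hb]
  refine ⟨b, t, hb, hb', fun i => ⟨ht i, ?_, ?_, ?_, ?_⟩⟩
  · refine (envelope_le_infDist _ _).trans ?_
    rw [hξ]
    refine (B.infDist_le_of_isNilpotent hO (hnil i)).trans ((h₃ _).trans ?_)
    have h4 : ‖(Pi.single i (c i).1 : ∀ j, Matrix (Fin (B.dim j)) (Fin (B.dim j)) ℝ)‖ ≤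
        C₁ i * t i := by
      rw [Pi.norm_single]
      exact hcn i
    calc C₃ * ‖(Pi.single i (c i).1 : ∀ j, Matrix (Fin (B.dim j)) (Fin (B.dim j)) ℝ)‖
        ≤ C₃ * (D * t i) := by
          refine mul_le_mul_of_nonneg_left (h4.trans ?_) hC₃
          exact mul_le_mul_of_nonneg_right (hsum i) (ht i).le
      _ = C₃ * D * t i := by ring
      _ ≤ C * t i := mul_le_mul_of_nonneg_right hCC₃ (ht i).le
  · rw [hξ]
    have h4 := h₂ (fun i => (b i).1.1) (B.mem_blocks.2 fun i => (b i).1.2)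
    refine (norm_le_pi_norm (fun i => (b i).1.1) i).trans (h4.trans ?_)
    exact mul_le_mul_of_nonneg_right hCC₂ (norm_nonneg _)
  · exact (hdet i).trans (mul_le_mul_of_nonneg_right ((hsum i).trans hCD) (abs_nonneg _))
  · have hCi : C₁ i ≤ C := (hsum i).trans hCD
    have h0 : 0 ≤ C₁ i := zero_le_one.trans (hC₁ i)
    have h0t := ht i
    refine (hinv i).trans ?_
    gcongr

/-- The exponent `2 n - 1 = 2 (n - 1) + 1` for `‖h⁻¹‖`: one factor `A` compensates the factor
`1 / t` in front of the Neumann series, and in each term `(‖b‖ / t) ^ j`, where `j ≤ n - 1`, there are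
`j` factors `A` for `‖b‖ ≲ |hᵀ ξ₀|` and `j` factors `A` for `1 / t`. -/
theorem normDecay (hd : 0 < d) {ξ₀ : Euc d} (hO : IsOpen (dualOrbit H ξ₀)) :
    NormDecay H (dualOrbit H ξ₀) ξ₀ (2 * (B.maxNilpotencyClass : ℝ) - 1) := by
  obtain ⟨C, hC1, hC⟩ := B.exists_block_bounds hO
  obtain ⟨K, hK, hP⟩ := exists_norm_le_of_finiteDimensional B.assemble
  obtain ⟨r, hr⟩ : ∃ r : ℕ, B.maxNilpotencyClass = r + 1 :=
    ⟨B.maxNilpotencyClass - 1, by have := B.maxNilpotencyClass_pos hd; omega⟩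
  have hC0 : 0 ≤ C := zero_le_one.trans hC1
  have hexp : ∀ x : ℝ, x ^ (2 * (B.maxNilpotencyClass : ℝ) - 1) = x ^ (2 * r + 1) := fun x => by
    rw [← Real.rpow_natCast, hr]
    congr 1
    push_cast
    ring
  set M : ℝ := C * C * ∑ j ∈ Finset.range B.maxNilpotencyClass, (C * C * C) ^ j with hM
  refine ⟨K * max C M, fun h => ?_⟩
  obtain ⟨b, t, hb, hb', hbt⟩ := hC h.1 h.2
  simp only [hexp]
  set α := envelope (dualOrbit H ξ₀) (dualAct h.1 ξ₀) with hα
  have hα0 : 0 ≤ α := envelope_nonneg _ _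
  have hα1 : α ≤ 1 := envelope_le_one _ _
  have hαξ : α * ‖dualAct h.1 ξ₀‖ ≤ 1 := envelope_mul_norm_le _ _
  have hαb : ∀ i, α * ‖(b i).1.1‖ ≤ C := fun i => by
    calc α * ‖(b i).1.1‖ ≤ α * (C * ‖dualAct h.1 ξ₀‖) :=
          mul_le_mul_of_nonneg_left (hbt i).2.2.1 hα0
      _ = C * (α * ‖dualAct h.1 ξ₀‖) := by ring
      _ ≤ C := by nlinarith
  have hαt : ∀ i, α / t i ≤ C := fun i => by
    rw [div_le_iff₀ (hbt i).1]
    exact (hbt i).2.1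
  have key : ∀ (β : ∀ i, Matrix (Fin (B.dim i)) (Fin (B.dim i)) ℝ),
      (∀ i, ‖β i‖ * α ^ (2 * r + 1) ≤ max C M) →
        ‖B.assemble β‖ * α ^ (2 * r + 1) ≤ K * max C M := by
    intro β hβ
    have hmax : 0 ≤ max C M := hC0.trans (le_max_left _ _)
    calc ‖B.assemble β‖ * α ^ (2 * r + 1) ≤ K * ‖β‖ * α ^ (2 * r + 1) :=
          mul_le_mul_of_nonneg_right (hP β) (by positivity)
      _ = K * ‖α ^ (2 * r + 1) • β‖ := by
          rw [norm_smul, Real.norm_of_nonneg (by positivity)]; ring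
      _ ≤ K * max C M := by
          refine mul_le_mul_of_nonneg_left ((pi_norm_le_iff_of_nonneg hmax).2 fun i => ?_) hK
          rw [Pi.smul_apply, norm_smul, Real.norm_of_nonneg (by positivity), mul_comm]
          exact hβ i
  constructor
  · rw [show opNorm h.1 = ‖B.assemble (fun i => (b i).1.1)‖ by rw [← hb]; rfl]
    refine key _ fun i => le_max_of_le_left ?_
    calc ‖(b i).1.1‖ * α ^ (2 * r + 1) = α * ‖(b i).1.1‖ * α ^ (2 * r) := by ring
      _ ≤ C * 1 := mul_le_mul (hαb i) (pow_le_one₀ hα0 hα1) (by positivity) hC0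
      _ = C := mul_one C
  · rw [show opNorm (h.1)⁻¹ = ‖B.assemble (fun i => (b i)⁻¹.1.1)‖ by rw [← hb']; rfl]
    refine key _ fun i => le_max_of_le_right ?_
    have hti := (hbt i).1
    calc ‖((b i)⁻¹).1.1‖ * α ^ (2 * r + 1)
        ≤ C / t i * (∑ j ∈ Finset.range B.maxNilpotencyClass, (C * ‖(b i).1.1‖ / t i) ^ j) *
            α ^ (2 * r + 1) :=
          mul_le_mul_of_nonneg_right (hbt i).2.2.2.2 (by positivity)
      _ = C * (α / t i) * ∑ j ∈ Finset.range B.maxNilpotencyClass,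
            (C * ‖(b i).1.1‖ / t i) ^ j * α ^ (2 * r) := by
          rw [← Finset.sum_mul]; ring
      _ ≤ C * C * ∑ j ∈ Finset.range B.maxNilpotencyClass, (C * C * C) ^ j := by
          refine mul_le_mul (mul_le_mul_of_nonneg_left (hαt i) hC0)
            (Finset.sum_le_sum fun j hj => ?_)
            (Finset.sum_nonneg fun j _ => by positivity) (by positivity)
          have hjr : 2 * j ≤ 2 * r := by
            have := Finset.mem_range.1 hj
            omega
          calc (C * ‖(b i).1.1‖ / t i) ^ j * α ^ (2 * r)
              ≤ (C * ‖(b i).1.1‖ / t i) ^ j * α ^ (2 * j) :=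
                mul_le_mul_of_nonneg_left (pow_le_pow_of_le_one hα0 hα1 hjr) (by positivity)
            _ = (C * (α * ‖(b i).1.1‖) * (α / t i)) ^ j := by
                rw [pow_mul, ← mul_pow]; congr 1; ring
            _ ≤ (C * C * C) ^ j := by
                refine pow_le_pow_left₀ (by positivity) ?_ j
                exact mul_le_mul (mul_le_mul_of_nonneg_left (hαb i) hC0) (hαt i) (by positivity)
                  (by positivity)

/-- The determinant is the product of the determinants of the blocks, and the block of size `d_i`
takes `d_i` factors `A` in either direction. -/
theorem detDecay (B : BlockDecomposition H) {ξ₀ : Euc d} (hO : IsOpen (dualOrbit H ξ₀)) :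
    DetDecay H (dualOrbit H ξ₀) ξ₀ (d : ℝ) := by
  obtain ⟨C, hC1, hC⟩ := B.exists_block_bounds hO
  have hC0 : 0 ≤ C := zero_le_one.trans hC1
  refine ⟨max (∏ i, ((B.dim i).factorial * C ^ B.dim i)) (∏ i, C ^ (B.dim i + 1)), fun h => ?_⟩
  obtain ⟨b, t, hb, hb', hbt⟩ := hC h.1 h.2
  simp only [Real.rpow_natCast]
  set α := envelope (dualOrbit H ξ₀) (dualAct h.1 ξ₀) with hα
  have hα0 : 0 ≤ α := envelope_nonneg _ _
  have hαξ : α * ‖dualAct h.1 ξ₀‖ ≤ 1 := envelope_mul_norm_le _ _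
  have hαd : α ^ d = ∏ i, α ^ B.dim i := by
    rw [Finset.prod_pow_eq_pow_sum, B.sum_dim]
  have hdet : absDet h.1 = ∏ i, |(b i).1.1.det| := by
    rw [absDet, hb, det_assemble, Finset.abs_prod]
  have hdpos : ∀ i, 0 < |(b i).1.1.det| := fun i => by
    by_contra hneg
    have h0 : |(b i).1.1.det| = 0 := le_antisymm (not_lt.1 hneg) (abs_nonneg _)
    have h1 := (hbt i).2.2.2.1
    rw [h0, mul_zero] at h1
    exact absurd (pow_pos (hbt i).1 _) (not_lt.2 h1)
  constructor
  · refine le_max_of_le_left ?_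
    rw [hdet, hαd, ← Finset.prod_mul_distrib]
    refine Finset.prod_le_prod (fun i _ => by positivity) fun i _ => ?_
    calc |(b i).1.1.det| * α ^ B.dim i
        ≤ (B.dim i).factorial * ‖(b i).1.1‖ ^ B.dim i * α ^ B.dim i :=
          mul_le_mul_of_nonneg_right (abs_det_le _) (by positivity)
      _ = (B.dim i).factorial * (α * ‖(b i).1.1‖) ^ B.dim i := by rw [mul_pow]; ring
      _ ≤ (B.dim i).factorial * C ^ B.dim i := by
          refine mul_le_mul_of_nonneg_left (pow_le_pow_left₀ (by positivity) ?_ _) (by positivity)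
          calc α * ‖(b i).1.1‖ ≤ α * (C * ‖dualAct h.1 ξ₀‖) :=
                mul_le_mul_of_nonneg_left (hbt i).2.2.1 hα0
            _ = C * (α * ‖dualAct h.1 ξ₀‖) := by ring
            _ ≤ C := by nlinarith
  · refine le_max_of_le_right ?_
    rw [absDet_inv, hdet, hαd, ← Finset.prod_inv_distrib, ← Finset.prod_mul_distrib]
    refine Finset.prod_le_prod (fun i _ => by positivity) fun i _ => ?_
    rw [inv_mul_le_iff₀ (hdpos i)]
    calc α ^ B.dim i ≤ (C * t i) ^ B.dim i := pow_le_pow_left₀ hα0 (hbt i).2.1 _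
      _ = C ^ B.dim i * t i ^ B.dim i := mul_pow _ _ _
      _ ≤ C ^ B.dim i * (C * |(b i).1.1.det|) :=
          mul_le_mul_of_nonneg_left (hbt i).2.2.2.1 (by positivity)
      _ = |(b i).1.1.det| * C ^ (B.dim i + 1) := by ring

end BlockDecomposition

/-! ### The Haar measure of `H` in orbit coordinates -/

section HaarMeasure

variable {d : ℕ}

theorem modularFn_eq_one {H : Subgroup (GL (Fin d) ℝ)} (hcomm : ∀ a ∈ H, ∀ b ∈ H, a * b = b * a)
    [MeasurableSpace H] [BorelSpace H] (μ : Measure H) [μ.IsHaarMeasure] (h : H) :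
    modularFn H μ h = 1 := by
  have h1 : Measure.map (· * h⁻¹) μ = μ := by
    have h2 : (fun x : H => x * h⁻¹) = fun x => h⁻¹ * x :=
      funext fun x => Subtype.ext (hcomm _ x.2 _ (h⁻¹).2)
    rw [h2]
    exact map_mul_left_eq_self μ h⁻¹
  have h3 : Measure.haarScalarFactor (Measure.map (· * h⁻¹) μ) μ =
      Measure.haarScalarFactor μ μ := by
    congr 1
  rw [modularFn, h3, Measure.haarScalarFactor_self, NNReal.coe_one]

/-- An abelian group is unimodular, so no power of the envelope is needed. -/
theorem modularDecay {H : Subgroup (GL (Fin d) ℝ)} (hcomm : ∀ a ∈ H, ∀ b ∈ H, a * b = b * a)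
    [MeasurableSpace H] [BorelSpace H] (μ : Measure H) [μ.IsHaarMeasure] (O : Set (Euc d))
    (ξ₀ : Euc d) : ModularDecay H μ O ξ₀ 0 :=
  ⟨1, fun h => by simp [modularFn_eq_one hcomm μ]⟩

theorem isEmbedding_units_val :
    IsEmbedding (Units.val : GL (Fin d) ℝ → Matrix (Fin d) (Fin d) ℝ) := by
  -- any Banach algebra norm inducing the topology of matrices will do
  open scoped Matrix.Norms.L2Operator in
  exact (Units.isOpenEmbedding_val (R := Matrix (Fin d) (Fin d) ℝ)).toIsEmbedding

/-- The orbit map `h ↦ hᵀ ξ₀` is a topological embedding, because matrices in the algebra `S` depend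
linearly on their value at `ξ₀`. -/
theorem isEmbedding_orbitMap {H : Subgroup (GL (Fin d) ℝ)}
    {S : Subalgebra ℝ (Matrix (Fin d) (Fin d) ℝ)} {ξ₀ : Euc d}
    (hS : ∀ h : GL (Fin d) ℝ, h ∈ H ↔ h.val ∈ S)
    (hbij : Function.Bijective (fun a : S => evalMap ξ₀ a.1)) :
    IsEmbedding fun h : H => dualAct h.1 ξ₀ := by
  let e : S ≃ₗ[ℝ] Euc d :=
    LinearEquiv.ofBijective ((evalMap ξ₀).comp (Subalgebra.toSubmodule S).subtype) hbij
  let f : Euc d →ₗ[ℝ] Matrix (Fin d) (Fin d) ℝ :=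
    (Subalgebra.toSubmodule S).subtype.comp e.symm.toLinearMap
  have hf : Continuous f := f.continuous_of_finiteDimensional
  have h1 : (f ∘ fun h : H => dualAct h.1 ξ₀) = fun h : H => h.1.val := by
    funext h
    exact congrArg Subtype.val (e.symm_apply_apply ⟨h.1.val, (hS _).1 h.2⟩)
  refine IsEmbedding.of_comp (continuous_dualAct_left H ξ₀) hf ?_
  rw [h1]
  exact isEmbedding_units_val.comp IsEmbedding.subtypeVal

/-- Lebesgue measure on the open orbit, transported to `H`. -/
noncomputable def orbitVolume (H : Subgroup (GL (Fin d) ℝ)) [MeasurableSpace H] (ξ₀ : Euc d) :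
    Measure H :=
  Measure.comap (fun h : H => dualAct h.1 ξ₀) volume

theorem map_mul_left_orbitVolume {H : Subgroup (GL (Fin d) ℝ)}
    (hcomm : ∀ a ∈ H, ∀ b ∈ H, a * b = b * a) [MeasurableSpace H] [BorelSpace H] {ξ₀ : Euc d}
    (hp : MeasurableEmbedding fun h : H => dualAct h.1 ξ₀) (k : H) :
    Measure.map (k * ·) (orbitVolume H ξ₀) =
      ENNReal.ofReal (absDet k.1)⁻¹ • orbitVolume H ξ₀ := by
  ext E hE
  have hmk : Measurable fun h : H => k * h := (continuous_const.mul continuous_id).measurable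
  rw [Measure.map_apply hmk hE, Measure.smul_apply, orbitVolume, hp.comap_apply, hp.comap_apply,
    smul_eq_mul, ← smul_eq_mul, ← Measure.smul_apply, ← map_dualAct_volume,
    Measure.map_apply (quasiMeasurePreserving_dualAct k.1).measurable
      (hp.measurableSet_image' hE)]
  congr 1
  have hk : ∀ h : H, dualAct (k * h).1 ξ₀ = dualAct k.1 (dualAct h.1 ξ₀) := fun h => by
    rw [Subgroup.coe_mul, hcomm _ k.2 _ h.2, dualAct_mul]
  ext v
  constructor
  · rintro ⟨h, hh, rfl⟩
    exact ⟨k * h, hh, hk h⟩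
  · rintro ⟨h, hh, hv⟩
    refine ⟨k⁻¹ * h, ?_, ?_⟩
    · rw [Set.mem_preimage, mul_inv_cancel_left]
      exact hh
    · refine (dualEquiv k.1).injective ?_
      rw [dualEquiv_apply, dualEquiv_apply]
      have h1 := hk (k⁻¹ * h)
      rw [mul_inv_cancel_left] at h1
      exact h1.symm.trans hv

/-- The Haar measure of `H` in orbit coordinates: `|det h|⁻¹ dξ` for `ξ = hᵀ ξ₀`. -/
noncomputable def orbitHaar (H : Subgroup (GL (Fin d) ℝ)) [MeasurableSpace H] (ξ₀ : Euc d) :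
    Measure H :=
  (orbitVolume H ξ₀).withDensity fun h => ENNReal.ofReal (absDet h.1)⁻¹

theorem isMulLeftInvariant_orbitHaar {H : Subgroup (GL (Fin d) ℝ)}
    (hcomm : ∀ a ∈ H, ∀ b ∈ H, a * b = b * a) [MeasurableSpace H] [BorelSpace H] {ξ₀ : Euc d}
    (hp : MeasurableEmbedding fun h : H => dualAct h.1 ξ₀) :
    (orbitHaar H ξ₀).IsMulLeftInvariant := by
  refine ⟨fun k => ?_⟩
  have hmk : Measurable fun h : H => k * h := (continuous_const.mul continuous_id).measurable
  have hdm := measurable_ofReal_inv_absDet H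
  ext E hE
  have hone : ENNReal.ofReal (absDet k.1) * ENNReal.ofReal (absDet k.1)⁻¹ = 1 := by
    rw [← ENNReal.ofReal_mul (absDet_pos _).le, mul_inv_cancel₀ (absDet_pos _).ne',
      ENNReal.ofReal_one]
  have hmul : ∀ h : H, ENNReal.ofReal (absDet h.1)⁻¹ =
      ENNReal.ofReal (absDet k.1) * ENNReal.ofReal (absDet (k * h).1)⁻¹ := fun h => by
    rw [← ENNReal.ofReal_mul (absDet_pos _).le, Subgroup.coe_mul, absDet_mul, mul_inv,
      mul_inv_cancel_left₀ (absDet_pos _).ne']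
  rw [Measure.map_apply hmk hE, orbitHaar, withDensity_apply _ (hmk hE), withDensity_apply _ hE,
    ← lintegral_indicator (hmk hE), ← lintegral_indicator hE]
  calc ∫⁻ h, ((fun h => k * h) ⁻¹' E).indicator (fun h : H => ENNReal.ofReal (absDet h.1)⁻¹) h
        ∂(orbitVolume H ξ₀)
      = ∫⁻ h, ENNReal.ofReal (absDet k.1) *
          E.indicator (fun h : H => ENNReal.ofReal (absDet h.1)⁻¹) (k * h) ∂(orbitVolume H ξ₀) := by
        refine lintegral_congr fun h => ?_
        by_cases hh : k * h ∈ E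
        · rw [Set.indicator_of_mem hh, Set.indicator_of_mem (show h ∈ (k * ·) ⁻¹' E from hh), hmul]
        · rw [Set.indicator_of_notMem hh,
            Set.indicator_of_notMem (show h ∉ (k * ·) ⁻¹' E from hh), mul_zero]
    _ = ENNReal.ofReal (absDet k.1) *
          ∫⁻ h, E.indicator (fun h : H => ENNReal.ofReal (absDet h.1)⁻¹) h
            ∂(Measure.map (k * ·) (orbitVolume H ξ₀)) := by
        rw [lintegral_const_mul' _ _ ENNReal.ofReal_ne_top,
          lintegral_map (hdm.indicator hE) hmk]
    _ = _ := by
        rw [map_mul_left_orbitVolume hcomm hp, lintegral_smul_measure, smul_eq_mul, ← mul_assoc,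
          hone, one_mul]

theorem isFiniteMeasureOnCompacts_orbitHaar {H : Subgroup (GL (Fin d) ℝ)} [MeasurableSpace H]
    [BorelSpace H] {ξ₀ : Euc d} (hp : MeasurableEmbedding fun h : H => dualAct h.1 ξ₀) :
    IsFiniteMeasureOnCompacts (orbitHaar H ξ₀) := by
  refine ⟨fun K hK => ?_⟩
  have hcont : Continuous fun h : H => (absDet h.1)⁻¹ :=
    (continuous_absDet.comp continuous_subtype_val).inv₀ fun h => (absDet_pos h.1).ne'
  obtain ⟨M, hM⟩ := (hK.image hcont).bddAbove
  rw [orbitHaar, withDensity_apply _ hK.measurableSet]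
  have h1 : orbitVolume H ξ₀ K < ∞ := by
    rw [orbitVolume, hp.comap_apply]
    exact (hK.image (continuous_dualAct_left H ξ₀)).measure_lt_top
  refine lt_of_le_of_lt (setLIntegral_mono' (g := fun _ => ENNReal.ofReal M) hK.measurableSet
    fun h hh => ENNReal.ofReal_le_ofReal (hM ⟨h, hh, rfl⟩)) ?_
  rw [setLIntegral_const]
  exact ENNReal.mul_lt_top ENNReal.ofReal_lt_top h1

/-- Integrability on `H` can be tested in orbit coordinates. -/
theorem lintegral_lt_top_of_orbit {H : Subgroup (GL (Fin d) ℝ)}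
    (hclosed : IsClosed (H : Set (GL (Fin d) ℝ))) (hcomm : ∀ a ∈ H, ∀ b ∈ H, a * b = b * a)
    [MeasurableSpace H] [BorelSpace H] (μ : Measure H) [μ.IsHaarMeasure] {ξ₀ : Euc d}
    (hO : IsOpen (dualOrbit H ξ₀)) (hemb : IsEmbedding fun h : H => dualAct h.1 ξ₀)
    {F : H → ℝ≥0∞} {G : Euc d → ℝ≥0∞}
    (hFG : ∀ h : H, ENNReal.ofReal (absDet h.1)⁻¹ * F h ≤ G (dualAct h.1 ξ₀))
    (hG : ∫⁻ ξ, G ξ < ∞) : ∫⁻ h, F h ∂μ < ∞ := by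
  have := locallyCompactSpace_closedSubgroup hclosed
  have := secondCountableTopology_subgroup H
  have hp : MeasurableEmbedding fun h : H => dualAct h.1 ξ₀ :=
    hemb.measurableEmbedding hO.measurableSet
  have := isMulLeftInvariant_orbitHaar hcomm hp
  have := isFiniteMeasureOnCompacts_orbitHaar hp
  have huniq := Measure.isMulLeftInvariant_eq_smul (orbitHaar H ξ₀) μ
  set c := (orbitHaar H ξ₀).haarScalarFactor μ with hc
  have hdm := measurable_ofReal_inv_absDet H
  have hvol : orbitVolume H ξ₀ ≠ 0 := by
    intro h0
    have h1 : orbitVolume H ξ₀ Set.univ = 0 := by rw [h0]; simp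
    rw [orbitVolume, hp.comap_apply, Set.image_univ] at h1
    exact (hO.measure_pos volume ⟨ξ₀, mem_dualOrbit_self H ξ₀⟩).ne' h1
  have hc0 : c ≠ 0 := by
    intro h0
    rw [h0, zero_smul, orbitHaar, withDensity_eq_zero_iff hdm.aemeasurable] at huniq
    refine hvol (ae_eq_bot.1 (Filter.eventually_false_iff_eq_bot.1 ?_))
    filter_upwards [huniq] with h hh
    rw [Pi.zero_apply, ENNReal.ofReal_eq_zero] at hh
    exact absurd (inv_pos.2 (absDet_pos h.1)) (not_lt.2 hh)
  have h1 : ∫⁻ h, F h ∂(orbitHaar H ξ₀) < ∞ := by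
    rw [orbitHaar, lintegral_withDensity_eq_lintegral_mul_non_measurable _ hdm
      (Filter.Eventually.of_forall fun _ => ENNReal.ofReal_lt_top)]
    calc _ ≤ ∫⁻ h : H, G (dualAct h.1 ξ₀) ∂(orbitVolume H ξ₀) := lintegral_mono hFG
      _ = ∫⁻ ξ, G ξ ∂(Measure.map (fun h : H => dualAct h.1 ξ₀) (orbitVolume H ξ₀)) :=
          (hp.lintegral_map G).symm
      _ ≤ ∫⁻ ξ, G ξ := by
          rw [orbitVolume, hp.map_comap]
          exact setLIntegral_le_lintegral _ _
      _ < ∞ := hG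
  rw [huniq, lintegral_smul_measure] at h1
  by_contra htop
  rw [not_lt, top_le_iff] at htop
  rw [htop, ENNReal.smul_def, smul_eq_mul, ENNReal.mul_top (ENNReal.coe_ne_zero.2 hc0)] at h1
  exact lt_irrefl _ h1

end HaarMeasure

/-! ### Integrability of negative powers of the growth function -/

section Growth

variable {d : ℕ}

/-- The growth function `(1 + ‖h‖) (1 + ‖h⁻¹‖)`. -/
noncomputable def growth (h : GL (Fin d) ℝ) : ℝ := (1 + opNorm h) * (1 + opNorm h⁻¹)

theorem one_add_opNorm_le_growth (h : GL (Fin d) ℝ) : 1 + opNorm h ≤ growth h := by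
  have h1 := opNorm_nonneg h
  have h2 := opNorm_nonneg h⁻¹
  rw [growth]
  nlinarith

theorem one_le_growth (h : GL (Fin d) ℝ) : 1 ≤ growth h := by
  linarith [one_add_opNorm_le_growth h, opNorm_nonneg h]

theorem growth_pos (h : GL (Fin d) ℝ) : 0 < growth h := zero_lt_one.trans_le (one_le_growth h)

theorem growth_inv (h : GL (Fin d) ℝ) : growth h⁻¹ = growth h := by
  rw [growth, growth, inv_inv, mul_comm]

theorem growth_mul_le (h k : GL (Fin d) ℝ) : growth (h * k) ≤ growth h * growth k := by
  have key : ∀ a b : GL (Fin d) ℝ, 1 + opNorm (a * b) ≤ (1 + opNorm a) * (1 + opNorm b) :=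
    fun a b => by nlinarith [opNorm_mul_le a b, opNorm_nonneg a, opNorm_nonneg b]
  calc growth (h * k) = (1 + opNorm (h * k)) * (1 + opNorm (k⁻¹ * h⁻¹)) := by
        rw [growth, mul_inv_rev]
    _ ≤ ((1 + opNorm h) * (1 + opNorm k)) * ((1 + opNorm k⁻¹) * (1 + opNorm h⁻¹)) :=
        mul_le_mul (key _ _) (key _ _) (by linarith [opNorm_nonneg (k⁻¹ * h⁻¹)])
          (mul_nonneg (by linarith [opNorm_nonneg h]) (by linarith [opNorm_nonneg k]))
    _ = growth h * growth k := by rw [growth, growth]; ring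

theorem continuous_growth : Continuous fun h : GL (Fin d) ℝ => growth h :=
  (continuous_const.add continuous_opNorm).mul
    (continuous_const.add (continuous_opNorm.comp continuous_inv))

theorem absDet_le_growth (h : GL (Fin d) ℝ) : absDet h ≤ d.factorial * growth h ^ d := by
  refine (abs_det_le h.val).trans (mul_le_mul_of_nonneg_left ?_ (by positivity))
  refine pow_le_pow_left₀ (opNorm_nonneg h) ?_ d
  linarith [one_add_opNorm_le_growth h]

theorem inv_absDet_le_growth (h : GL (Fin d) ℝ) :
    (absDet h)⁻¹ ≤ d.factorial * growth h ^ d := by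
  rw [← absDet_inv, ← growth_inv]
  exact absDet_le_growth h⁻¹

theorem exists_absDet_rpow_le (d : ℕ) (x : ℝ) :
    ∃ (k : ℕ) (C : ℝ), 0 ≤ C ∧ ∀ h : GL (Fin d) ℝ, absDet h ^ x ≤ C * growth h ^ k := by
  refine ⟨d * ⌈|x|⌉₊, (d.factorial : ℝ) ^ ⌈|x|⌉₊, by positivity, fun h => ?_⟩
  have ha := absDet_pos h
  have hM : 1 ≤ (d.factorial : ℝ) * growth h ^ d :=
    one_le_mul_of_one_le_of_one_le (by exact_mod_cast d.factorial_pos)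
      (one_le_pow₀ (one_le_growth h))
  have h1 : absDet h ^ x ≤ ((d.factorial : ℝ) * growth h ^ d) ^ |x| := by
    rcases le_total 0 x with hx | hx
    · rw [abs_of_nonneg hx]
      exact Real.rpow_le_rpow ha.le (absDet_le_growth h) hx
    · rw [abs_of_nonpos hx, ← neg_neg x, Real.rpow_neg ha.le, ← Real.inv_rpow ha.le, neg_neg]
      exact Real.rpow_le_rpow (inv_pos.2 ha).le (inv_absDet_le_growth h) (neg_nonneg.2 hx)
  calc absDet h ^ x ≤ ((d.factorial : ℝ) * growth h ^ d) ^ ((⌈|x|⌉₊ : ℕ) : ℝ) :=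
        h1.trans (Real.rpow_le_rpow_of_exponent_le hM (Nat.le_ceil _))
    _ = _ := by rw [Real.rpow_natCast, mul_pow, ← pow_mul]

/-- Powers of `|det h|` and `1 + ‖h‖` and polynomially bounded weights are dominated by a power of
the growth function. -/
theorem PolynomiallyBounded.exists_le_growth {H : Subgroup (GL (Fin d) ℝ)} {w : H → ℝ}
    (hpos : ∀ h, 0 < w h) (hw : PolynomiallyBounded H w) (x y : ℝ) :
    ∃ (k : ℕ) (C : ℝ), 0 ≤ C ∧
      ∀ h : H, absDet h.1 ^ x * (1 + opNorm h.1) ^ y * w h ≤ C * growth h.1 ^ k := by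
  obtain ⟨k₁, C₁, hC₁, h₁⟩ := exists_absDet_rpow_le d x
  obtain ⟨k₂, C₂, h₂⟩ := hw
  refine ⟨k₁ + ⌈y⌉₊ + k₂, C₁ * |C₂|, by positivity, fun h => ?_⟩
  have hN := growth_pos h.1
  have hop := opNorm_nonneg h.1
  have h3 : (1 + opNorm h.1) ^ y ≤ growth h.1 ^ ⌈y⌉₊ := by
    rw [← Real.rpow_natCast]
    refine (Real.rpow_le_rpow_of_exponent_le (by linarith) (Nat.le_ceil y)).trans ?_
    exact Real.rpow_le_rpow (by linarith) (one_add_opNorm_le_growth h.1) (Nat.cast_nonneg _)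
  have h4 : w h ≤ |C₂| * growth h.1 ^ k₂ := by
    refine (h₂ h).trans ?_
    rw [← mul_pow]
    exact mul_le_mul_of_nonneg_right (le_abs_self _) (pow_nonneg hN.le _)
  calc absDet h.1 ^ x * (1 + opNorm h.1) ^ y * w h
      ≤ (C₁ * growth h.1 ^ k₁) * growth h.1 ^ ⌈y⌉₊ * (|C₂| * growth h.1 ^ k₂) :=
        mul_le_mul (mul_le_mul (h₁ h.1) h3 (Real.rpow_nonneg (by linarith) _) (by positivity)) h4
          (hpos h).le (by positivity)
    _ = C₁ * |C₂| * growth h.1 ^ (k₁ + ⌈y⌉₊ + k₂) := by rw [pow_add, pow_add]; ring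

theorem lintegral_one_add_norm_lt_top (d : ℕ) :
    ∫⁻ ξ : Euc d, ENNReal.ofReal (((1 + ‖ξ‖) ^ (d + 1))⁻¹) < ∞ := by
  have h1 := finite_integral_one_add_norm (E := Euc d) (μ := volume) (r := ((d + 1 : ℕ) : ℝ))
    (by simp)
  refine lt_of_le_of_lt (le_of_eq (lintegral_congr fun ξ => ?_)) h1
  rw [Real.rpow_neg (by positivity), Real.rpow_natCast]

/-- The exponent `2 d + 1` is large enough because in orbit coordinates the Haar measure is
`|det h|⁻¹ dξ`, and `|det h|⁻¹` and `1 + |hᵀ ξ₀|` are at most of order `d` and `1` in the growth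
function. -/
theorem lintegral_inv_growth_pow_lt_top {H : Subgroup (GL (Fin d) ℝ)}
    (hclosed : IsClosed (H : Set (GL (Fin d) ℝ))) (hcomm : ∀ a ∈ H, ∀ b ∈ H, a * b = b * a)
    [MeasurableSpace H] [BorelSpace H] (μ : Measure H) [μ.IsHaarMeasure] {ξ₀ : Euc d}
    (hO : IsOpen (dualOrbit H ξ₀)) (hemb : IsEmbedding fun h : H => dualAct h.1 ξ₀) :
    ∫⁻ h : H, ENNReal.ofReal ((growth h.1 ^ (2 * d + 1))⁻¹) ∂μ < ∞ := by
  set c : ℝ := d.factorial * (1 + ‖ξ₀‖) ^ (d + 1) with hc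
  have hc0 : 0 ≤ c := by positivity
  refine lintegral_lt_top_of_orbit hclosed hcomm μ hO hemb
    (G := fun ξ => ENNReal.ofReal c * ENNReal.ofReal (((1 + ‖ξ‖) ^ (d + 1))⁻¹)) (fun h => ?_) ?_
  · rw [← ENNReal.ofReal_mul (inv_pos.2 (absDet_pos _)).le, ← ENNReal.ofReal_mul hc0]
    refine ENNReal.ofReal_le_ofReal ?_
    have hN := growth_pos h.1
    have h1 : 1 + ‖dualAct h.1 ξ₀‖ ≤ growth h.1 * (1 + ‖ξ₀‖) := by
      have h2 := norm_dualAct_le h.1 ξ₀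
      have h3 := one_add_opNorm_le_growth h.1
      nlinarith [norm_nonneg ξ₀, opNorm_nonneg h.1]
    rw [← div_eq_mul_inv, ← div_eq_mul_inv, div_le_div_iff₀ (by positivity) (by positivity)]
    calc (absDet h.1)⁻¹ * (1 + ‖dualAct h.1 ξ₀‖) ^ (d + 1)
        ≤ (d.factorial * growth h.1 ^ d) * (growth h.1 * (1 + ‖ξ₀‖)) ^ (d + 1) :=
          mul_le_mul (inv_absDet_le_growth _) (pow_le_pow_left₀ (by positivity) h1 _)
            (by positivity) (by positivity)
      _ = c * growth h.1 ^ (2 * d + 1) := by rw [hc, mul_pow]; ring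
  · rw [lintegral_const_mul' _ _ ENNReal.ofReal_ne_top]
    exact ENNReal.mul_lt_top ENNReal.ofReal_lt_top (lintegral_one_add_norm_lt_top d)

/-- The bound is integrable and at most `1`, so its `q`-th power is integrable as well. -/
theorem memLp_of_norm_le_inv_growth {H : Subgroup (GL (Fin d) ℝ)} [MeasurableSpace H] [BorelSpace H]
    {μ : Measure H} (hint : ∫⁻ h : H, ENNReal.ofReal ((growth h.1 ^ (2 * d + 1))⁻¹) ∂μ < ∞)
    {f : H → ℝ} (hf : Continuous f) {C : ℝ} (hC : 0 ≤ C)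
    (hle : ∀ h, ‖f h‖ ≤ C * (growth h.1 ^ (2 * d + 1))⁻¹) {q : ℝ} (hq : 1 ≤ q) :
    MemLp f (ENNReal.ofReal q) μ := by
  have := secondCountableTopology_subgroup H
  have hq0 : 0 < q := zero_lt_one.trans_le hq
  refine ⟨hf.aestronglyMeasurable, ?_⟩
  rw [eLpNorm_lt_top_iff_lintegral_rpow_enorm_lt_top (ENNReal.ofReal_pos.2 hq0).ne'
    ENNReal.ofReal_ne_top, ENNReal.toReal_ofReal hq0.le]
  calc ∫⁻ h, ‖f h‖ₑ ^ q ∂μ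
      ≤ ∫⁻ h : H, ENNReal.ofReal (C ^ q) * ENNReal.ofReal ((growth h.1 ^ (2 * d + 1))⁻¹) ∂μ := by
        refine lintegral_mono fun h => ?_
        rw [← ENNReal.ofReal_mul (Real.rpow_nonneg hC q), ← ofReal_norm,
          ENNReal.ofReal_rpow_of_nonneg (norm_nonneg _) hq0.le]
        have hN : 0 < growth h.1 ^ (2 * d + 1) := pow_pos (growth_pos h.1) _
        have hN1 : (growth h.1 ^ (2 * d + 1))⁻¹ ≤ 1 :=
          inv_le_one_of_one_le₀ (one_le_pow₀ (one_le_growth _))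
        refine ENNReal.ofReal_le_ofReal
          ((Real.rpow_le_rpow (norm_nonneg _) (hle h) hq0.le).trans ?_)
        rw [Real.mul_rpow hC (inv_pos.2 hN).le]
        exact mul_le_mul_of_nonneg_left (Real.rpow_le_self_of_le_one (inv_pos.2 hN).le hN1 hq)
          (Real.rpow_nonneg hC q)
    _ < ∞ := by
        rw [lintegral_const_mul' _ _ ENNReal.ofReal_ne_top]
        exact ENNReal.mul_lt_top ENNReal.ofReal_lt_top hint

theorem NormDecay.exists_growth_le {H : Subgroup (GL (Fin d) ℝ)} {O : Set (Euc d)} {ξ₀ : Euc d}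
    {m : ℕ} (hdec : NormDecay H O ξ₀ (m : ℝ)) : ∃ C : ℝ, 0 ≤ C ∧ ∀ h : H,
      growth h.1 * envelope O (dualAct h.1 ξ₀) ^ (2 * m) ≤ C := by
  obtain ⟨C, hC⟩ := hdec
  simp only [Real.rpow_natCast] at hC
  refine ⟨(1 + C) * (1 + C), mul_self_nonneg _, fun h => ?_⟩
  set α := envelope O (dualAct h.1 ξ₀)
  have hα0 : 0 ≤ α := envelope_nonneg _ _
  have hα1 : α ^ m ≤ 1 := pow_le_one₀ hα0 (envelope_le_one _ _)
  have hp := opNorm_nonneg h.1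
  have hp' := opNorm_nonneg (h.1)⁻¹
  obtain ⟨h1, h2⟩ := hC h
  calc growth h.1 * α ^ (2 * m)
      = ((1 + opNorm h.1) * α ^ m) * ((1 + opNorm (h.1)⁻¹) * α ^ m) := by rw [growth]; ring
    _ ≤ (1 + C) * (1 + C) := by
        have h3 : 0 ≤ α ^ m := pow_nonneg hα0 _
        refine mul_le_mul (by linarith) (by linarith) (by positivity) ?_
        nlinarith

end Growth

/-! ### Decay of the function `Φ_ℓ` -/

section AuxPhi

variable {d : ℕ} {H : Subgroup (GL (Fin d) ℝ)}

theorem ofReal_envelope_pow_le (O : Set (Euc d)) {l : ℕ} (hl : d + 1 ≤ l) (ξ η : Euc d) :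
    ENNReal.ofReal (envelope O ξ ^ l * envelope O η ^ l) ≤
      ENNReal.ofReal (((1 + ‖ξ‖) ^ (d + 1))⁻¹) := by
  refine ENNReal.ofReal_le_ofReal ?_
  calc envelope O ξ ^ l * envelope O η ^ l ≤ envelope O ξ ^ (d + 1) * 1 :=
        mul_le_mul (pow_le_pow_of_le_one (envelope_nonneg _ _) (envelope_le_one _ _) hl)
          (pow_le_one₀ (envelope_nonneg _ _) (envelope_le_one _ _))
          (pow_nonneg (envelope_nonneg _ _) _) (pow_nonneg (envelope_nonneg _ _) _)
    _ ≤ (1 / (1 + ‖ξ‖)) ^ (d + 1) := by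
        rw [mul_one]
        exact pow_le_pow_left₀ (envelope_nonneg _ _) (envelope_le_inv _ _) _
    _ = ((1 + ‖ξ‖) ^ (d + 1))⁻¹ := by rw [one_div, inv_pow]

theorem auxPhi_ne_top (O : Set (Euc d)) {l : ℕ} (hl : d + 1 ≤ l) (h : GL (Fin d) ℝ) :
    auxPhi O l h ≠ ∞ :=
  ((lintegral_mono fun _ => ofReal_envelope_pow_le O hl _ _).trans_lt
    (lintegral_one_add_norm_lt_top d)).ne

theorem continuous_auxPhi (H : Subgroup (GL (Fin d) ℝ)) (O : Set (Euc d)) {l : ℕ}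
    (hl : d + 1 ≤ l) : Continuous fun h : H => auxPhi O l h.1 := by
  have := secondCountableTopology_subgroup H
  refine continuous_iff_continuousAt.2 fun h => ?_
  refine tendsto_lintegral_filter_of_dominated_convergence
    (fun ξ => ENNReal.ofReal (((1 + ‖ξ‖) ^ (d + 1))⁻¹)) (Filter.Eventually.of_forall fun k => ?_)
    (Filter.Eventually.of_forall fun k => Filter.Eventually.of_forall fun ξ =>
      ofReal_envelope_pow_le O hl _ _) (lintegral_one_add_norm_lt_top d).ne
    (Filter.Eventually.of_forall fun ξ => ?_)
  · have h1 : Continuous fun ξ => envelope O ξ := continuous_envelope O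
    have h2 : Continuous fun ξ => envelope O (dualAct k.1 ξ) :=
      h1.comp (continuous_dualAct_comp continuous_const continuous_id)
    exact ((h1.pow l).mul (h2.pow l)).measurable.ennreal_ofReal
  · have h2 : Continuous fun k : H => envelope O (dualAct k.1 ξ) :=
      (continuous_envelope O).comp (continuous_dualAct_left H ξ)
    exact (ENNReal.continuous_ofReal.comp (continuous_const.mul (h2.pow l))).tendsto h

/-- For `ξ = kᵀ ξ₀` the growth of `h` is at most the product of the growths of `k` and `k h`, and
these are compensated by `A(ξ)` and `A(hᵀ ξ)`. -/
theorem growth_mul_envelope_le {ξ₀ : Euc d} {K : ℝ} {r : ℕ}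
    (hgrow : ∀ h : H, growth h.1 * envelope (dualOrbit H ξ₀) (dualAct h.1 ξ₀) ^ r ≤ K)
    (h : H) {ξ : Euc d} (hξ : ξ ∈ dualOrbit H ξ₀) :
    growth h.1 * envelope (dualOrbit H ξ₀) ξ ^ r *
      envelope (dualOrbit H ξ₀) (dualAct h.1 ξ) ^ r ≤ K * K := by
  obtain ⟨k, rfl⟩ := hξ
  simp only
  rw [← dualAct_mul]
  have hα := pow_nonneg (envelope_nonneg (dualOrbit H ξ₀) (dualAct k.1 ξ₀)) r
  have hβ := pow_nonneg (envelope_nonneg (dualOrbit H ξ₀) (dualAct (k.1 * h.1) ξ₀)) r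
  have h1 : growth h.1 ≤ growth k.1 * growth (k.1 * h.1) := by
    have h2 := growth_mul_le (k.1)⁻¹ (k.1 * h.1)
    rwa [inv_mul_cancel_left, growth_inv] at h2
  have hk := hgrow k
  have hkh := hgrow (k * h)
  rw [Subgroup.coe_mul] at hkh
  have hNk := growth_pos k.1
  have hNkh := growth_pos (k.1 * h.1)
  calc _ ≤ growth k.1 * growth (k.1 * h.1) * envelope (dualOrbit H ξ₀) (dualAct k.1 ξ₀) ^ r *
        envelope (dualOrbit H ξ₀) (dualAct (k.1 * h.1) ξ₀) ^ r := by gcongr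
    _ = (growth k.1 * envelope (dualOrbit H ξ₀) (dualAct k.1 ξ₀) ^ r) *
        (growth (k.1 * h.1) * envelope (dualOrbit H ξ₀) (dualAct (k.1 * h.1) ξ₀) ^ r) := by ring
    _ ≤ K * K := mul_le_mul hk hkh (by positivity) ((by positivity : (0 : ℝ) ≤ _).trans hk)

/-- The factors `A^{2 m j}` give the decay `growth^{-j}`, and the remaining `A(ξ)^{d + 1}` makes the
integral over `ξ` converge. -/
theorem exists_auxPhi_le {ξ₀ : Euc d} {m : ℕ}
    (hdec : NormDecay H (dualOrbit H ξ₀) ξ₀ (m : ℝ)) (j : ℕ) :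
    ∃ C : ℝ, 0 ≤ C ∧ ∀ h : H, auxPhi (dualOrbit H ξ₀) (2 * m * j + (d + 1)) h.1 ≤
      ENNReal.ofReal (C * (growth h.1 ^ j)⁻¹) := by
  obtain ⟨K, hK, hgrow⟩ := hdec.exists_growth_le
  set I := ∫⁻ ξ : Euc d, ENNReal.ofReal (((1 + ‖ξ‖) ^ (d + 1))⁻¹) with hI
  have hIt : I ≠ ∞ := (lintegral_one_add_norm_lt_top d).ne
  refine ⟨(K * K) ^ j * I.toReal, by positivity, fun h => ?_⟩
  have hN := growth_pos h.1
  calc auxPhi (dualOrbit H ξ₀) (2 * m * j + (d + 1)) h.1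
      ≤ ∫⁻ ξ : Euc d, ENNReal.ofReal ((K * K) ^ j * (growth h.1 ^ j)⁻¹) *
          ENNReal.ofReal (((1 + ‖ξ‖) ^ (d + 1))⁻¹) := by
        refine lintegral_mono fun ξ => ?_
        by_cases hξ : ξ ∈ dualOrbit H ξ₀
        · have h1 := growth_mul_envelope_le hgrow h hξ
          set α := envelope (dualOrbit H ξ₀) ξ
          set β := envelope (dualOrbit H ξ₀) (dualAct h.1 ξ)
          have hα : 0 ≤ α := envelope_nonneg _ _
          have hβ : 0 ≤ β := envelope_nonneg _ _
          have h2 : α ^ (2 * m * j) * β ^ (2 * m * j) ≤ (K * K) ^ j * (growth h.1 ^ j)⁻¹ := by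
            rw [← div_eq_mul_inv, le_div_iff₀ (by positivity)]
            calc α ^ (2 * m * j) * β ^ (2 * m * j) * growth h.1 ^ j
                = (growth h.1 * α ^ (2 * m) * β ^ (2 * m)) ^ j := by
                  rw [pow_mul, pow_mul, mul_pow, mul_pow]; ring
              _ ≤ (K * K) ^ j := pow_le_pow_left₀ (by positivity) h1 j
          calc ENNReal.ofReal (α ^ (2 * m * j + (d + 1)) * β ^ (2 * m * j + (d + 1)))
              = ENNReal.ofReal (α ^ (2 * m * j) * β ^ (2 * m * j)) *
                  ENNReal.ofReal (α ^ (d + 1) * β ^ (d + 1)) := by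
                rw [← ENNReal.ofReal_mul (by positivity)]
                congr 1
                ring
            _ ≤ _ := mul_le_mul' (ENNReal.ofReal_le_ofReal h2)
                (ofReal_envelope_pow_le _ le_rfl _ _)
        · rw [envelope_eq_zero hξ, zero_pow (by omega), zero_mul, ENNReal.ofReal_zero]
          exact zero_le
    _ = ENNReal.ofReal ((K * K) ^ j * (growth h.1 ^ j)⁻¹) * I :=
        lintegral_const_mul' _ _ ENNReal.ofReal_ne_top
    _ = ENNReal.ofReal ((K * K) ^ j * I.toReal * (growth h.1 ^ j)⁻¹) := by
        rw [← ENNReal.ofReal_toReal hIt, ← ENNReal.ofReal_mul (by positivity),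
          ENNReal.toReal_ofReal ENNReal.toReal_nonneg]
        congr 1
        ring

end AuxPhi

/-! ### Temperate embeddedness of the dual orbit -/

section Temperate

variable {d : ℕ} {H : Subgroup (GL (Fin d) ℝ)} [MeasurableSpace H] {μ : Measure H}

theorem continuous_absDet_rpow_mul (x y : ℝ) :
    Continuous fun h : GL (Fin d) ℝ => absDet h ^ x * (1 + opNorm h) ^ y := by
  refine (continuous_absDet.rpow_const fun h => Or.inl (absDet_pos h).ne').mul
    ((continuous_const.add continuous_opNorm).rpow_const fun h => Or.inl ?_)
  exact (add_pos_of_pos_of_nonneg one_pos (opNorm_nonneg h)).ne'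

/-- If `N α^r ≤ K`, then `α^{r (k + D)}` with `D = 2 d + 1` compensates a factor `N^k` and leaves
the integrable function `N^{-D}`. -/
theorem memLp_mul_envelope [BorelSpace H]
    (hint : ∫⁻ h : H, ENNReal.ofReal ((growth h.1 ^ (2 * d + 1))⁻¹) ∂μ < ∞)
    {f : H → ℝ} (hf : Continuous f) (hf0 : ∀ h, 0 ≤ f h) {C : ℝ} {k : ℕ} (hC : 0 ≤ C)
    (hle : ∀ h : H, f h ≤ C * growth h.1 ^ k) {α : H → ℝ} (hα : Continuous α) (hα0 : ∀ h, 0 ≤ α h)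
    {K : ℝ} {r : ℕ} (hK : 0 ≤ K) (hgα : ∀ h : H, growth h.1 * α h ^ r ≤ K) {q : ℝ}
    (hq : 1 ≤ q) :
    MemLp (fun h => f h * α h ^ (r * (k + (2 * d + 1)))) (ENNReal.ofReal q) μ := by
  refine memLp_of_norm_le_inv_growth hint (hf.mul (hα.pow _))
    (C := C * K ^ (k + (2 * d + 1))) (by positivity) (fun h => ?_) hq
  change ‖f h * α h ^ (r * (k + (2 * d + 1)))‖ ≤ _
  have hN := growth_pos h.1
  have h0 := hα0 h
  rw [Real.norm_of_nonneg (mul_nonneg (hf0 h) (pow_nonneg h0 _)), ← div_eq_mul_inv,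
    le_div_iff₀ (by positivity)]
  calc f h * α h ^ (r * (k + (2 * d + 1))) * growth h.1 ^ (2 * d + 1)
      ≤ C * growth h.1 ^ k * α h ^ (r * (k + (2 * d + 1))) * growth h.1 ^ (2 * d + 1) := by
        gcongr
        exact hle h
    _ = C * (growth h.1 * α h ^ r) ^ (k + (2 * d + 1)) := by
        rw [pow_mul, mul_pow, pow_add (growth h.1)]; ring
    _ ≤ C * K ^ (k + (2 * d + 1)) :=
        mul_le_mul_of_nonneg_left (pow_le_pow_left₀ (by positivity) (hgα h) _) hC

theorem exists_temperatelyEmbedded [BorelSpace H]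
    (hint : ∫⁻ h : H, ENNReal.ofReal ((growth h.1 ^ (2 * d + 1))⁻¹) ∂μ < ∞) {O : Set (Euc d)}
    {m : ℕ} (hdec : ∀ ξ₀ ∈ O, NormDecay H O ξ₀ (m : ℝ)) {w : H → ℝ} (hw : IsWeight w)
    (hwp : PolynomiallyBounded H w) (s : ℝ) {q : ℝ} (hq : 1 ≤ q) :
    ∃ l : ℕ, TemperatelyEmbedded H μ O s q w l := by
  obtain ⟨k₁, C₁, hC₁, h₁⟩ := hwp.exists_le_growth hw.pos (1 / 2 - 1 / q) (s + d + 1)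
  obtain ⟨k₂, C₂, hC₂, h₂⟩ := hwp.exists_le_growth hw.pos (-(1 / 2) - 1 / q) (s + d + 1)
  refine ⟨2 * m * (max k₁ k₂ + (2 * d + 1)), fun ξ₀ hξ₀ => ?_⟩
  obtain ⟨K, hK, hgrow⟩ := (hdec ξ₀ hξ₀).exists_growth_le
  have hcont : ∀ x y : ℝ, Continuous fun h : H => absDet h.1 ^ x * (1 + opNorm h.1) ^ y * w h :=
    fun x y => ((continuous_absDet_rpow_mul x y).comp continuous_subtype_val).mul hw.continuous
  have hnonneg : ∀ (x y : ℝ) (h : H), 0 ≤ absDet h.1 ^ x * (1 + opNorm h.1) ^ y * w h :=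
    fun x y h => mul_nonneg (mul_nonneg (Real.rpow_nonneg (absDet_pos _).le _)
      (Real.rpow_nonneg (by linarith [opNorm_nonneg h.1]) _)) (hw.pos h).le
  have hmono : ∀ {C : ℝ} {k : ℕ}, 0 ≤ C → k ≤ max k₁ k₂ → ∀ h : H,
      C * growth h.1 ^ k ≤ C * growth h.1 ^ max k₁ k₂ := fun hC hk h =>
    mul_le_mul_of_nonneg_left (pow_le_pow_right₀ (one_le_growth _) hk) hC
  have hact : Continuous fun h : H => envelope O (dualAct h.1 ξ₀) :=
    (continuous_envelope O).comp (continuous_dualAct_left H ξ₀)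
  constructor
  · exact memLp_mul_envelope hint (hcont _ _) (hnonneg _ _) hC₁
      (fun h => (h₁ h).trans (hmono hC₁ (le_max_left _ _) h)) hact
      (fun h => envelope_nonneg _ _) hK hgrow hq
  · rw [← ENNReal.ofReal_one]
    refine memLp_mul_envelope hint (hcont _ _) (hnonneg _ _) hC₂
      (fun h => (h₂ h).trans (hmono hC₂ (le_max_right _ _) h)) (hact.comp continuous_inv)
      (fun h => envelope_nonneg _ _) hK (fun h => ?_) le_rfl
    rw [← growth_inv]
    exact hgrow h⁻¹

theorem exists_stronglyTemperatelyEmbedded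
    (hint : ∫⁻ h : H, ENNReal.ofReal ((growth h.1 ^ (2 * d + 1))⁻¹) ∂μ < ∞) {ξ₀ : Euc d}
    {m : ℕ} (hdec : NormDecay H (dualOrbit H ξ₀) ξ₀ (m : ℝ)) {w : H → ℝ} (hw : IsWeight w)
    (hwp : PolynomiallyBounded H w) (s : ℝ) :
    ∃ l : ℕ, StronglyTemperatelyEmbedded H μ (dualOrbit H ξ₀) s w l := by
  obtain ⟨k, C₁, hC₁, h₁⟩ := hwp.exists_le_growth hw.pos (-(1 / 2)) (2 * (s + d + 1))
  obtain ⟨C, hC, hΦ⟩ := exists_auxPhi_le hdec (k + (2 * d + 1))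
  have hl : d + 1 ≤ 2 * m * (k + (2 * d + 1)) + (d + 1) := Nat.le_add_left _ _
  refine ⟨2 * m * (k + (2 * d + 1)) + (d + 1), fun h => auxPhi_ne_top _ hl h.1,
    continuous_auxPhi H _ hl, fun U hU _ => ?_⟩
  obtain ⟨M, hM⟩ := (hU.image (continuous_growth.comp continuous_subtype_val)).bddAbove
  have hsup : ∀ h : H, (⨆ u ∈ U, auxPhi (dualOrbit H ξ₀)
      (2 * m * (k + (2 * d + 1)) + (d + 1)) (h * u : H).1) ≤
        ENNReal.ofReal (C * |M| ^ (k + (2 * d + 1)) * (growth h.1 ^ (k + (2 * d + 1)))⁻¹) := by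
    refine fun h => iSup₂_le fun u hu => (hΦ (h * u)).trans (ENNReal.ofReal_le_ofReal ?_)
    have hN := growth_pos h.1
    have hNu := growth_pos (h * u : H).1
    have h2 : growth h.1 ≤ |M| * growth (h * u : H).1 := by
      have h3 := growth_mul_le (h * u : H).1 (u.1)⁻¹
      rw [Subgroup.coe_mul, mul_inv_cancel_right, growth_inv, mul_comm] at h3
      exact h3.trans (mul_le_mul_of_nonneg_right ((hM ⟨u, hu, rfl⟩).trans (le_abs_self M)) hNu.le)
    rw [← div_eq_mul_inv, ← div_eq_mul_inv, div_le_div_iff₀ (by positivity) (by positivity),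
      mul_assoc, ← mul_pow]
    exact mul_le_mul_of_nonneg_left (pow_le_pow_left₀ hN.le h2 _) hC
  refine lt_of_le_of_lt (lintegral_mono (g := fun h : H =>
    ENNReal.ofReal (C * |M| ^ (k + (2 * d + 1)) * C₁) *
      ENNReal.ofReal ((growth h.1 ^ (2 * d + 1))⁻¹)) fun h => ?_) ?_
  · have hN := growth_pos h.1
    refine (mul_le_mul' (hsup h) (ENNReal.ofReal_le_ofReal (q := C₁ * growth h.1 ^ k) ?_)).trans ?_
    · refine le_trans (le_of_eq ?_) (h₁ h)
      ring
    · beta_reduce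
      rw [← ENNReal.ofReal_mul (by positivity), ← ENNReal.ofReal_mul (by positivity)]
      refine ENNReal.ofReal_le_ofReal (le_of_eq ?_)
      rw [pow_add (growth h.1)]
      field_simp
  · rw [lintegral_const_mul' _ _ ENNReal.ofReal_ne_top]
    exact ENNReal.mul_lt_top ENNReal.ofReal_lt_top hint

end Temperate

end AbelianDilation

theorem mainTheorem3 {d : ℕ} (hd : 0 < d) (H : Subgroup (GL (Fin d) ℝ))
    (hclosed : IsClosed (H : Set (GL (Fin d) ℝ)))
    (hcomm : ∀ a ∈ H, ∀ b ∈ H, a * b = b * a)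
    [MeasurableSpace H] [BorelSpace H] (μ : Measure H) [μ.IsHaarMeasure]
    (hadm : AbelianDilation.IrreduciblyAdmissible H μ) :
    Nonempty (AbelianDilation.BlockDecomposition H) ∧
    (∃! O : Set (AbelianDilation.Euc d), AbelianDilation.IsOpenDualOrbit H O) ∧
    ∀ O : Set (AbelianDilation.Euc d), AbelianDilation.IsOpenDualOrbit H O →
      (∀ B : AbelianDilation.BlockDecomposition H, ∀ ξ₀ ∈ O,
        AbelianDilation.NormDecay H O ξ₀ (2 * (B.maxNilpotencyClass : ℝ) - 1) ∧
        AbelianDilation.DetDecay H O ξ₀ (d : ℝ) ∧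
        AbelianDilation.ModularDecay H μ O ξ₀ 0) ∧
      ∀ w : H → ℝ, AbelianDilation.IsWeight w → AbelianDilation.PolynomiallyBounded H w →
        ∀ s : ℝ, 0 ≤ s →
          (∀ q : ℝ, 1 ≤ q → ∃ l : ℕ, AbelianDilation.TemperatelyEmbedded H μ O s q w l) ∧
          ∃ l : ℕ, AbelianDilation.StronglyTemperatelyEmbedded H μ O s w l := by
  obtain ⟨ξ₁, hconull⟩ := hadm.exists_conull_dualOrbit hclosed μ
  obtain ⟨S, hScomm, hS, hbij⟩ := AbelianDilation.exists_subalgebra_of_conull hcomm hconull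
  have hB := AbelianDilation.nonempty_blockDecomposition hScomm hS
  have hopen := AbelianDilation.isOpen_dualOrbit hS hbij
  refine ⟨hB, ⟨AbelianDilation.dualOrbit H ξ₁, ⟨hopen, ξ₁, rfl⟩,
    fun O hO => hO.eq_of_conull hconull⟩, fun O hO => ?_⟩
  have hnorm : ∀ B : AbelianDilation.BlockDecomposition H, ∀ ξ₀ ∈ O,
      AbelianDilation.NormDecay H O ξ₀ (2 * (B.maxNilpotencyClass : ℝ) - 1) := fun B ξ₀ hξ₀ => by
    rw [hO.eq_dualOrbit hξ₀]
    exact B.normDecay hd (hO.eq_dualOrbit hξ₀ ▸ hO.1)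
  refine ⟨fun B ξ₀ hξ₀ => ⟨hnorm B ξ₀ hξ₀, ?_, AbelianDilation.modularDecay hcomm μ O ξ₀⟩, ?_⟩
  · rw [hO.eq_dualOrbit hξ₀]
    exact B.detDecay (hO.eq_dualOrbit hξ₀ ▸ hO.1)
  intro w hw hwp s _
  have hint := AbelianDilation.lintegral_inv_growth_pow_lt_top hclosed hcomm μ hopen
    (AbelianDilation.isEmbedding_orbitMap hS hbij)
  obtain ⟨B⟩ := hB
  obtain ⟨m, hm⟩ : ∃ m : ℕ, (m : ℝ) = 2 * (B.maxNilpotencyClass : ℝ) - 1 :=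
    ⟨2 * B.maxNilpotencyClass - 1, by
      have := B.maxNilpotencyClass_pos hd
      rw [Nat.cast_sub (by omega)]
      push_cast
      ring⟩
  have hdec : ∀ ξ₀ ∈ O, AbelianDilation.NormDecay H O ξ₀ (m : ℝ) := fun ξ₀ hξ₀ => by
    rw [hm]
    exact hnorm B ξ₀ hξ₀
  refine ⟨fun q hq => AbelianDilation.exists_temperatelyEmbedded hint hdec hw hwp s hq, ?_⟩
  have hOeq := hO.eq_of_conull hconull
  rw [hOeq] at hdec ⊢
  exact AbelianDilation.exists_stronglyTemperatelyEmbedded hint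
    (hdec ξ₁ (AbelianDilation.mem_dualOrbit_self H ξ₁)) hw hwp s
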